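/- \textbf{Setting.} Let $\mathfrak d$ be a real vector space of dimension $n$, $\mathfrak d_{\mathbb C}=\mathfrak d+i\mathfrak d$ its complexification, and $\Delta\subset\mathfrak d^*$ an $n$-dimensional convex polytope with $d$ facets, $\Delta=\bigcap_{j=1}^d\{\mu\mid\langle\mu,X_j\rangle\ge\lambda_j\}$, where $X_1,\dots,X_d\in\mathfrak d$ are inward normals, one for each facet. Let $Q\subset\mathfrak d$ be a quasilattice (a $\mathbb Z$-submodule generated by a finite set spanning $\mathfrak d$) containing all $X_j$, and let $D_{\mathbb C}=\mathfrak d_{\mathbb C}/Q$. For each open face $F$ (including the interior of $\Delta$) let $I_F$ be the set of $j$ with $\langle\cdot,X_j\rangle=\lambda_j$ on $F$; a $p$-dimensional $F$ is regular if $|I_F|=n-p$ and singular if $|I_F|>n-p$. For $J\subset\{1,\dots,d\}$ and $\mathbb K=\mathbb C,\mathbb C^*$ let $\mathbb K^J$ be the set of $z\in\mathbb C^d$ with $z_j\in\mathbb K$ for $j\in J$ and $z_j=0$ for $j\notin J$; write $\mathbb K^F=\mathbb K^{I_F}$, $\mathbb K^{F^c}=\mathbb K^{I_F^c}$. Put $\mathbb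 C^d_\Delta=\bigcup_F\mathbb C^F\times(\mathbb C^*)^{F^c}$. Let $\pi_{\mathbb C}:\mathbb C^d\to\mathfrak d_{\mathbb C}$, $e_j\mapsto X_j$, let $\pi:\mathbb R^d\to\mathfrak d$ be its restriction, $\exp(Z)=(e^{2\pi iZ_j})_j\in(\mathbb C^*)^d$, $\mathfrak n=\ker\pi$, $N=\{\exp(x)\mid x\in\mathbb R^d,\ \pi(x)\in Q\}$, $A=\exp(i\mathfrak n)$ and $N_{\mathbb C}=\{\exp(Z)\mid\pi_{\mathbb C}(Z)\in Q\}$; these groups act on $\mathbb C^d_\Delta$ coordinatewise. Let $X_\Delta$ be the quotient of $\mathbb C^d_\Delta$, with the quotient topology, by the equivalence relation $z\sim w\iff N(\overline{Az})\cap\overline{Aw}\ne\emptyset$ (closures in $\mathbb C^d_\Delta$). For a face $F$ let $O_F$ be the image of $(\mathbb C^*)^{F^c}$ in $X_\Delta$. The pieces of $X_\Delta$ are $\mathcal T_{\max}$, the image of $\bigcup_{F\text{ regular}}\mathbb C^F\times(\mathbb C^*)^{F^c}$, and, for each singular face $F$, $\mathcal T_F$, the image of $\{z\mid\overline{Az}\cap(\mathbb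 C^*)^{F^c}\ne\emptyset\}$; they carry the subspace topology. \textbf{Charts.} Let $\mathcal I$ be the family of $I\subset\{1,\dots,d\}$ such that $(X_j)_{j\in I}$ is a basis of $\mathfrak d$ and $I\subset I_\mu$ for some vertex $\mu$ of $\Delta$; let $\Gamma_I$ be the group of $t\in N$ with $t_j=1$ for $j\notin I$. For $I\in\mathcal I$, $\mathcal T_{\max}$ has the chart $\tilde V_I\to\mathcal T_{\max}$, $z\mapsto[p_I(z)]$, with group $\Gamma_I$, where $p_I$ fills in the coordinates outside $I$ with $1$ and $\tilde V_I\subset\mathbb C^I$ is the set of $z$ such that the vanishing coordinates of $p_I(z)$ are exactly those in $I_F$ for some regular face $F$. For a singular $p$-dimensional $F$ and $I\in\mathcal I$ with $|I\cap I_F|=n-p$, $\mathcal T_F$ has the chart $(\mathbb C^*)^{I\setminus I_F}\to\mathcal T_F$ that fills in $0$ on $I_F$ and $1$ outside $I\cup I_F$, with group $\Gamma_I/\{t\in\Gamma_I\mid t_j=1\text{ for }j\notin I_F\}$. $D_{\mathbb C}$ has the chart $\mathfrak d_{\mathbb C}\to D_{\mathbb C}$ with group $Q$ (with $\mathfrak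 d_{\mathbb C}\cong\mathbb C^n$ by any real basis of $\mathfrak d$). A map between complex quasifolds is holomorphic if it is continuous and lifts locally, through charts, to holomorphic maps. \textbf{Proposition.} With these charts $D_{\mathbb C}$ and $\mathcal T_{\max}$ are complex quasifolds of dimension $n$, and, for each singular face $F$, $\mathcal T_F$ is a complex quasifold of dimension $\dim F$. There is an action of $D_{\mathbb C}$ on $X_\Delta$ with $[\pi_{\mathbb C}(Z)]\cdot[z]=[\exp(Z)z]$ for all $Z\in\mathbb C^d$, $z\in\mathbb C^d_\Delta$, and: \begin{enumerate} \item the action map $D_{\mathbb C}\times X_\Delta\to X_\Delta$ is continuous; \item for each face $F$ the set $O_F$ is a $D_{\mathbb C}$-orbit, and the orbit $O_{\mathrm{int}\,\Delta}$ corresponding to the interior of $\Delta$ is open and dense in $X_\Delta$; \item each piece $\mathcal T$ ($\mathcal T_{\max}$, and $\mathcal T_F$ for $F$ singular) is invariant, and the restricted action $D_{\mathbb C}\times\mathcal T\to\mathcal T$ is holomorphic; \item for each singular face $F$, $\mathcal T_F=O_F$, and the map $(\mathbb C^*)^{F^c}\to\mathcal T_F$ induces a homeomorphism $(\mathbb C^*)^{F^c}/N_{\mathbb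 C}\cong\mathcal T_F$; moreover $\mathcal T_{\max}$ is the union of the $O_F$ over the regular faces $F$. \end{enumerate} -/

import Mathlib

open scoped TensorProduct Topology

universe u v w v'

/-! ### Complex quasifolds -/

/-- The data of a complex quasifold chart on `X`: a subset `dom` of a finite-dimensional complex
vector space `E`, a group `Γ` acting on `dom` (through `act`, whose values outside `dom` are
irrelevant), and the composite `proj : dom → dom / Γ ≃ V ⊆ X` of the quotient map with the
homeomorphism onto the domain `V` of the chart. The laws are in `ComplexChart.IsChart`. -/
structure ComplexChart (X : Type u) where
  E : Type
  [normedAddCommGroup : NormedAddCommGroup E]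
  [normedSpace : NormedSpace ℂ E]
  [finiteDimensional : FiniteDimensional ℂ E]
  dom : Set E
  Γ : Type v
  [group : Group Γ]
  act : Γ → E → E
  proj : dom → X

namespace ComplexChart

attribute [instance] ComplexChart.normedAddCommGroup ComplexChart.normedSpace
  ComplexChart.finiteDimensional ComplexChart.group

/-- The set of points of `dom` at which the action of `Γ` is not free. -/
def nonFree {X : Type u} (c : ComplexChart.{u, v} X) : Set c.E :=
  {x | x ∈ c.dom ∧ ∃ γ : c.Γ, γ ≠ 1 ∧ c.act γ x = x}

/-- `c` is a complex quasifold chart of the topological space `X`: `dom` is a connected open set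
on which the (discrete) group `Γ` acts by biholomorphisms, the set of points where the action is
not free is closed in `dom` and of real codimension at least two (it is empty, or its Hausdorff
dimension is at most `dim_ℝ E - 2`), and `proj` induces a homeomorphism from `dom / Γ` onto an open
subset of `X` (it is continuous and open, and its fibres are the `Γ`-orbits). -/
structure IsChart {X : Type u} [TopologicalSpace X] (c : ComplexChart.{u, v} X) : Prop where
  isOpen_dom : IsOpen c.dom
  isConnected_dom : IsConnected c.dom
  mapsTo : ∀ γ, Set.MapsTo (c.act γ) c.dom c.dom
  one_act : ∀ x ∈ c.dom, c.act 1 x = x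
  mul_act : ∀ γ γ', ∀ x ∈ c.dom, c.act (γ * γ') x = c.act γ (c.act γ' x)
  holomorphic : ∀ γ, DifferentiableOn ℂ (c.act γ) c.dom
  closed_nonFree : IsClosed {x : c.dom | (x : c.E) ∈ c.nonFree}
  codim_nonFree : c.nonFree = ∅ ∨ dimH c.nonFree + 2 ≤ ((2 * Module.finrank ℂ c.E : ℕ) : ENNReal)
  continuous_proj : Continuous c.proj
  isOpenMap_proj : IsOpenMap c.proj
  proj_eq_iff : ∀ x y : c.dom, c.proj x = c.proj y ↔ ∃ γ : c.Γ, c.act γ x = y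

/-- Two charts are compatible: whenever `x` and `y` lie over the same point of `X`, the change of
charts lifts to a biholomorphism from a neighbourhood of `x` to a neighbourhood of `y`. -/
def Compatible {X : Type u} (c c' : ComplexChart.{u, v} X) : Prop :=
  ∀ (x : c.dom) (y : c'.dom), c.proj x = c'.proj y →
    ∃ h : OpenPartialHomeomorph c.E c'.E,
      (x : c.E) ∈ h.source ∧ h x = y ∧ h.source ⊆ c.dom ∧ h.target ⊆ c'.dom ∧
      DifferentiableOn ℂ h h.source ∧ DifferentiableOn ℂ h.symm h.target ∧
      ∀ u : c.dom, (u : c.E) ∈ h.source → ∃ hu : h u ∈ c'.dom, c'.proj ⟨h u, hu⟩ = c.proj u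

/-- The product of two charts. -/
noncomputable def prod {X : Type u} {Y : Type w} (c : ComplexChart.{u, v} X) (c' : ComplexChart.{w, v'} Y) :
    ComplexChart.{max u w, max v v'} (X × Y) where
  E := c.E × c'.E
  dom := c.dom ×ˢ c'.dom
  Γ := c.Γ × c'.Γ
  act γ x := (c.act γ.1 x.1, c'.act γ.2 x.2)
  proj x := (c.proj ⟨x.1.1, x.2.1⟩, c'.proj ⟨x.1.2, x.2.2⟩)

end ComplexChart

/-- The family `𝒜` of charts makes `X` a complex quasifold of complex dimension `k`. -/
structure IsComplexQuasifold {X : Type u} [TopologicalSpace X] {α : Type*} (k : ℕ)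
    (𝒜 : α → ComplexChart.{u, v} X) : Prop where
  isChart : ∀ i, (𝒜 i).IsChart
  finrank_eq : ∀ i, Module.finrank ℂ (𝒜 i).E = k
  cover : ∀ x : X, ∃ i, x ∈ Set.range (𝒜 i).proj
  compatible : ∀ i j, (𝒜 i).Compatible (𝒜 j)

/-- A continuous map is holomorphic with respect to the atlases `𝒜` and `ℬ` if near each point
of each chart of `𝒜` it lifts to a holomorphic map into some chart of `ℬ`. -/
def IsHolomorphicMap {X : Type u} {Y : Type w} [TopologicalSpace X] [TopologicalSpace Y]
    {α β : Type*} (𝒜 : α → ComplexChart.{u, v} X) (ℬ : β → ComplexChart.{w, v'} Y)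
    (f : X → Y) : Prop :=
  Continuous f ∧ ∀ (i : α) (x : (𝒜 i).dom), ∃ (j : β) (U : Set (𝒜 i).E) (g : (𝒜 i).E → (ℬ j).E),
    IsOpen U ∧ (x : (𝒜 i).E) ∈ U ∧ U ⊆ (𝒜 i).dom ∧ DifferentiableOn ℂ g U ∧
    ∀ u : (𝒜 i).dom, (u : (𝒜 i).E) ∈ U →
      ∃ hu : g u ∈ (ℬ j).dom, (ℬ j).proj ⟨g u, hu⟩ = f ((𝒜 i).proj u)

/-! ### The complexification of a real vector space -/

/-- The complexification `𝔡 + i𝔡` of a real vector space. -/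
def Complexification (𝔡 : Type u) [AddCommGroup 𝔡] [Module ℝ 𝔡] : Type u := ℂ ⊗[ℝ] 𝔡

namespace Complexification

variable {𝔡 : Type u} [AddCommGroup 𝔡] [Module ℝ 𝔡]

noncomputable instance : AddCommGroup (Complexification 𝔡) :=
  inferInstanceAs (AddCommGroup (ℂ ⊗[ℝ] 𝔡))

noncomputable instance : Module ℂ (Complexification 𝔡) :=
  inferInstanceAs (Module ℂ (ℂ ⊗[ℝ] 𝔡))

/-- The canonical vector space topology; in finite dimension, the usual one. -/
noncomputable instance : TopologicalSpace (Complexification 𝔡) := moduleTopology ℂ (Complexification 𝔡)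

/-- The inclusion of `𝔡` into its complexification, as a homomorphism of groups. -/
noncomputable def incl : 𝔡 →+ Complexification 𝔡 :=
  (TensorProduct.mk ℝ ℂ 𝔡 1).toAddMonoidHom

end Complexification

/-! ### Polytopes with normals and a quasilattice -/

/-- A quasilattice: a `ℤ`-submodule generated by a finite set of vectors spanning `𝔡` over `ℝ`. -/
def IsQuasilattice {𝔡 : Type u} [AddCommGroup 𝔡] [Module ℝ 𝔡] (Q : AddSubgroup 𝔡) : Prop :=
  ∃ s : Finset 𝔡, Submodule.span ℝ (s : Set 𝔡) = ⊤ ∧ AddSubgroup.closure (s : Set 𝔡) = Q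

/-- A full-dimensional convex polytope `Δ` in the dual of `𝔡`, with an inward normal vector `X j`
for each of its `d` facets, and a quasilattice `Q` containing these normals. -/
structure ToricDatum (𝔡 : Type u) [AddCommGroup 𝔡] [Module ℝ 𝔡] (d : ℕ) where
  Δ : Set (Module.Dual ℝ 𝔡)
  X : Fin d → 𝔡
  lam : Fin d → ℝ
  Q : AddSubgroup 𝔡
  isPolytope : ∃ s : Set (Module.Dual ℝ 𝔡), s.Finite ∧ convexHull ℝ s = Δ
  fullDim : affineSpan ℝ Δ = ⊤
  eq_halfSpaces : Δ = {μ | ∀ j, lam j ≤ μ (X j)}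
  facet_nonempty : ∀ j, {μ ∈ Δ | μ (X j) = lam j}.Nonempty
  facet_dim : ∀ j, Module.finrank ℝ (vectorSpan ℝ {μ ∈ Δ | μ (X j) = lam j}) + 1 =
    Module.finrank ℝ 𝔡
  facet_injective : Function.Injective fun j => {μ ∈ Δ | μ (X j) = lam j}
  isQuasilattice : IsQuasilattice Q
  mem_Q : ∀ j, X j ∈ Q

namespace ToricDatum

variable {𝔡 : Type u} [AddCommGroup 𝔡] [Module ℝ 𝔡] {d : ℕ} (P : ToricDatum 𝔡 d)

/-- The open face of `Δ` on which exactly the inequalities indexed by `F` are equalities. -/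
def openFace (F : Finset (Fin d)) : Set (Module.Dual ℝ 𝔡) :=
  {μ ∈ P.Δ | ∀ j, μ (P.X j) = P.lam j ↔ j ∈ F}

/-- `F` is the index set of a face of `Δ`. Faces are referred to by their index sets; the
interior of `Δ` corresponds to `∅`. -/
def IsFace (F : Finset (Fin d)) : Prop := (P.openFace F).Nonempty

/-- The dimension of the face with index set `F`. -/
noncomputable def faceDim (F : Finset (Fin d)) : ℕ :=
  Module.finrank ℝ (vectorSpan ℝ (P.openFace F))

/-- A `p`-dimensional face is regular if it lies on exactly `n - p` facets. -/
def IsRegular (F : Finset (Fin d)) : Prop :=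
  P.IsFace F ∧ F.card + P.faceDim F = Module.finrank ℝ 𝔡

/-- A `p`-dimensional face is singular if it lies on more than `n - p` facets. -/
def IsSingular (F : Finset (Fin d)) : Prop :=
  P.IsFace F ∧ Module.finrank ℝ 𝔡 < F.card + P.faceDim F

/-- The open subset `ℂ^d_Δ` of `ℂ^d`, the union over the faces `F` of `ℂ^F × (ℂ^*)^{F^c}`. -/
def CΔ : Set (Fin d → ℂ) :=
  {z | ∃ F, P.IsFace F ∧ ∀ j, z j = 0 → j ∈ F}

/-! ### The complex torus and its subgroups -/

/-- The exponential map `ℂ^d → ℂ^d / ℤ^d = (ℂ^*)^d`. -/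
noncomputable def expC (Z : Fin d → ℂ) : Fin d → ℂˣ := fun j =>
  Units.mk0 (Complex.exp (2 * Real.pi * Complex.I * Z j)) (Complex.exp_ne_zero _)

theorem expC_zero : expC (0 : Fin d → ℂ) = 1 := by
  ext j; simp [expC]

theorem expC_add (Z W : Fin d → ℂ) : expC (Z + W) = expC Z * expC W := by
  ext j; simp [expC, mul_add, Complex.exp_add]

theorem expC_neg (Z : Fin d → ℂ) : expC (-Z) = (expC Z)⁻¹ := by
  ext j; simp [expC, Complex.exp_neg]

/-- The map `π : ℝ^d → 𝔡` sending `e_j` to `X j`. -/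
noncomputable def π : (Fin d → ℝ) →+ 𝔡 := (Fintype.linearCombination ℝ P.X).toAddMonoidHom

/-- The map `π_ℂ : ℂ^d → 𝔡_ℂ` sending `e_j` to `X j`. -/
noncomputable def πC : (Fin d → ℂ) →+ Complexification 𝔡 :=
  (Fintype.linearCombination ℂ fun j => Complexification.incl (P.X j)).toAddMonoidHom

/-- `Q` as a subgroup of the complexification of `𝔡`. -/
noncomputable def QC : AddSubgroup (Complexification 𝔡) := P.Q.map Complexification.incl

/-- The complex quasitorus `D_ℂ = 𝔡_ℂ / Q`, with the quotient topology. -/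
abbrev DC : Type u := Complexification 𝔡 ⧸ P.QC

/-- The group `N`, the kernel of the homomorphism `ℝ^d / ℤ^d → 𝔡 / Q` induced by `π`, as a
subgroup of `(ℂ^*)^d`. -/
def N : Subgroup (Fin d → ℂˣ) where
  carrier := {t | ∃ x : Fin d → ℝ, P.π x ∈ P.Q ∧ t = expC fun j => (x j : ℂ)}
  one_mem' := ⟨0, by simp [P.Q.zero_mem], by rw [← expC_zero]; congr 1⟩
  mul_mem' := by
    rintro _ _ ⟨x, hx, rfl⟩ ⟨y, hy, rfl⟩
    refine ⟨x + y, by simpa using P.Q.add_mem hx hy, ?_⟩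
    rw [← expC_add]; congr 1; ext j; simp
  inv_mem' := by
    rintro _ ⟨x, hx, rfl⟩
    refine ⟨-x, by simpa using hx, ?_⟩
    rw [← expC_neg]; congr 1; ext j; simp

/-- The group `A = exp (i𝔫)`, where `𝔫` is the kernel of `π`. -/
def A : Subgroup (Fin d → ℂˣ) where
  carrier := {t | ∃ y : Fin d → ℝ, P.π y = 0 ∧ t = expC fun j => Complex.I * y j}
  one_mem' := ⟨0, by simp, by rw [← expC_zero]; congr 1; ext j; simp⟩
  mul_mem' := by
    rintro _ _ ⟨x, hx, rfl⟩ ⟨y, hy, rfl⟩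
    refine ⟨x + y, by simp [hx, hy], ?_⟩
    rw [← expC_add]; congr 1; ext j; simp [mul_add]
  inv_mem' := by
    rintro _ ⟨x, hx, rfl⟩
    refine ⟨-x, by simp [hx], ?_⟩
    rw [← expC_neg]; congr 1; ext j; simp

/-- The group `N_ℂ`, the kernel of the homomorphism `ℂ^d / ℤ^d → 𝔡_ℂ / Q` induced by `π_ℂ`. -/
def NC : Subgroup (Fin d → ℂˣ) where
  carrier := {t | ∃ Z : Fin d → ℂ, P.πC Z ∈ P.QC ∧ t = expC Z}
  one_mem' := ⟨0, by simp [P.QC.zero_mem], expC_zero.symm⟩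
  mul_mem' := by
    rintro _ _ ⟨x, hx, rfl⟩ ⟨y, hy, rfl⟩
    exact ⟨x + y, by simpa using P.QC.add_mem hx hy, (expC_add x y).symm⟩
  inv_mem' := by
    rintro _ ⟨x, hx, rfl⟩
    exact ⟨-x, by simpa using hx, (expC_neg x).symm⟩

/-- `(ℂ^*)^d` acts on `ℂ^d_Δ` by coordinatewise multiplication. -/
instance : MulAction (Fin d → ℂˣ) P.CΔ where
  smul t z := ⟨fun j => (t j : ℂ) * (z : Fin d → ℂ) j, by
    obtain ⟨F, hF, h⟩ := z.2
    exact ⟨F, hF, fun j hj => h j (by simpa using hj)⟩⟩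
  one_smul z := Subtype.ext (funext fun j => one_mul _)
  mul_smul t s z := Subtype.ext (funext fun j => mul_assoc _ _ _)

/-! ### The quotient and its pieces -/

/-- `z` and `w` are equivalent if the `N`-saturation of the closure in `ℂ^d_Δ` of the orbit `A z`
meets the closure in `ℂ^d_Δ` of the orbit `A w`. -/
def rel (z w : P.CΔ) : Prop :=
  ∃ t ∈ P.N, ∃ u ∈ closure (MulAction.orbit P.A z), t • u ∈ closure (MulAction.orbit P.A w)

/-- The space `X_Δ = ℂ^d_Δ // N_ℂ`, the quotient of `ℂ^d_Δ` by (the equivalence relation) `rel`,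
with the quotient topology. -/
abbrev Space : Type := Quot P.rel

/-- The projection `ℂ^d_Δ → X_Δ`. -/
def toSpace (z : P.CΔ) : P.Space := Quot.mk P.rel z

/-- The set `(ℂ^*)^{F^c}` of the points whose vanishing coordinates are exactly those in `F`. -/
def coordStratum (F : Finset (Fin d)) : Set P.CΔ :=
  {z | ∀ j, (z : Fin d → ℂ) j = 0 ↔ j ∈ F}

/-- The image of `(ℂ^*)^{F^c}` in `X_Δ`. -/
def faceOrbit (F : Finset (Fin d)) : Set P.Space := P.toSpace '' P.coordStratum F

/-- The maximal piece: the image in `X_Δ` of the union over the regular faces `F` of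
`ℂ^F × (ℂ^*)^{F^c}`. -/
def maxPiece : Set P.Space :=
  P.toSpace '' {z | ∃ F, P.IsRegular F ∧ ∀ j, (z : Fin d → ℂ) j = 0 → j ∈ F}

/-- The piece of the singular face `F`: the image in `X_Δ` of the set of points `z` such that the
closure of `A z` meets `(ℂ^*)^{F^c}`. -/
def piece (F : Finset (Fin d)) : Set P.Space :=
  P.toSpace '' {z | (closure (MulAction.orbit P.A z) ∩ P.coordStratum F).Nonempty}

/-! ### The atlases -/

/-- The chart of the complex quasitorus given by a basis `b` of `𝔡`: it identifies `ℂ^n` with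
`𝔡_ℂ`, on which `Q` acts by translations. -/
noncomputable def quasitorusChart
    (b : Module.Basis (Fin (Module.finrank ℝ 𝔡)) ℝ 𝔡) : ComplexChart.{u, u} P.DC where
  E := Fin (Module.finrank ℝ 𝔡) → ℂ
  dom := Set.univ
  Γ := Multiplicative P.Q
  act q y := fun k => y k + (b.repr (Multiplicative.toAdd q : P.Q) k : ℂ)
  proj y := QuotientAddGroup.mk (∑ k, (y : Fin (Module.finrank ℝ 𝔡) → ℂ) k •
    Complexification.incl (b k))

/-- The family `𝓘` of index sets `I` such that the `X j`, `j ∈ I`, form a basis of `𝔡` and `I` is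
contained in the index set of a vertex of `Δ`. -/
def IsBasisSet (I : Finset (Fin d)) : Prop :=
  LinearIndependent ℝ (fun j : I => P.X j) ∧ Submodule.span ℝ (P.X '' I) = ⊤ ∧
    ∃ μ ∈ P.Δ.extremePoints ℝ, ∀ j ∈ I, μ (P.X j) = P.lam j

/-- The group `Γ_I`, the intersection of `N` with the torus of the `t` with `t j = 1` for
`j ∉ I`. -/
def ΓI (I : Finset (Fin d)) : Subgroup (Fin d → ℂˣ) where
  carrier := {t | t ∈ P.N ∧ ∀ j, j ∉ I → t j = 1}
  one_mem' := ⟨P.N.one_mem, fun _ _ => rfl⟩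
  mul_mem' := fun ha hb => ⟨P.N.mul_mem ha.1 hb.1, fun j hj => by
    simp [ha.2 j hj, hb.2 j hj]⟩
  inv_mem' := fun ha => ⟨P.N.inv_mem ha.1, fun j hj => by simp [ha.2 j hj]⟩

/-- The map `p_I : ℂ^I → ℂ^d` that fills in the coordinates outside `I` with `1`. -/
def pI (I : Finset (Fin d)) (z : I → ℂ) : Fin d → ℂ :=
  fun j => if h : j ∈ I then z ⟨j, h⟩ else 1

/-- The chart of the maximal piece given by `I ∈ 𝓘`: the group `Γ_I` acts on the set of the
`z ∈ ℂ^I` such that the vanishing coordinates of `p_I z` are exactly those of a regular face. -/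
noncomputable def maxChart (I : {I : Finset (Fin d) // P.IsBasisSet I}) : ComplexChart.{0, 0} P.maxPiece where
  E := I.1 → ℂ
  dom := {z | ∃ F, P.IsRegular F ∧ ∀ j, pI I.1 z j = 0 ↔ j ∈ F}
  Γ := P.ΓI I.1
  act γ z := fun j => ((γ : Fin d → ℂˣ) j : ℂ) * z j
  proj z := ⟨P.toSpace ⟨pI I.1 z, by
      obtain ⟨F, hF, h⟩ := z.2
      exact ⟨F, hF.1, fun j hj => (h j).1 hj⟩⟩, _, by
      obtain ⟨F, hF, h⟩ := z.2
      exact ⟨F, hF, fun j hj => (h j).1 hj⟩, rfl⟩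

/-- The homomorphism that restricts an element of `(ℂ^*)^d` to the coordinates in `J`. -/
def restrict (J : Finset (Fin d)) : (Fin d → ℂˣ) →* (J → ℂˣ) where
  toFun t := fun j => t j
  map_one' := rfl
  map_mul' _ _ := rfl

/-- The map `p_F : (ℂ^*)^{I \ F} → (ℂ^*)^{F^c}` that fills in the coordinates outside `I ∪ F`
with `1`, and those in `F` with `0`. -/
def pF (F I : Finset (Fin d)) (z : ↥(I \ F) → ℂ) : Fin d → ℂ :=
  fun j => if h : j ∈ I \ F then z ⟨j, h⟩ else if j ∈ F then 0 else 1

theorem pF_eq_zero_iff {F I : Finset (Fin d)} {z : ↥(I \ F) → ℂ} (hz : ∀ j, z j ≠ 0) (j : Fin d) :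
    pF F I z j = 0 ↔ j ∈ F := by
  unfold pF
  split_ifs with h h'
  · simp [hz, (Finset.mem_sdiff.1 h).2]
  · simp [h']
  · simp [h']

/-- The chart of the piece of a singular face `F` given by `I ∈ 𝓘` with `card (I ∩ F) = n - p`,
where `p` is the dimension of the face: the quotient of `Γ_I` by the subgroup of the elements with
`t j = 1` for all `j ∉ F`, that is, the image of `Γ_I` under restriction to the coordinates in
`I \ F`, acts on `(ℂ^*)^{I \ F}`. -/
noncomputable def pieceChart (F : Finset (Fin d)) (hF : P.IsSingular F)
    (I : {I : Finset (Fin d) // P.IsBasisSet I ∧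
      (I ∩ F).card + P.faceDim F = Module.finrank ℝ 𝔡}) :
    ComplexChart.{0, 0} (P.piece F) where
  E := ↥(I.1 \ F) → ℂ
  dom := {z | ∀ j, z j ≠ 0}
  Γ := (P.ΓI I.1).map (restrict (I.1 \ F))
  act γ z := fun j => ((γ : ↥(I.1 \ F) → ℂˣ) j : ℂ) * z j
  proj z := ⟨P.toSpace ⟨pF F I.1 z, F, hF.1, fun j hj => (pF_eq_zero_iff z.2 j).1 hj⟩, _,
    ⟨_, subset_closure (MulAction.mem_orbit_self _), fun j => pF_eq_zero_iff z.2 j⟩, rfl⟩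

/-- The atlas of the product of the complex quasitorus and a space `T` with atlas `𝒜`. -/
noncomputable def prodAtlas {T : Type} {α : Type*} (𝒜 : α → ComplexChart.{0, 0} T) :
    Module.Basis (Fin (Module.finrank ℝ 𝔡)) ℝ 𝔡 × α → ComplexChart.{u, u} (P.DC × T) :=
  fun i => (P.quasitorusChart i.1).prod (𝒜 i.2)

/-- The subset `T` of `X_Δ` is invariant under the given action of the complex quasitorus, and the
restricted action `D_ℂ × T → T` is holomorphic with respect to the atlas `𝒜` of `T`. -/
def ActsHolomorphicallyOn [AddAction P.DC P.Space] (T : Set P.Space) {α : Type*}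
    (𝒜 : α → ComplexChart.{0, 0} T) : Prop :=
  ∃ h : ∀ (g : P.DC), ∀ x ∈ T, g +ᵥ x ∈ T,
    IsHolomorphicMap (P.prodAtlas 𝒜) 𝒜 fun p : P.DC × T => ⟨p.1 +ᵥ (p.2 : P.Space), h p.1 p.2 p.2.2⟩

end ToricDatum

/-! Everything rests on a normal form for `rel`. To a point z attach `face z`, the smallest index
set of a face that contains the vanishing coordinates of z (index sets of faces are closed under
intersection), and `retr z`, in which all coordinates in `face z` are replaced by zeros. A theorem
of the alternative provides a linear relation between the normals in `face z` that is positive at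
the coordinates still to be killed (`exists_relation_minFace`), and the corresponding one-parameter
subgroup of A drives z to `retr z`. Conversely, an A-invariant monomial in the moduli shows that the
face is constant on the closure of A z, and outside the face the orbit is, in logarithmic
coordinates, a translate of a linear subspace, hence closed. So every w in the closure has `retr w`
in the A-orbit of `retr z` (`retr_mem_orbit`). As N_ℂ = N A, `rel z w` means that `retr z` and `retr
w` lie in one N_ℂ-orbit (`rel_iff`).

Hence X_Δ is, as a set, the disjoint union over the faces of the quotients (ℂ^*)^{F^c} / N_ℂ. The
torus (ℂ^*)^d commutes with N_ℂ and with `retr` and is transitive on each stratum, which gives the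
action of D_ℂ and its orbits. Every subset of the index set of a regular face is again one, so
`retr` is the identity over the maximal piece.

The charts are slices. If the normals in I form a basis, any values outside I extend uniquely to an
element of the kernel of π_ℂ; applied to logarithms of coordinates, this moves a point into the
slice where the coordinates outside I are 1, locally holomorphically. Openness of the charts,
covering and transition maps all follow. The construction is made for a family of vectors in any
real vector space because it is used twice: in 𝔡 for the maximal piece, and in 𝔡 modulo the normals
of F for 𝒯_F. On a slice, D_ℂ acts by exponentials of its coordinates in the basis I, so the action
lifts to holomorphic maps. -/

/-! ### Slices of the action of an exponentiated kernel on `ℂ^κ` -/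

namespace TorusSlice

/-! ### The exponential and the principal logarithm, coordinatewise -/

section Exp

variable {κ : Type*}

/-- The coordinatewise exponential `Z ↦ exp (2 π i Z)`. -/
noncomputable def cexp (Z : κ → ℂ) : κ → ℂ := fun j => Complex.exp (2 * Real.pi * Complex.I * Z j)

theorem cexp_ne_zero (Z : κ → ℂ) (j : κ) : cexp Z j ≠ 0 := Complex.exp_ne_zero _

theorem cexp_zero : cexp (0 : κ → ℂ) = 1 := by
  ext j; simp [cexp]

theorem cexp_add (Z W : κ → ℂ) : cexp (Z + W) = cexp Z * cexp W := by
  ext j; simp [cexp, mul_add, Complex.exp_add]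

theorem cexp_neg_mul (Z : κ → ℂ) : cexp (-Z) * cexp Z = 1 := by
  rw [← cexp_add, neg_add_cancel, cexp_zero]

theorem cexp_mul_neg (Z : κ → ℂ) : cexp Z * cexp (-Z) = 1 := by
  rw [← cexp_add, add_neg_cancel, cexp_zero]

/-- The principal logarithm inverting `cexp`, with the opposite sign. -/
noncomputable def negLog (z : κ → ℂ) : κ → ℂ :=
  fun j => -(2 * Real.pi * Complex.I)⁻¹ * Complex.log (z j)

theorem cexp_negLog_mul {z : κ → ℂ} {j : κ} (hz : z j ≠ 0) : cexp (negLog z) j * z j = 1 := by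
  have h : (2 * Real.pi * Complex.I : ℂ) ≠ 0 := Complex.two_pi_I_ne_zero
  have : 2 * Real.pi * Complex.I * negLog z j = -Complex.log (z j) := by
    rw [negLog]; field_simp
  rw [cexp, this, Complex.exp_neg, Complex.exp_log hz, inv_mul_cancel₀ hz]

theorem negLog_eq_zero {z : κ → ℂ} {j : κ} (hz : z j = 1) : negLog z j = 0 := by
  simp [negLog, hz]

/-- The bound puts the imaginary part of 2πi W_j inside (-π, π), where the principal logarithm
inverts the exponential. -/
theorem negLog_cexp {W : κ → ℂ} {j : κ} (h : |(W j).re| < 1 / 2) :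
    negLog (cexp W) j = -W j := by
  have h0 : (2 * Real.pi * Complex.I : ℂ) ≠ 0 := Complex.two_pi_I_ne_zero
  have him : (2 * Real.pi * Complex.I * W j).im = 2 * Real.pi * (W j).re := by simp
  have hpi := Real.pi_pos
  rw [abs_lt] at h
  rw [negLog, cexp, Complex.log_exp]
  · field_simp
  · rw [him]; nlinarith
  · rw [him]; nlinarith

theorem differentiableAt_negLog [Fintype κ] {z : κ → ℂ} {j : κ} (h : z j ∈ Complex.slitPlane) :
    DifferentiableAt ℂ (fun z : κ → ℂ => negLog z j) z := by
  unfold negLog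
  exact ((differentiableAt_apply (𝕜 := ℂ) j z).clog h).const_mul _

end Exp

/-! ### Logarithms of the acting group -/

section LogGroup

variable {κ V : Type*} [Fintype κ] [AddCommGroup V] [Module ℝ V]

/-- The group of the `Z ∈ ℂ^κ` that the complexification of `e_j ↦ X j` maps into `Q`. -/
def logGroup (X : κ → V) (Q : AddSubgroup V) : AddSubgroup (κ → ℂ) where
  carrier := {Z | ∑ j, (Z j).re • X j ∈ Q ∧ ∑ j, (Z j).im • X j = 0}
  zero_mem' := by simp [Q.zero_mem]
  add_mem' := by
    rintro Z W ⟨h1, h2⟩ ⟨h3, h4⟩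
    refine ⟨?_, ?_⟩
    · simpa [add_smul, Finset.sum_add_distrib] using Q.add_mem h1 h3
    · simp [add_smul, Finset.sum_add_distrib, h2, h4]
  neg_mem' := by
    rintro Z ⟨h1, h2⟩
    refine ⟨?_, ?_⟩
    · simpa [neg_smul] using h1
    · simp [neg_smul, h2]

theorem mem_logGroup {X : κ → V} {Q : AddSubgroup V} {Z : κ → ℂ} :
    Z ∈ logGroup X Q ↔ ∑ j, (Z j).re • X j ∈ Q ∧ ∑ j, (Z j).im • X j = 0 := Iff.rfl

theorem logGroup_mono (X : κ → V) {Q Q' : AddSubgroup V} (h : Q ≤ Q') :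
    logGroup X Q ≤ logGroup X Q' := fun _ hZ => ⟨h hZ.1, hZ.2⟩

end LogGroup

/-! ### The embedding of a slice -/

section Fill

variable {κ α : Type*} {e : α → κ}

/-- Fill in the coordinates outside the range of `e` with `1`. -/
noncomputable def fill (e : α → κ) (u : α → ℂ) : κ → ℂ := Function.extend e u 1

theorem fill_apply (he : e.Injective) (u : α → ℂ) (i : α) : fill e u (e i) = u i :=
  he.extend_apply _ _ _

theorem fill_of_notMem (u : α → ℂ) {j : κ} (hj : j ∉ Set.range e) : fill e u j = 1 :=
  Function.extend_apply' _ _ _ hj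

theorem differentiable_fill [Fintype κ] [Fintype α] (he : e.Injective) :
    Differentiable ℂ (fill e) := by
  refine differentiable_pi.2 fun j => ?_
  by_cases hj : j ∈ Set.range e
  · obtain ⟨i, rfl⟩ := hj
    simp only [fill_apply he]
    exact differentiable_apply i
  · simp only [fill_of_notMem _ hj]
    exact differentiable_const _

end Fill

/-! ### Moving points into a slice -/

section Slice

variable {κ V α : Type*} [Fintype κ] [Fintype α] [AddCommGroup V] [Module ℝ V]
  {X : κ → V} {e : α → κ} {b : Module.Basis α ℝ V}

open Classical in
theorem sum_eq_sum_range_add {M : Type*} [AddCommMonoid M] (he : e.Injective) (f : κ → M) :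
    ∑ j, f j = ∑ i, f (e i) + ∑ j, if j ∈ Set.range e then 0 else f j := by
  rw [← Finset.sum_image (f := f) (s := Finset.univ) (g := e) fun x _ y _ h => he h,
    ← Finset.sum_filter_add_sum_filter_not Finset.univ (· ∈ Set.range e) f]
  congr 1
  · congr 1; ext; simp
  · rw [Finset.sum_filter]; exact Finset.sum_congr rfl fun j _ => by by_cases h : j ∈ Set.range e <;> simp [h]

open Classical in
/-- The element of the kernel of the complexification of `e_j ↦ X j` that agrees with `w`
outside the range of `e`. -/
noncomputable def kerLift (X : κ → V) (e : α → κ) (b : Module.Basis α ℝ V) (w : κ → ℂ) : κ → ℂ :=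
  Function.extend e
    (fun i => -∑ j, if j ∈ Set.range e then 0 else (b.repr (X j) i : ℂ) * w j) w

open Classical in
theorem kerLift_apply (he : e.Injective) (w : κ → ℂ) (i : α) : kerLift X e b w (e i) =
    -∑ j, if j ∈ Set.range e then 0 else (b.repr (X j) i : ℂ) * w j :=
  he.extend_apply _ _ _

theorem kerLift_of_notMem (w : κ → ℂ) {j : κ} (hj : j ∉ Set.range e) :
    kerLift X e b w j = w j :=
  Function.extend_apply' _ _ _ hj

theorem kerLift_congr {w w' : κ → ℂ} (h : ∀ j, j ∉ Set.range e → w j = w' j) :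
    kerLift X e b w = kerLift X e b w' := by
  classical
  have : (fun i => -∑ j, if j ∈ Set.range e then 0 else (b.repr (X j) i : ℂ) * w j) =
      fun i => -∑ j, if j ∈ Set.range e then 0 else (b.repr (X j) i : ℂ) * w' j := by
    funext i
    congr 1
    refine Finset.sum_congr rfl fun j _ => ?_
    split_ifs with hj
    · rfl
    · rw [h j hj]
  funext j
  unfold kerLift
  by_cases hj : j ∈ Set.range e
  · simp only [this]
    obtain ⟨i, rfl⟩ := hj
    simp only [Function.extend]
    rw [dif_pos ⟨i, rfl⟩, dif_pos ⟨i, rfl⟩]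
  · rw [Function.extend_apply' _ _ _ hj, Function.extend_apply' _ _ _ hj, h j hj]

/-- `φ` stands for the real or the imaginary part: the coordinates `b.repr (X j) i` are real, so a
real functional passes through them and one computation serves for both. -/
theorem sum_kerLift (he : e.Injective) (hb : ∀ i, X (e i) = b i) (φ : ℂ →ₗ[ℝ] ℝ) (w : κ → ℂ) :
    ∑ j, φ (kerLift X e b w j) • X j = 0 := by
  classical
  have hφ : ∀ (r : ℝ) (z : ℂ), φ (r * z) = r * φ z := fun r z => by
    rw [← Complex.real_smul, map_smul, smul_eq_mul]
  have h1 : ∀ i, φ (kerLift X e b w (e i)) • X (e i) =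
      -∑ j, if j ∈ Set.range e then 0 else φ (w j) • b.repr (X j) i • b i := fun i => by
    rw [kerLift_apply he, map_neg, map_sum, hb, neg_smul, Finset.sum_smul]
    congr 1
    refine Finset.sum_congr rfl fun j _ => ?_
    split_ifs
    · simp
    · rw [hφ, smul_smul, mul_comm]
  rw [sum_eq_sum_range_add he]
  simp only [h1]
  rw [Finset.sum_neg_distrib, Finset.sum_comm, neg_add_eq_zero]
  refine Finset.sum_congr rfl fun j _ => ?_
  split_ifs with hj
  · simp
  · rw [← Finset.smul_sum, b.sum_repr, kerLift_of_notMem _ hj]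

theorem kerLift_mem (he : e.Injective) (hb : ∀ i, X (e i) = b i) (w : κ → ℂ) :
    kerLift X e b w ∈ logGroup X ⊥ :=
  ⟨by simpa using sum_kerLift he hb Complex.reLm w, by
    simpa using sum_kerLift he hb Complex.imLm w⟩

/-- The `X (e i)` are linearly independent, so an element of the kernel is determined by its values
outside the range of `e`. -/
theorem kerLift_eq_self (he : e.Injective) (hb : ∀ i, X (e i) = b i) {W : κ → ℂ}
    (hW : W ∈ logGroup X ⊥) : kerLift X e b W = W := by
  classical
  have key : ∀ (φ : ℂ →ₗ[ℝ] ℝ), ∑ j, φ (W j) • X j = 0 → ∀ i,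
      φ (kerLift X e b W (e i)) = φ (W (e i)) := fun φ h i => by
    have hφ : ∀ (r : ℝ) (z : ℂ), φ (r * z) = r * φ z := fun r z => by
      rw [← Complex.real_smul, map_smul, smul_eq_mul]
    rw [sum_eq_sum_range_add he] at h
    have h' := congrArg (fun v => b.repr v i) h
    simp only [map_add, map_sum, hb, map_smul, Module.Basis.repr_self, Finsupp.coe_add,
      Pi.add_apply, Finsupp.finsetSum_apply, Finsupp.smul_apply, map_zero, Finsupp.coe_zero,
      Pi.zero_apply, smul_eq_mul] at h'
    rw [Finset.sum_eq_single i (fun k _ hk => by simp [hk]) (by simp),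
      Finsupp.single_eq_same, mul_one] at h'
    rw [kerLift_apply he, map_neg, map_sum, neg_eq_iff_add_eq_zero, add_comm, ← h']
    congr 1
    refine Finset.sum_congr rfl fun j _ => ?_
    split_ifs
    · simp
    · rw [hφ, map_smul, Finsupp.smul_apply, smul_eq_mul, mul_comm]
  funext j
  by_cases hj : j ∈ Set.range e
  · obtain ⟨i, rfl⟩ := hj
    exact Complex.ext (key Complex.reLm (by simpa using hW.1) i)
      (key Complex.imLm (by simpa using hW.2) i)
  · exact kerLift_of_notMem _ hj

theorem differentiableAt_kerLift {E : Type*} [NormedAddCommGroup E] [NormedSpace ℂ E]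
    (he : e.Injective) {w : E → κ → ℂ} {x : E}
    (hw : ∀ j, j ∉ Set.range e → DifferentiableAt ℂ (fun x => w x j) x) :
    DifferentiableAt ℂ (fun x => kerLift X e b (w x)) x := by
  classical
  refine differentiableAt_pi.2 fun j => ?_
  by_cases hj : j ∈ Set.range e
  · obtain ⟨i, rfl⟩ := hj
    simp only [kerLift_apply he]
    refine DifferentiableAt.neg (DifferentiableAt.fun_sum fun j _ => ?_)
    split_ifs with h
    · exact differentiableAt_const _
    · exact (hw j h).const_mul _
  · simp only [kerLift_of_notMem _ hj]
    exact hw j hj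

/-- The element of the kernel that moves `z` into the slice. -/
noncomputable def shift (X : κ → V) (e : α → κ) (b : Module.Basis α ℝ V) (z : κ → ℂ) : κ → ℂ :=
  kerLift X e b (negLog z)

/-- The coordinates in the slice of the translate of `z` by `shift z`. -/
noncomputable def toSlice (X : κ → V) (e : α → κ) (b : Module.Basis α ℝ V) (z : κ → ℂ) : α → ℂ :=
  fun i => cexp (shift X e b z) (e i) * z (e i)

theorem fill_toSlice (he : e.Injective) {z : κ → ℂ}
    (hz : ∀ j, j ∉ Set.range e → z j ≠ 0) :
    fill e (toSlice X e b z) = cexp (shift X e b z) * z := by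
  funext j
  by_cases hj : j ∈ Set.range e
  · obtain ⟨i, rfl⟩ := hj
    rw [fill_apply he, toSlice, Pi.mul_apply]
  · rw [fill_of_notMem _ hj, Pi.mul_apply, ← cexp_negLog_mul (hz j hj)]
    simp only [shift, cexp, kerLift_of_notMem _ hj]

theorem differentiableAt_shift {E : Type*} [NormedAddCommGroup E] [NormedSpace ℂ E]
    (he : e.Injective) {f : E → κ → ℂ} {x : E} (hf : DifferentiableAt ℂ f x)
    (hz : ∀ j, j ∉ Set.range e → f x j ∈ Complex.slitPlane) :
    DifferentiableAt ℂ (fun x => shift X e b (f x)) x :=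
  differentiableAt_kerLift he fun j hj =>
    (differentiableAt_negLog (hz j hj)).comp x hf

omit [Fintype κ] in
theorem differentiableAt_cexp {E : Type*} [NormedAddCommGroup E] [NormedSpace ℂ E]
    {f : E → κ → ℂ} {x : E} (hf : DifferentiableAt ℂ f x) (j : κ) :
    DifferentiableAt ℂ (fun x => cexp (f x) j) x :=
  ((differentiableAt_pi.1 hf j).const_mul _).cexp

theorem differentiableAt_toSlice {E : Type*} [NormedAddCommGroup E] [NormedSpace ℂ E]
    (he : e.Injective) {f : E → κ → ℂ} {x : E} (hf : DifferentiableAt ℂ f x)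
    (hz : ∀ j, j ∉ Set.range e → f x j ∈ Complex.slitPlane) :
    DifferentiableAt ℂ (fun x => toSlice X e b (f x)) x :=
  differentiableAt_pi.2 fun _ => (differentiableAt_cexp (differentiableAt_shift he hf hz) _).mul
    (differentiableAt_pi.1 hf _)

theorem shift_eq_zero (he : e.Injective) (hb : ∀ i, X (e i) = b i) {z : κ → ℂ}
    (hz : ∀ j, j ∉ Set.range e → z j = 1) : shift X e b z = 0 := by
  rw [shift, kerLift_congr (w' := 0) fun j hj => negLog_eq_zero (hz j hj)]
  exact kerLift_eq_self he hb (zero_mem _)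

theorem toSlice_fill (he : e.Injective) (hb : ∀ i, X (e i) = b i) (u : α → ℂ) :
    toSlice X e b (fill e u) = u := by
  funext i
  rw [toSlice, shift_eq_zero he hb fun j hj => fill_of_notMem u hj, cexp_zero, fill_apply he,
    Pi.one_apply, one_mul]

/-- Outside the range of `e` the moved point equals `cexp W`, and the small real part lets the
principal logarithm recover `-W` there. These values determine an element of the kernel, so the
shift is exactly `-W`. -/
theorem toSlice_cexp_mul_fill (he : e.Injective) (hb : ∀ i, X (e i) = b i) {W : κ → ℂ}
    (hW : W ∈ logGroup X ⊥) (hs : ∀ j, j ∉ Set.range e → |(W j).re| < 1 / 2) (u : α → ℂ) :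
    toSlice X e b (cexp W * fill e u) = u := by
  have : shift X e b (cexp W * fill e u) = -W := by
    rw [shift, kerLift_congr (w' := -W) fun j hj => ?_]
    · exact kerLift_eq_self he hb (neg_mem hW)
    · rw [Pi.neg_apply, ← negLog_cexp (hs j hj)]
      simp [negLog, fill_of_notMem u hj]
  funext i
  rw [toSlice, this, Pi.mul_apply, ← mul_assoc, ← Pi.mul_apply (cexp (-W)), cexp_neg_mul,
    fill_apply he, Pi.one_apply, one_mul]

/-- Every point that does not vanish outside the range of `e` is a translate of a point of the
slice. -/
theorem exists_eq_cexp_mul_fill (he : e.Injective) (hb : ∀ i, X (e i) = b i) {z : κ → ℂ}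
    (hz : ∀ j, j ∉ Set.range e → z j ≠ 0) :
    ∃ W ∈ logGroup X ⊥, z = cexp W * fill e (toSlice X e b z) := by
  refine ⟨-shift X e b z, neg_mem (kerLift_mem he hb _), ?_⟩
  rw [fill_toSlice he hz, ← mul_assoc, cexp_neg_mul, one_mul]

/-- The saturation of an open subset of a slice is open. -/
theorem isOpen_saturation (he : e.Injective) (hb : ∀ i, X (e i) = b i) (Q : AddSubgroup V)
    {U : Set (α → ℂ)} (hU : IsOpen U) :
    IsOpen {z | ∃ Z ∈ logGroup X Q, ∃ u ∈ U, z = cexp Z * fill e u} := by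
  rw [isOpen_iff_mem_nhds]
  rintro _ ⟨Z, hZ, u, hu, rfl⟩
  have hg : Continuous fun z : κ → ℂ => cexp (-Z) * z := by fun_prop
  have hd : Differentiable ℂ fun z : κ → ℂ => cexp (-Z) * z := by fun_prop
  have hval : cexp (-Z) * (cexp Z * fill e u) = fill e u := by
    rw [← mul_assoc, cexp_neg_mul, one_mul]
  have hslit : ∀ j, j ∉ Set.range e → (cexp (-Z) * (cexp Z * fill e u)) j ∈ Complex.slitPlane :=
    fun j hj => by rw [hval, fill_of_notMem _ hj]; exact Complex.one_mem_slitPlane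
  -- Undoing `Z` brings the base point into the slice, where the coordinates outside the range of
  -- `e` are 1 and `toSlice` is continuous.
  have h1 : ∀ᶠ z in 𝓝 (cexp Z * fill e u), toSlice X e b (cexp (-Z) * z) ∈ U := by
    refine (differentiableAt_toSlice he hd.differentiableAt hslit).continuousAt.eventually_mem
      (hU.mem_nhds ?_)
    rwa [hval, toSlice_fill he hb]
  have h2 : ∀ᶠ z in 𝓝 (cexp Z * fill e u), ∀ j, j ∉ Set.range e →
      (cexp (-Z) * z) j ∈ Complex.slitPlane := by
    rw [Filter.eventually_all]
    intro j
    by_cases hj : j ∈ Set.range e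
    · exact Filter.Eventually.of_forall fun _ h => absurd hj h
    · filter_upwards [((continuous_apply j).comp hg).continuousAt.eventually_mem
        (Complex.isOpen_slitPlane.mem_nhds (hslit j hj))] with z hz _ using hz
  filter_upwards [h1, h2] with z hz1 hz2
  obtain ⟨W, hW, h⟩ := exists_eq_cexp_mul_fill (b := b) he hb
    fun j hj => Complex.slitPlane_ne_zero (hz2 j hj)
  refine ⟨Z + W, add_mem hZ (logGroup_mono X bot_le hW), _, hz1, ?_⟩
  rw [cexp_add, mul_assoc, ← h, ← mul_assoc, cexp_mul_neg, one_mul]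

end Slice

/-! ### Changes of slice -/

section Transition

/-- Two maps that are inverse to each other on open sets define a partial homeomorphism. -/
def partialHomeoOfInverse {E E' : Type*} [TopologicalSpace E] [TopologicalSpace E']
    (f : E → E') (f' : E' → E) (U : Set E) (U' : Set E') (hU : IsOpen U) (hU' : IsOpen U')
    (hf : ContinuousOn f U) (hf' : ContinuousOn f' U') (h : ∀ x ∈ U, f' (f x) = x)
    (h' : ∀ x ∈ U', f (f' x) = x) : OpenPartialHomeomorph E E' where
  toFun := f
  invFun := f'
  source := U ∩ f ⁻¹' U'
  target := U' ∩ f' ⁻¹' U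
  map_source' x hx := ⟨hx.2, by simpa [h x hx.1] using hx.1⟩
  map_target' x hx := ⟨hx.2, by simpa [h' x hx.1] using hx.1⟩
  left_inv' x hx := h x hx.1
  right_inv' x hx := h' x hx.1
  open_source := hf.isOpen_inter_preimage hU hU'
  open_target := hf'.isOpen_inter_preimage hU' hU
  continuousOn_toFun := hf.mono Set.inter_subset_left
  continuousOn_invFun := hf'.mono Set.inter_subset_left

variable {κ V α β : Type*} [Fintype κ] [Fintype α] [Fintype β] [AddCommGroup V] [Module ℝ V]
  {X : κ → V} {e : α → κ} {b : Module.Basis α ℝ V} {e' : β → κ} {b' : Module.Basis β ℝ V}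

/-- The transition map from the slice of `e` to that of `e'` near a point moved by `cexp Z`. -/
noncomputable def transition (X : κ → V) (e : α → κ) (e' : β → κ) (b' : Module.Basis β ℝ V)
    (Z : κ → ℂ) (u : α → ℂ) : β → ℂ :=
  toSlice X e' b' (cexp Z * fill e u)

/-- The set on which `transition` is well behaved. -/
def transitionSource (X : κ → V) (e : α → κ) (e' : β → κ) (b' : Module.Basis β ℝ V)
    (Z : κ → ℂ) : Set (α → ℂ) :=
  {u | ∀ j, j ∉ Set.range e' → (cexp Z * fill e u) j ∈ Complex.slitPlane} ∩
    {u | ∀ j, |(shift X e' b' (cexp Z * fill e u) j).re| < 1 / 2}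

theorem differentiable_cexp_mul_fill (he : e.Injective) (Z : κ → ℂ) :
    Differentiable ℂ fun u : α → ℂ => cexp Z * fill e u :=
  (differentiable_const _).mul (differentiable_fill he)

theorem isOpen_transitionSource (he : e.Injective) (he' : e'.Injective) (Z : κ → ℂ) :
    IsOpen (transitionSource X e e' b' Z) := by
  have hd := differentiable_cexp_mul_fill he Z
  -- The shift is known to be continuous only where the logarithms are, so the second condition is
  -- treated relative to the first.
  refine ContinuousOn.isOpen_inter_preimage (f := fun u j =>
    |(shift X e' b' (cexp Z * fill e u) j).re|) (t := {f : κ → ℝ | ∀ j, f j < 1 / 2}) ?_ ?_ ?_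
  · refine continuousOn_pi.2 fun j u hu => ContinuousAt.continuousWithinAt ?_
    have := continuousAt_pi.1
      (differentiableAt_shift (X := X) (b := b') he' hd.differentiableAt hu).continuousAt j
    exact (Complex.continuous_re.continuousAt.comp this).abs
  · simp only [Set.ofPred_forall]
    refine isOpen_iInter_of_finite fun j => isOpen_iInter_of_finite fun _ => ?_
    exact Complex.isOpen_slitPlane.preimage ((continuous_apply j).comp hd.continuous)
  · simp only [Set.ofPred_forall]
    exact isOpen_iInter_of_finite fun j => isOpen_lt (continuous_apply j) continuous_const

omit [Fintype α] in
theorem fill_transition (he' : e'.Injective) (hb' : ∀ i, X (e' i) = b' i) {Z : κ → ℂ} {u : α → ℂ}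
    (hu : u ∈ transitionSource X e e' b' Z) :
    ∃ W ∈ logGroup X ⊥, (∀ j, |(W j).re| < 1 / 2) ∧
      fill e' (transition X e e' b' Z u) = cexp W * (cexp Z * fill e u) :=
  ⟨_, kerLift_mem he' hb' _, hu.2,
    fill_toSlice he' fun j hj => Complex.slitPlane_ne_zero (hu.1 j hj)⟩

/-- The correction `W` made by the first map is in the kernel and has small real parts. Once `cexp
Z` is undone only `cexp W` is left, and `toSlice` for `e` removes it exactly; this is the purpose of
the bound 1 / 2 in `transitionSource`. -/
theorem transition_transition (he : e.Injective) (hb : ∀ i, X (e i) = b i)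
    (he' : e'.Injective) (hb' : ∀ i, X (e' i) = b' i) {Z : κ → ℂ} {u : α → ℂ}
    (hu : u ∈ transitionSource X e e' b' Z) :
    transition X e' e b (-Z) (transition X e e' b' Z u) = u := by
  obtain ⟨W, hW, hs, h⟩ := fill_transition he' hb' hu
  rw [transition, h, mul_left_comm (cexp W), ← mul_assoc, cexp_neg_mul, one_mul]
  exact toSlice_cexp_mul_fill he hb hW (fun j _ => hs j) u

omit [Fintype α] in
-- At the base point the translate already lies in the target slice, so its coordinates outside the
-- range of `e'` are 1 and the shift is zero.
theorem mem_transitionSource (he' : e'.Injective) (hb' : ∀ i, X (e' i) = b' i) {Z : κ → ℂ}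
    {u : α → ℂ} {u' : β → ℂ} (h : fill e' u' = cexp Z * fill e u) :
    u ∈ transitionSource X e e' b' Z := by
  refine ⟨fun j hj => ?_, fun j => ?_⟩
  · rw [← h, fill_of_notMem _ hj]; exact Complex.one_mem_slitPlane
  · rw [← h, shift_eq_zero he' hb' fun j hj => fill_of_notMem u' hj]; simp

theorem differentiableOn_transition (he : e.Injective) (he' : e'.Injective) (Z : κ → ℂ) :
    DifferentiableOn ℂ (transition X e e' b' Z) (transitionSource X e e' b' Z) := fun _ hu =>
  (differentiableAt_toSlice he' (differentiable_cexp_mul_fill he Z).differentiableAt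
    hu.1).differentiableWithinAt

/-- If a point of one slice is a translate of a point of another, there is a biholomorphism near
these points that maps each point to a translate of it. -/
theorem exists_transition (he : e.Injective) (hb : ∀ i, X (e i) = b i)
    (he' : e'.Injective) (hb' : ∀ i, X (e' i) = b' i) {Q : AddSubgroup V} {Z : κ → ℂ}
    (hZ : Z ∈ logGroup X Q) {u : α → ℂ} {u' : β → ℂ} (h : fill e' u' = cexp Z * fill e u) :
    ∃ f : OpenPartialHomeomorph (α → ℂ) (β → ℂ), u ∈ f.source ∧ f u = u' ∧
      DifferentiableOn ℂ f f.source ∧ DifferentiableOn ℂ f.symm f.target ∧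
      ∀ x ∈ f.source, ∃ W ∈ logGroup X Q, fill e' (f x) = cexp W * fill e x := by
  have h' : fill e u = cexp (-Z) * fill e' u' := by
    rw [h, ← mul_assoc, cexp_neg_mul, one_mul]
  have hu : transition X e e' b' Z u = u' := by
    rw [transition, ← h, toSlice_fill he' hb']
  refine ⟨partialHomeoOfInverse (transition X e e' b' Z) (transition X e' e b (-Z))
    (transitionSource X e e' b' Z) (transitionSource X e' e b (-Z))
    (isOpen_transitionSource he he' Z) (isOpen_transitionSource he' he (-Z))
    (differentiableOn_transition he he' Z).continuousOn
    (differentiableOn_transition he' he (-Z)).continuousOn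
    (fun x hx => transition_transition he hb he' hb' hx)
    (fun x hx => by simpa using transition_transition (Z := -Z) he' hb' he hb hx),
    ⟨mem_transitionSource he' hb' h, ?_⟩, hu,
    (differentiableOn_transition he he' Z).mono Set.inter_subset_left,
    (differentiableOn_transition he' he (-Z)).mono Set.inter_subset_left, ?_⟩
  · rw [Set.mem_preimage, hu]
    exact mem_transitionSource he hb h'
  · rintro x ⟨hx, -⟩
    obtain ⟨W, hW, -, hWx⟩ := fill_transition he' hb' hx
    exact ⟨W + Z, add_mem (logGroup_mono X bot_le hW) hZ, by rw [cexp_add, mul_assoc]; exact hWx⟩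

end Transition

end TorusSlice

/-! ### A theorem of the alternative -/

/-- Stiemke's lemma relative to a subspace: if no functional that vanishes on `L` is nonnegative
and nonzero on the family `v`, then a positive combination of the family lies in `L`. -/
theorem exists_pos_sum_smul_mem {V ι : Type*} [AddCommGroup V] [Module ℝ V] [Fintype ι]
    (L : Submodule ℝ V) (v : ι → V)
    (h : ∀ ν : Module.Dual ℝ V, (∀ x ∈ L, ν x = 0) → (∀ i, 0 ≤ ν (v i)) → ∀ i, ν (v i) = 0) :
    ∃ y : ι → ℝ, (∀ i, 0 < y i) ∧ ∑ i, y i • v i ∈ L := by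
  classical
  let φ : (ι → ℝ) →ₗ[ℝ] V ⧸ L := L.mkQ ∘ₗ Fintype.linearCombination ℝ v
  have hφ : ∀ y, φ y = 0 ↔ ∑ i, y i • v i ∈ L := fun y => by
    rw [LinearMap.comp_apply, Submodule.mkQ_apply, Submodule.Quotient.mk_eq_zero,
      Fintype.linearCombination_apply]
  by_contra! hcon
  let s : Set (ι → ℝ) := Set.univ.pi fun _ => Set.Ioi 0
  have hs : ∀ y, y ∈ s ↔ ∀ i, 0 < y i := fun y => by simp [s]
  have hdisj : Disjoint s (φ.ker : Set (ι → ℝ)) := by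
    rw [Set.disjoint_left]
    intro y hy hk
    exact hcon y ((hs y).1 hy) ((hφ y).1 hk)
  -- Separate the open positive orthant from the kernel of `φ`.
  obtain ⟨f, c, hf, hfc⟩ := geometric_hahn_banach_open
    (convex_pi fun _ _ => convex_Ioi 0)
    (isOpen_set_pi Set.finite_univ fun _ _ => isOpen_Ioi) φ.ker.convex hdisj
  have hc : c ≤ 0 := by simpa using hfc 0 φ.ker.zero_mem
  -- A functional bounded below on a subspace vanishes on it.
  have hf0 : ∀ y ∈ φ.ker, f y = 0 := by
    intro y hy
    by_contra hne
    have := hfc (((c - 1) / f y) • y) (φ.ker.smul_mem _ hy)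
    rw [map_smul, smul_eq_mul, div_mul_cancel₀ _ hne] at this
    linarith
  have hneg : ∀ i, f (Pi.single i 1) ≤ 0 := by
    intro i
    by_contra! hpos
    have hone : f 1 < 0 := (hf 1 ((hs _).2 fun _ => one_pos)).trans_le hc
    -- The coefficient makes `f` vanish at this point of the orthant, where `f` must be negative.
    have := hf (1 + (-f 1 / f (Pi.single i 1)) • Pi.single i (1 : ℝ)) ((hs _).2 fun k => by
      have h0 : 0 ≤ -f 1 / f (Pi.single i 1) := div_nonneg (by linarith) hpos.le
      have h1 : 0 ≤ (Pi.single i (1 : ℝ) : ι → ℝ) k := by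
        by_cases hk : k = i
        · subst hk; simp
        · simp [hk]
      simp only [Pi.add_apply, Pi.one_apply, Pi.smul_apply, smul_eq_mul]
      nlinarith [mul_nonneg h0 h1])
    rw [map_add, map_smul, smul_eq_mul, div_mul_cancel₀ _ hpos.ne'] at this
    linarith
  -- `-f` vanishes on the kernel of `φ`, hence factors through `φ`; this yields the functional to
  -- which `h` applies.
  have hann : (-(f : (ι → ℝ) →ₗ[ℝ] ℝ)) ∈ φ.ker.dualAnnihilator :=
    (Submodule.mem_dualAnnihilator _).2 fun y hy => by simpa using hf0 y hy
  rw [← LinearMap.range_dualMap_eq_dualAnnihilator_ker] at hann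
  obtain ⟨ν, hν⟩ := hann
  have hνv : ∀ i, ν (L.mkQ (v i)) = -f (Pi.single i 1) := fun i => by
    have := LinearMap.congr_fun hν (Pi.single i 1)
    simpa [φ, LinearMap.dualMap_apply, Fintype.linearCombination_apply_single] using this
  have hz := h (ν ∘ₗ L.mkQ) (fun x hx => by
    rw [LinearMap.comp_apply, Submodule.mkQ_apply, (Submodule.Quotient.mk_eq_zero L).2 hx,
      map_zero]) fun i => by
    rw [LinearMap.comp_apply, hνv i]
    linarith [hneg i]
  have hone : f 1 < 0 := (hf 1 ((hs _).2 fun _ => one_pos)).trans_le hc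
  have hsum : f 1 = ∑ i, f (Pi.single i 1) := by
    rw [← map_sum]
    congr 1
    ext k
    simp [Finset.sum_apply, Pi.single_apply]
  have : ∀ i, f (Pi.single i 1) = 0 := fun i => by
    have := hz i
    rw [LinearMap.comp_apply, hνv i] at this
    linarith
  simp [hsum, this] at hone

namespace ToricDatum

variable {𝔡 : Type u} [AddCommGroup 𝔡] [Module ℝ 𝔡] {d : ℕ} (P : ToricDatum 𝔡 d)

/-! ### The faces of the polytope -/

theorem mem_Δ {μ : Module.Dual ℝ 𝔡} : μ ∈ P.Δ ↔ ∀ j, P.lam j ≤ μ (P.X j) := by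
  rw [P.eq_halfSpaces]; rfl

variable {P} in
theorem mem_openFace_iff {F : Finset (Fin d)} {μ : Module.Dual ℝ 𝔡} :
    μ ∈ P.openFace F ↔ (∀ j ∈ F, μ (P.X j) = P.lam j) ∧ ∀ j, j ∉ F → P.lam j < μ (P.X j) := by
  constructor
  · rintro ⟨h1, h2⟩
    exact ⟨fun j hj => (h2 j).2 hj, fun j hj =>
      lt_of_le_of_ne (P.mem_Δ.1 h1 j) fun h => hj ((h2 j).1 h.symm)⟩
  · rintro ⟨h1, h2⟩
    refine ⟨P.mem_Δ.2 fun j => ?_, fun j => ⟨fun h => ?_, h1 j⟩⟩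
    · by_cases hj : j ∈ F
      · exact (h1 j hj).ge
      · exact (h2 j hj).le
    · by_contra hj
      exact (h2 j hj).ne' h

theorem mem_openFace_of_mem {μ : Module.Dual ℝ 𝔡} (h : μ ∈ P.Δ) :
    μ ∈ P.openFace (Finset.univ.filter fun j => μ (P.X j) = P.lam j) :=
  ⟨h, fun j => by simp⟩

variable {P} in
-- For small `ε` the strict inequalities outside `F` persist, while those in `F` with `ν (P.X j) >
-- 0` become strict.
theorem exists_add_smul_mem_openFace {F : Finset (Fin d)} {μ ν : Module.Dual ℝ 𝔡}
    (hμ : μ ∈ P.openFace F) (hν : ∀ j ∈ F, 0 ≤ ν (P.X j)) :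
    ∃ ε : ℝ, 0 < ε ∧ μ + ε • ν ∈ P.openFace (F.filter fun j => ν (P.X j) = 0) := by
  rw [mem_openFace_iff] at hμ
  have h : ∀ᶠ ε in 𝓝[>] (0 : ℝ), ∀ j, j ∉ F → P.lam j < μ (P.X j) + ε * ν (P.X j) := by
    rw [Filter.eventually_all]
    intro j
    by_cases hj : j ∈ F
    · exact Filter.Eventually.of_forall fun _ h => absurd hj h
    · have hc : Continuous fun ε : ℝ => μ (P.X j) + ε * ν (P.X j) := by fun_prop
      have := hc.continuousAt (x := 0) |>.eventually_mem
        (isOpen_Ioi.mem_nhds (show _ ∈ Set.Ioi (P.lam j) by simpa using hμ.2 j hj))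
      filter_upwards [this.filter_mono nhdsWithin_le_nhds] with ε hε _ using hε
  obtain ⟨ε, hε, hpos⟩ := (h.and self_mem_nhdsWithin).exists
  refine ⟨ε, hpos, mem_openFace_iff.2 ⟨fun j hj => ?_, fun j hj => ?_⟩⟩
  · rw [Finset.mem_filter] at hj
    simp [hμ.1 j hj.1, hj.2]
  · rw [LinearMap.add_apply, LinearMap.smul_apply, smul_eq_mul]
    by_cases hjF : j ∈ F
    · have : 0 < ν (P.X j) := lt_of_le_of_ne (hν j hjF) fun h => hj (by simp [hjF, h.symm])
      rw [hμ.1 j hjF]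
      exact lt_add_of_pos_right _ (mul_pos hpos this)
    · exact hε j hjF

variable {P} in
-- At the midpoint of points of the two open faces, an inequality is an equality exactly when it is
-- one at both points.
theorem IsFace.inter {F G : Finset (Fin d)} (hF : P.IsFace F) (hG : P.IsFace G) :
    P.IsFace (F ∩ G) := by
  obtain ⟨μ, hμ⟩ := hF
  obtain ⟨ν, hν⟩ := hG
  have h1 := P.mem_Δ.1 hμ.1
  have h2 := P.mem_Δ.1 hν.1
  rw [mem_openFace_iff] at hμ hν
  refine ⟨(1 / 2 : ℝ) • μ + (1 / 2 : ℝ) • ν, mem_openFace_iff.2 ⟨fun j hj => ?_, fun j hj => ?_⟩⟩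
  · rw [Finset.mem_inter] at hj
    simp only [LinearMap.add_apply, LinearMap.smul_apply, smul_eq_mul, hμ.1 j hj.1, hν.1 j hj.2]
    ring
  · simp only [LinearMap.add_apply, LinearMap.smul_apply, smul_eq_mul]
    rw [Finset.mem_inter, not_and_or] at hj
    rcases hj with hj | hj
    · linarith [hμ.2 j hj, h2 j]
    · linarith [hν.2 j hj, h1 j]

open Classical in
/-- The index set of the smallest face on which all the inequalities in `S` are equalities. -/
noncomputable def minFace (S : Finset (Fin d)) : Finset (Fin d) :=
  Finset.univ.filter fun j => ∀ F, P.IsFace F → S ⊆ F → j ∈ F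

theorem subset_minFace (S : Finset (Fin d)) : S ⊆ P.minFace S := fun j hj => by
  simp only [minFace, Finset.mem_filter, Finset.mem_univ, true_and]
  exact fun F _ h => h hj

variable {P} in
theorem minFace_subset {S F : Finset (Fin d)} (hF : P.IsFace F) (h : S ⊆ F) :
    P.minFace S ⊆ F := fun j hj => by
  simp only [minFace, Finset.mem_filter, Finset.mem_univ, true_and] at hj
  exact hj F hF h

variable {P} in
theorem minFace_eq_self {F : Finset (Fin d)} (hF : P.IsFace F) : P.minFace F = F :=
  (minFace_subset hF subset_rfl).antisymm (P.subset_minFace F)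

variable {P} in
-- A face index set of least cardinality among those containing `S` lies in every other one, since
-- intersecting the two gives a face again.
theorem isFace_minFace {S F : Finset (Fin d)} (hF : P.IsFace F) (h : S ⊆ F) :
    P.IsFace (P.minFace S) := by
  classical
  obtain ⟨G, hG, hmin⟩ := Finset.exists_min_image
    (Finset.univ.filter fun G => P.IsFace G ∧ S ⊆ G) Finset.card ⟨F, by simp [hF, h]⟩
  simp only [Finset.mem_filter, Finset.mem_univ, true_and] at hG hmin
  have : P.minFace S = G := by
    refine (minFace_subset hG.1 hG.2).antisymm fun j hj => ?_
    simp only [minFace, Finset.mem_filter, Finset.mem_univ, true_and]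
    intro T hT hS
    have := Finset.eq_of_subset_of_card_le Finset.inter_subset_left
      (hmin (G ∩ T) ⟨hG.1.inter hT, Finset.subset_inter hG.2 hS⟩)
    rw [← this] at hj
    exact (Finset.mem_inter.1 hj).2
  rw [this]
  exact hG.1

theorem nonempty_Δ : P.Δ.Nonempty := by
  rw [Set.nonempty_iff_ne_empty]
  intro h
  have := P.fullDim
  rw [h, AffineSubspace.span_empty] at this
  exact AffineSubspace.bot_ne_top ℝ _ _ this

theorem exists_le_of_mem_Δ (x : 𝔡) : ∃ C : ℝ, ∀ μ ∈ P.Δ, μ x ≤ C := by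
  obtain ⟨s, hs, h⟩ := P.isPolytope
  obtain ⟨C, hC⟩ := (hs.image fun μ : Module.Dual ℝ 𝔡 => μ x).bddAbove
  refine ⟨C, fun μ hμ => ?_⟩
  rw [← h] at hμ
  exact convexHull_min (t := {μ | μ x ≤ C}) (fun μ hμ => hC ⟨μ, hμ, rfl⟩)
    (convex_halfSpace_le (f := fun μ : Module.Dual ℝ 𝔡 => μ x) ⟨fun _ _ => rfl, fun _ _ => rfl⟩ C) hμ

/-- If nonzero, `ν` would be a direction in which `Δ` is unbounded, but a convex hull of finitely
many points is bounded. -/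
theorem eq_zero_of_nonneg {ν : Module.Dual ℝ 𝔡} (h : ∀ j, 0 ≤ ν (P.X j)) : ν = 0 := by
  obtain ⟨μ, hμ⟩ := P.nonempty_Δ
  have key : ∀ x, ν x ≤ 0 := by
    intro x
    by_contra! hx
    obtain ⟨C, hC⟩ := P.exists_le_of_mem_Δ x
    have h0 := hC μ hμ
    -- The multiple of `ν` is chosen so that the value at `x` becomes `C + 1`.
    have := hC (μ + ((C + 1 - μ x) / ν x) • ν) (P.mem_Δ.2 fun j => by
      have h1 := P.mem_Δ.1 hμ j
      have h2 : 0 ≤ (C + 1 - μ x) / ν x * ν (P.X j) :=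
        mul_nonneg (div_nonneg (by linarith) hx.le) (h j)
      simp only [LinearMap.add_apply, LinearMap.smul_apply, smul_eq_mul]
      linarith)
    simp only [LinearMap.add_apply, LinearMap.smul_apply, smul_eq_mul] at this
    rw [div_mul_cancel₀ _ hx.ne'] at this
    linarith
  ext x
  refine le_antisymm (key x) ?_
  have := key (-x)
  rw [map_neg] at this
  simpa using this

/-- The span of the normals of the facets that contain the face `F`. -/
def normalSpan (F : Finset (Fin d)) : Submodule ℝ 𝔡 := Submodule.span ℝ (P.X '' F)

theorem X_mem_normalSpan {F : Finset (Fin d)} {j : Fin d} (hj : j ∈ F) :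
    P.X j ∈ P.normalSpan F := Submodule.subset_span ⟨j, hj, rfl⟩

theorem normalSpan_mono {F G : Finset (Fin d)} (h : F ⊆ G) : P.normalSpan F ≤ P.normalSpan G :=
  Submodule.span_mono (Set.image_mono (by exact_mod_cast h))

theorem eq_zero_of_mem_normalSpan {F : Finset (Fin d)} {ν : Module.Dual ℝ 𝔡}
    (h : ∀ j ∈ F, ν (P.X j) = 0) {x : 𝔡} (hx : x ∈ P.normalSpan F) : ν x = 0 := by
  have : P.normalSpan F ≤ LinearMap.ker ν := by
    rw [normalSpan, Submodule.span_le]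
    rintro _ ⟨j, hj, rfl⟩
    exact h j hj
  exact this hx

theorem mem_normalSpan_iff {F : Finset (Fin d)} {x : 𝔡} : x ∈ P.normalSpan F ↔
    ∃ c : Fin d → ℝ, (∀ j, j ∉ F → c j = 0) ∧ ∑ j, c j • P.X j = x := by
  constructor
  · intro h
    obtain ⟨c, hc⟩ := (Submodule.mem_span_image_finset_iff_exists_fun ℝ).1 h
    refine ⟨fun j => if hj : j ∈ F then c ⟨j, hj⟩ else 0, fun j hj => by simp [hj], ?_⟩
    rw [← hc, ← Finset.sum_subset (Finset.subset_univ F) fun j _ hj => by simp [hj],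
      ← Finset.sum_coe_sort F]
    exact Finset.sum_congr rfl fun j _ => by simp
  · rintro ⟨c, hc, rfl⟩
    refine Submodule.sum_mem _ fun j _ => ?_
    by_cases hj : j ∈ F
    · exact Submodule.smul_mem _ _ (P.X_mem_normalSpan hj)
    · simp [hc j hj]

theorem normalSpan_univ : P.normalSpan Finset.univ = ⊤ := by
  by_contra h
  obtain ⟨ν, hν, hle⟩ := Submodule.exists_le_ker_of_lt_top _ (lt_top_iff_ne_top.2 h)
  exact hν (P.eq_zero_of_nonneg fun j => (hle (P.X_mem_normalSpan (Finset.mem_univ j))).ge)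

variable {P} in
-- From a point of the open face one can move a little in every direction that annihilates the
-- normals in `F`.
theorem vectorSpan_openFace {F : Finset (Fin d)} (hF : P.IsFace F) :
    vectorSpan ℝ (P.openFace F) = (P.normalSpan F).dualAnnihilator := by
  obtain ⟨μ, hμ⟩ := hF
  apply le_antisymm
  · rw [vectorSpan_def, Submodule.span_le]
    rintro _ ⟨μ₁, h₁, μ₂, h₂, rfl⟩
    refine (Submodule.mem_dualAnnihilator _).2 fun x hx =>
      P.eq_zero_of_mem_normalSpan (fun j hj => ?_) hx
    rw [show (fun x y => x -ᵥ y) μ₁ μ₂ = μ₁ - μ₂ from rfl, LinearMap.sub_apply, (mem_openFace_iff.1 h₁).1 j hj,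
      (mem_openFace_iff.1 h₂).1 j hj, sub_self]
  · intro ν hν
    have hν' : ∀ j ∈ F, ν (P.X j) = 0 := fun j hj =>
      (Submodule.mem_dualAnnihilator _).1 hν _ (P.X_mem_normalSpan hj)
    obtain ⟨ε, hε, h⟩ := exists_add_smul_mem_openFace hμ fun j hj => (hν' j hj).ge
    rw [Finset.filter_true_of_mem hν'] at h
    have := vsub_mem_vectorSpan ℝ h hμ
    rw [vsub_eq_sub, add_sub_cancel_left] at this
    simpa [smul_smul, hε.ne'] using Submodule.smul_mem _ ε⁻¹ this

variable {P} in
theorem finrank_normalSpan_add_faceDim [FiniteDimensional ℝ 𝔡] {F : Finset (Fin d)}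
    (hF : P.IsFace F) :
    Module.finrank ℝ (P.normalSpan F) + P.faceDim F = Module.finrank ℝ 𝔡 := by
  rw [faceDim, vectorSpan_openFace hF]
  exact Subspace.finrank_add_finrank_dualAnnihilator_eq _

theorem finrank_normalSpan_of_linearIndepOn {F : Finset (Fin d)}
    (h : LinearIndepOn ℝ P.X (F : Set (Fin d))) :
    Module.finrank ℝ (P.normalSpan F) = F.card := by
  have := finrank_span_eq_card h.linearIndependent
  rw [normalSpan, ← Fintype.card_coe F, Set.image_eq_range]
  exact this

variable {P} in
-- By `finrank_normalSpan_add_faceDim`, regularity says that the number of normals in `F` is the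
-- dimension of their span.
theorem isRegular_iff [FiniteDimensional ℝ 𝔡] {F : Finset (Fin d)} :
    P.IsRegular F ↔ P.IsFace F ∧ LinearIndepOn ℝ P.X (F : Set (Fin d)) := by
  refine and_congr_right fun hF => ?_
  rw [← finrank_normalSpan_add_faceDim hF, add_left_inj]
  constructor
  · intro h
    refine linearIndependent_iff_card_eq_finrank_span.2 ?_
    rw [Set.finrank, ← Set.image_eq_range, ← normalSpan, ← h]
    exact Fintype.card_coe F
  · exact fun h => (P.finrank_normalSpan_of_linearIndepOn h).symm

variable {P} in
-- Near a regular face the polytope is simple: by linear independence some `ν` vanishes on the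
-- normals in `S` and is 1 on the others in `F`, and a small step along it leaves exactly the facets
-- in `F \ S`.
theorem IsRegular.subset [FiniteDimensional ℝ 𝔡] {F S : Finset (Fin d)} (hF : P.IsRegular F)
    (hS : S ⊆ F) : P.IsRegular S := by
  rw [isRegular_iff] at hF ⊢
  obtain ⟨⟨μ, hμ⟩, hli⟩ := hF
  refine ⟨?_, hli.mono (by exact_mod_cast hS)⟩
  obtain ⟨ν, hν⟩ := LinearMap.exists_extend ((Module.Basis.span hli.linearIndependent).constr ℝ
    fun j => if (j : Fin d) ∈ S then (0 : ℝ) else 1)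
  have hνX : ∀ j ∈ F, ν (P.X j) = if j ∈ S then (0 : ℝ) else 1 := fun j hj => by
    have h1 := LinearMap.congr_fun hν (Module.Basis.span hli.linearIndependent ⟨j, hj⟩)
    rw [Module.Basis.constr_basis, LinearMap.comp_apply, Submodule.subtype_apply,
      Module.Basis.span_apply] at h1
    exact h1
  obtain ⟨ε, -, h⟩ := exists_add_smul_mem_openFace hμ fun j hj => by
    rw [hνX j hj]; split_ifs <;> norm_num
  refine ⟨μ + ε • ν, ?_⟩
  convert h using 1
  congr 1
  ext j
  rw [Finset.mem_filter]
  refine ⟨fun hj => ⟨hS hj, by simp [hνX j (hS hj), hj]⟩, fun ⟨hj, h0⟩ => ?_⟩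
  by_contra hjS
  simp [hνX j hj, hjS] at h0

/-- A facet containing every face would be all of `Δ`, whose dimension is one too large. -/
theorem exists_isFace_notMem [FiniteDimensional ℝ 𝔡] (j : Fin d) : ∃ F, P.IsFace F ∧ j ∉ F := by
  by_contra! h
  have hΔ : {μ ∈ P.Δ | μ (P.X j) = P.lam j} = P.Δ := by
    refine Set.Subset.antisymm (fun _ h => h.1) fun μ hμ => ⟨hμ, ?_⟩
    have := h _ ⟨μ, P.mem_openFace_of_mem hμ⟩
    simpa using this
  have h1 := P.facet_dim j
  rw [hΔ, ← direction_affineSpan, P.fullDim, AffineSubspace.direction_top, finrank_top,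
    Subspace.dual_finrank_eq] at h1
  omega

theorem isFace_empty [FiniteDimensional ℝ 𝔡] : P.IsFace ∅ := by
  obtain ⟨μ, hμ⟩ := P.nonempty_Δ
  have h : P.IsFace (P.minFace ∅) :=
    isFace_minFace ⟨μ, P.mem_openFace_of_mem hμ⟩ (Finset.empty_subset _)
  convert h
  symm
  rw [Finset.eq_empty_iff_forall_notMem]
  intro j hj
  obtain ⟨F, hF, hjF⟩ := P.exists_isFace_notMem j
  exact hjF (minFace_subset hF (Finset.empty_subset _) hj)

theorem isRegular_empty [FiniteDimensional ℝ 𝔡] : P.IsRegular ∅ :=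
  isRegular_iff.2 ⟨P.isFace_empty, by simp⟩

variable {P} in
-- Follow a direction that annihilates the normals in `F` until a new facet is hit, which happens
-- because `Δ` is bounded.
theorem exists_ssuperset_isFace {F : Finset (Fin d)} (hF : P.IsFace F)
    (hne : P.normalSpan F ≠ ⊤) : ∃ G, P.IsFace G ∧ F ⊂ G := by
  obtain ⟨μ, hμ⟩ := hF
  obtain ⟨ν, hν, hle⟩ := Submodule.exists_le_ker_of_lt_top _ (lt_top_iff_ne_top.2 hne)
  have hνF : ∀ j ∈ F, ν (P.X j) = 0 := fun j hj => hle (P.X_mem_normalSpan hj)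
  have hex : ∃ j, ν (P.X j) < 0 := by
    by_contra! h
    exact hν (P.eq_zero_of_nonneg h)
  -- `k` is a facet that the ray meets first, at time `t`.
  obtain ⟨k, hk, hmin⟩ := Finset.exists_min_image
    (Finset.univ.filter fun j => ν (P.X j) < 0)
    (fun j => (μ (P.X j) - P.lam j) / -ν (P.X j)) (by simpa [Finset.filter_nonempty_iff] using hex)
  simp only [Finset.mem_filter, Finset.mem_univ, true_and] at hk hmin
  set t := (μ (P.X k) - P.lam k) / -ν (P.X k) with ht
  have h0 := P.mem_Δ.1 hμ.1
  have ht0 : 0 ≤ t := div_nonneg (by linarith [h0 k]) (by linarith)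
  have hmem : μ + t • ν ∈ P.Δ := P.mem_Δ.2 fun j => by
    simp only [LinearMap.add_apply, LinearMap.smul_apply, smul_eq_mul]
    rcases le_or_gt 0 (ν (P.X j)) with h | h
    · linarith [h0 j, mul_nonneg ht0 h]
    · have := hmin j h
      rw [le_div_iff₀ (by linarith)] at this
      linarith
  refine ⟨_, ⟨_, P.mem_openFace_of_mem hmem⟩, ?_⟩
  rw [Finset.ssubset_iff_of_subset]
  · refine ⟨k, ?_, fun hkF => by simp [hνF k hkF] at hk⟩
    simp only [Finset.mem_filter, Finset.mem_univ, true_and, LinearMap.add_apply,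
      LinearMap.smul_apply, smul_eq_mul]
    have : t * -ν (P.X k) = μ (P.X k) - P.lam k := div_mul_cancel₀ _ (by linarith)
    linarith
  · intro j hj
    simp [hνF j hj, (mem_openFace_iff.1 hμ).1 j hj]

variable {P} in
/-- Every face contains a vertex. -/
theorem exists_vertex {F : Finset (Fin d)} (hF : P.IsFace F) :
    ∃ G, P.IsFace G ∧ F ⊆ G ∧ P.normalSpan G = ⊤ := by
  classical
  obtain ⟨G, hG, hmax⟩ := Finset.exists_max_image
    (Finset.univ.filter fun G => P.IsFace G ∧ F ⊆ G) Finset.card ⟨F, by simp [hF]⟩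
  simp only [Finset.mem_filter, Finset.mem_univ, true_and] at hG hmax
  refine ⟨G, hG.1, hG.2, ?_⟩
  by_contra hne
  obtain ⟨G', hG', hlt⟩ := exists_ssuperset_isFace hG.1 hne
  exact (Finset.card_lt_card hlt).not_ge (hmax G' ⟨hG', hG.2.trans hlt.subset⟩)

variable {P} in
-- The equalities in `G` at an interior point of a segment in `Δ` hold at both ends, and functionals
-- that agree on spanning normals coincide.
theorem mem_extremePoints_of_normalSpan_eq_top {G : Finset (Fin d)} {μ : Module.Dual ℝ 𝔡}
    (hμ : μ ∈ P.openFace G) (hG : P.normalSpan G = ⊤) : μ ∈ P.Δ.extremePoints ℝ := by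
  rw [mem_extremePoints_iff_left]
  refine ⟨hμ.1, fun μ₁ h₁ μ₂ h₂ hseg => ?_⟩
  obtain ⟨a, c, ha, hc, hac, rfl⟩ := hseg
  rw [P.mem_Δ] at h₁ h₂
  rw [mem_openFace_iff] at hμ
  rw [← sub_eq_zero]
  ext x
  refine P.eq_zero_of_mem_normalSpan (F := G) (fun j hj => ?_) (by rw [hG]; trivial)
  have h3 := hμ.1 j hj
  simp only [LinearMap.add_apply, LinearMap.smul_apply, LinearMap.sub_apply, smul_eq_mul]
    at h3 ⊢
  have h4 := h₁ j
  have h5 := h₂ j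
  have e1 : a * (μ₁ (P.X j) - P.lam j) + c * (μ₂ (P.X j) - P.lam j) = 0 := by
    linear_combination h3 - P.lam j * hac
  have e2 : a * (μ₁ (P.X j) - P.lam j) = 0 := by
    nlinarith [mul_nonneg ha.le (sub_nonneg.2 h4), mul_nonneg hc.le (sub_nonneg.2 h5)]
  have e3 : μ₁ (P.X j) - P.lam j = 0 := by
    rcases mul_eq_zero.1 e2 with h | h
    · exact absurd h ha.ne'
    · exact h
  rw [e3, mul_zero, zero_add] at e1
  have e4 : μ₂ (P.X j) - P.lam j = 0 := by
    rcases mul_eq_zero.1 e1 with h | h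
    · exact absurd h hc.ne'
    · exact h
  linear_combination (1 - a) * e3 - c * e4 - P.lam j * hac

/-! ### Basis sets -/

variable {P} in
theorem IsBasisSet.linearIndepOn {I : Finset (Fin d)} (hI : P.IsBasisSet I) :
    LinearIndepOn ℝ P.X (I : Set (Fin d)) := hI.1

/-- The basis of `𝔡` given by a basis set. -/
noncomputable def IsBasisSet.basis {P : ToricDatum 𝔡 d} {I : Finset (Fin d)}
    (hI : P.IsBasisSet I) : Module.Basis I ℝ 𝔡 :=
  Module.Basis.mk hI.1 (by
    have h := hI.2.1
    rw [Set.image_eq_range] at h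
    exact h.ge)

theorem IsBasisSet.basis_apply {P : ToricDatum 𝔡 d} {I : Finset (Fin d)}
    (hI : P.IsBasisSet I) (i : I) : hI.basis i = P.X i := by
  simp [IsBasisSet.basis]

theorem IsBasisSet.card_eq {P : ToricDatum 𝔡 d} {I : Finset (Fin d)}
    (hI : P.IsBasisSet I) : I.card = Module.finrank ℝ 𝔡 := by
  rw [Module.finrank_eq_card_basis hI.basis, Fintype.card_coe]

/-- A basis of the normal span of `F`, chosen among its normals, is extended to a basis of `𝔡`
within the normals at a vertex of the face. -/
theorem exists_isBasisSet [FiniteDimensional ℝ 𝔡] {F : Finset (Fin d)} (hF : P.IsFace F) :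
    ∃ I, P.IsBasisSet I ∧ (I ∩ F).card + P.faceDim F = Module.finrank ℝ 𝔡 := by
  classical
  obtain ⟨G, ⟨μ, hμ⟩, hFG, hG⟩ := exists_vertex hF
  obtain ⟨B, hBF, -, hB, hBi⟩ := exists_linearIndepOn_extension (K := ℝ) (v := P.X)
    (linearIndepOn_empty ℝ P.X) (Set.empty_subset (F : Set (Fin d)))
  obtain ⟨I, hIG, hBI, hI, hIi⟩ := exists_linearIndepOn_extension hBi
    (hBF.trans (show (F : Set (Fin d)) ⊆ G by exact_mod_cast hFG))
  lift B to Finset (Fin d) using B.toFinite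
  lift I to Finset (Fin d) using I.toFinite
  have hspan : Submodule.span ℝ (P.X '' I) = ⊤ := by
    rw [eq_top_iff, ← hG]
    exact Submodule.span_le.2 hI
  have hsub : B ⊆ I ∩ F := Finset.subset_inter (by exact_mod_cast hBI) (by exact_mod_cast hBF)
  have hs : P.normalSpan (I ∩ F) = P.normalSpan F :=
    (P.normalSpan_mono Finset.inter_subset_right).antisymm
      ((Submodule.span_le.2 hB).trans (P.normalSpan_mono hsub))
  refine ⟨I, ⟨hIi, hspan, μ, mem_extremePoints_of_normalSpan_eq_top hμ hG, fun j hj =>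
    (mem_openFace_iff.1 hμ).1 j (hIG hj)⟩, ?_⟩
  rw [← finrank_normalSpan_add_faceDim hF, ← hs, P.finrank_normalSpan_of_linearIndepOn
    (hIi.mono (Finset.coe_subset.2 Finset.inter_subset_left))]

variable {P} in
theorem IsBasisSet.normalSpan_inter [FiniteDimensional ℝ 𝔡] {I F : Finset (Fin d)}
    (hI : P.IsBasisSet I) (hF : P.IsFace F)
    (h : (I ∩ F).card + P.faceDim F = Module.finrank ℝ 𝔡) :
    P.normalSpan (I ∩ F) = P.normalSpan F := by
  refine Submodule.eq_of_le_of_finrank_le (P.normalSpan_mono Finset.inter_subset_right) ?_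
  rw [P.finrank_normalSpan_of_linearIndepOn
    (hI.linearIndepOn.mono (Finset.coe_subset.2 Finset.inter_subset_left))]
  have := finrank_normalSpan_add_faceDim hF
  omega

variable {P} in
theorem exists_isBasisSet_superset [FiniteDimensional ℝ 𝔡] {F : Finset (Fin d)}
    (hF : P.IsRegular F) : ∃ I, P.IsBasisSet I ∧ F ⊆ I := by
  obtain ⟨I, hI, hc⟩ := P.exists_isBasisSet hF.1
  refine ⟨I, hI, Finset.inter_eq_right.1
    (Finset.eq_of_subset_of_card_le Finset.inter_subset_right ?_)⟩
  have := hF.2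
  omega

variable {P} in
/-- A relation between the normals that is positive on the complement of `S` in the smallest
face containing `S`. -/
theorem exists_relation_minFace {S F : Finset (Fin d)} (hF : P.IsFace F) (hS : S ⊆ F) :
    ∃ y : Fin d → ℝ, ∑ j, y j • P.X j = 0 ∧ (∀ j ∈ P.minFace S, j ∉ S → 0 < y j) ∧
      ∀ j, j ∉ P.minFace S → y j = 0 := by
  classical
  set M := P.minFace S with hM
  obtain ⟨μ, hμ⟩ := isFace_minFace hF hS
  have hSM := P.subset_minFace S
  obtain ⟨y, hy, hmem⟩ := exists_pos_sum_smul_mem (P.normalSpan S)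
    (fun j : ↥(M \ S) => P.X j) fun ν h0 hpos => by
      have hpos' : ∀ j ∈ M, 0 ≤ ν (P.X j) := fun j hj => by
        by_cases hjS : j ∈ S
        · exact (h0 _ (P.X_mem_normalSpan hjS)).ge
        · exact hpos ⟨j, Finset.mem_sdiff.2 ⟨hj, hjS⟩⟩
      -- A small step along `ν` leads to a face whose index set contains `S` and lies in `M`;
      -- minimality of `M` makes `ν` vanish on all normals in `M`.
      obtain ⟨ε, -, h⟩ := exists_add_smul_mem_openFace hμ hpos'
      have hsub := minFace_subset ⟨_, h⟩ fun j hj => Finset.mem_filter.2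
        ⟨hSM hj, h0 _ (P.X_mem_normalSpan hj)⟩
      exact fun i => (Finset.mem_filter.1 (hsub (Finset.mem_sdiff.1 i.2).1)).2
  -- Membership in the span becomes a relation by subtracting a combination of the normals in `S`,
  -- which leaves the other coefficients unchanged.
  obtain ⟨c, hc, hsum⟩ := P.mem_normalSpan_iff.1 hmem
  let y' : Fin d → ℝ := fun j => if h : j ∈ M \ S then y ⟨j, h⟩ else 0
  have hy' : ∑ j, y' j • P.X j = ∑ j, y j • P.X j := by
    rw [← Finset.sum_subset (Finset.subset_univ (M \ S)) fun j _ hj => by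
      simp only [y', dif_neg hj, zero_smul], ← Finset.sum_coe_sort (M \ S)]
    exact Finset.sum_congr rfl fun j _ => by
      have := j.2
      simp only [y', dif_pos this]
  refine ⟨y' - c, ?_, fun j hj hjS => ?_, fun j hj => ?_⟩
  · simp [sub_smul, Finset.sum_sub_distrib, hsum, hy']
  · have h : j ∈ M \ S := Finset.mem_sdiff.2 ⟨hj, hjS⟩
    simp only [Pi.sub_apply, hc j hjS, sub_zero, y', dif_pos h]
    exact hy _
  · have h : j ∉ M \ S := fun h => hj (Finset.mem_sdiff.1 h).1
    simp only [Pi.sub_apply, hc j fun h => hj (hSM h), sub_zero, y', dif_neg h]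

end ToricDatum

/-! ### Real and imaginary parts -/

namespace Complexification

variable {𝔡 : Type u} [AddCommGroup 𝔡] [Module ℝ 𝔡]

/-- The map `𝔡_ℂ → 𝔡` given by a real functional on `ℂ`, such as the real or the imaginary part. -/
noncomputable def part (φ : ℂ →ₗ[ℝ] ℝ) : Complexification 𝔡 →+ 𝔡 :=
  ((TensorProduct.lid ℝ 𝔡).toLinearMap ∘ₗ LinearMap.rTensor 𝔡 φ).toAddMonoidHom

theorem smul_incl (c : ℂ) (x : 𝔡) : c • incl x = (c ⊗ₜ[ℝ] x : ℂ ⊗[ℝ] 𝔡) := by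
  change c • ((1 : ℂ) ⊗ₜ[ℝ] x : ℂ ⊗[ℝ] 𝔡) = _
  rw [TensorProduct.smul_tmul', smul_eq_mul, mul_one]

theorem part_smul_incl (φ : ℂ →ₗ[ℝ] ℝ) (c : ℂ) (x : 𝔡) : part φ (c • incl x) = φ c • x := by
  rw [smul_incl]
  change (TensorProduct.lid ℝ 𝔡) (LinearMap.rTensor 𝔡 φ (c ⊗ₜ[ℝ] x)) = _
  rw [LinearMap.rTensor_tmul, TensorProduct.lid_tmul]

theorem part_incl (φ : ℂ →ₗ[ℝ] ℝ) (x : 𝔡) : part φ (incl x) = φ 1 • x := by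
  rw [← part_smul_incl, one_smul]

theorem incl_smul (r : ℝ) (x : 𝔡) : incl (r • x) = (r : ℂ) • incl x := by
  rw [smul_incl]
  change ((1 : ℂ) ⊗ₜ[ℝ] (r • x) : ℂ ⊗[ℝ] 𝔡) = _
  rw [← TensorProduct.smul_tmul]
  simp

theorem smul_incl_sum {ι : Type*} [Fintype ι] (c : ℂ) (a : ι → ℝ) (v : ι → 𝔡) :
    c • incl (∑ i, a i • v i) = ∑ i, (c * a i) • incl (v i) := by
  rw [map_sum, Finset.smul_sum]
  exact Finset.sum_congr rfl fun i _ => by rw [incl_smul, smul_smul]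

theorem induction_on {p : Complexification 𝔡 → Prop} (v : Complexification 𝔡)
    (zero : p 0) (smul : ∀ (c : ℂ) (x : 𝔡), p (c • incl x)) (add : ∀ v w, p v → p w → p (v + w)) :
    p v := by
  refine TensorProduct.induction_on (motive := p) v zero (fun c x => ?_) add
  rw [← smul_incl]
  exact smul c x

theorem sum_smul_incl {ι : Type*} [Fintype ι] (Z : ι → ℂ) (v : ι → 𝔡) :
    ∑ i, Z i • incl (v i) =
      incl (∑ i, (Z i).re • v i) + Complex.I • incl (∑ i, (Z i).im • v i) := by
  rw [← one_smul ℂ (incl (∑ i, (Z i).re • v i)), smul_incl_sum, smul_incl_sum,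
    ← Finset.sum_add_distrib]
  refine Finset.sum_congr rfl fun i _ => ?_
  rw [← add_smul, one_mul, mul_comm, Complex.re_add_im]

end Complexification

namespace ToricDatum

variable {𝔡 : Type u} [AddCommGroup 𝔡] [Module ℝ 𝔡] {d : ℕ} (P : ToricDatum 𝔡 d)

open Complexification in
-- `Q` consists of real vectors, so membership splits into a condition on the real part and
-- vanishing of the imaginary part; this ties `logGroup` to `N_ℂ`.
theorem sum_smul_incl_mem_QC_iff {ι : Type*} [Fintype ι] (Z : ι → ℂ) (v : ι → 𝔡) :
    ∑ i, Z i • incl (v i) ∈ P.QC ↔ Z ∈ TorusSlice.logGroup v P.Q := by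
  rw [TorusSlice.mem_logGroup]
  constructor
  · rintro ⟨q, hq, h⟩
    have h1 := congrArg (part Complex.reLm) h
    have h2 := congrArg (part Complex.imLm) h
    simp only [part_incl, map_sum, part_smul_incl, Complex.reLm_coe, Complex.imLm_coe,
      Complex.one_re, Complex.one_im, one_smul, zero_smul] at h1 h2
    rw [← h1, ← h2]
    exact ⟨hq, rfl⟩
  · rintro ⟨h1, h2⟩
    rw [sum_smul_incl, h2, map_zero, smul_zero, add_zero]
    exact ⟨_, h1, rfl⟩

theorem πC_apply (Z : Fin d → ℂ) : P.πC Z = ∑ j, Z j • Complexification.incl (P.X j) := by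
  simp [πC, Fintype.linearCombination_apply]

theorem π_apply (x : Fin d → ℝ) : P.π x = ∑ j, x j • P.X j := by
  simp [π, Fintype.linearCombination_apply]

theorem πC_mem_QC_iff (Z : Fin d → ℂ) :
    P.πC Z ∈ P.QC ↔ Z ∈ TorusSlice.logGroup P.X P.Q := by
  rw [πC_apply, sum_smul_incl_mem_QC_iff]

theorem πC_surjective : Function.Surjective P.πC := by
  intro v
  induction v using Complexification.induction_on with
  | zero => exact ⟨0, map_zero _⟩
  | smul c x =>
    obtain ⟨a, -, ha⟩ := P.mem_normalSpan_iff.1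
      (show x ∈ P.normalSpan Finset.univ by rw [normalSpan_univ]; trivial)
    refine ⟨fun j => c * a j, ?_⟩
    rw [πC_apply, ← ha, Complexification.smul_incl_sum]
  | add v w hv hw =>
    obtain ⟨Z, rfl⟩ := hv
    obtain ⟨W, rfl⟩ := hw
    exact ⟨Z + W, map_add _ _ _⟩

theorem mem_NC_iff {t : Fin d → ℂˣ} :
    t ∈ P.NC ↔ ∃ Z ∈ TorusSlice.logGroup P.X P.Q, t = expC Z := by
  simp only [← πC_mem_QC_iff]
  rfl

theorem mem_A_iff {t : Fin d → ℂˣ} : t ∈ P.A ↔ ∃ y : Fin d → ℝ, ∑ j, y j • P.X j = 0 ∧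
    t = expC fun j => Complex.I * y j := by
  simp only [← π_apply]
  rfl

theorem mem_N_iff {t : Fin d → ℂˣ} : t ∈ P.N ↔ ∃ x : Fin d → ℝ, ∑ j, x j • P.X j ∈ P.Q ∧
    t = expC fun j => (x j : ℂ) := by
  simp only [← π_apply]
  rfl

theorem N_le_NC : P.N ≤ P.NC := by
  intro t ht
  obtain ⟨x, hx, rfl⟩ := P.mem_N_iff.1 ht
  exact P.mem_NC_iff.2 ⟨_, ⟨by simpa using hx, by simp⟩, rfl⟩

theorem A_le_NC : P.A ≤ P.NC := by
  intro t ht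
  obtain ⟨y, hy, rfl⟩ := P.mem_A_iff.1 ht
  exact P.mem_NC_iff.2 ⟨_, ⟨by simp [P.Q.zero_mem], by simpa using hy⟩, rfl⟩

/-- Polar decomposition: the real part of `Z` gives the factor in `N`, the imaginary part the factor
in `A`. -/
theorem exists_mul_of_mem_NC {t : Fin d → ℂˣ} (ht : t ∈ P.NC) :
    ∃ n ∈ P.N, ∃ a ∈ P.A, t = n * a := by
  obtain ⟨Z, hZ, rfl⟩ := P.mem_NC_iff.1 ht
  refine ⟨_, P.mem_N_iff.2 ⟨fun j => (Z j).re, hZ.1, rfl⟩, _,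
    P.mem_A_iff.2 ⟨fun j => (Z j).im, hZ.2, rfl⟩, ?_⟩
  rw [← expC_add]
  congr 1
  ext j
  simp [mul_comm Complex.I, Complex.re_add_im]

/-! ### Orbits of `A` and their closures -/

variable {P}

theorem smul_apply (t : Fin d → ℂˣ) (z : P.CΔ) (j : Fin d) :
    ((t • z : P.CΔ) : Fin d → ℂ) j = t j * (z : Fin d → ℂ) j := rfl

/-- Since exp(2πi · iy) = exp(-2πy), `A` acts by positive factors whose logarithms run over the real
relations between the normals. -/
theorem mem_orbit_A_iff {z w : P.CΔ} : w ∈ MulAction.orbit P.A z ↔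
    ∃ y : Fin d → ℝ, ∑ j, y j • P.X j = 0 ∧
      ∀ j, (w : Fin d → ℂ) j = Real.exp (y j) * (z : Fin d → ℂ) j := by
  have hexp : ∀ y : ℝ, Complex.exp (2 * Real.pi * Complex.I * (Complex.I * y)) =
      (Real.exp (-2 * Real.pi * y) : ℝ) := fun y => by
    rw [Complex.ofReal_exp]
    congr 1
    push_cast
    linear_combination (2 * Real.pi * y : ℂ) * Complex.I_mul_I
  constructor
  · rintro ⟨⟨t, ht⟩, rfl⟩
    obtain ⟨y, hy, rfl⟩ := P.mem_A_iff.1 ht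
    refine ⟨fun j => -2 * Real.pi * y j, ?_, fun j => ?_⟩
    · simp only [mul_smul, ← Finset.smul_sum, hy, smul_zero]
    · change Complex.exp (2 * Real.pi * Complex.I * (Complex.I * y j)) * _ = _
      rw [hexp]
  · rintro ⟨y, hy, h⟩
    refine ⟨⟨_, P.mem_A_iff.2 ⟨fun j => (-2 * Real.pi)⁻¹ * y j, ?_, rfl⟩⟩, ?_⟩
    · simp only [mul_smul, ← Finset.smul_sum, hy, smul_zero]
    · refine Subtype.ext (funext fun j => ?_)
      change Complex.exp (2 * Real.pi * Complex.I * (Complex.I *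
        (((-2 * Real.pi)⁻¹ * y j : ℝ) : ℂ))) * _ = _
      rw [hexp, h j, mul_inv_cancel_left₀ (by simp [Real.pi_ne_zero])]

/-- The set of the vanishing coordinates. -/
noncomputable def zeros (z : P.CΔ) : Finset (Fin d) :=
  Finset.univ.filter fun j => (z : Fin d → ℂ) j = 0

theorem mem_zeros {z : P.CΔ} {j : Fin d} : j ∈ zeros z ↔ (z : Fin d → ℂ) j = 0 := by
  simp [zeros]

theorem zeros_smul (t : Fin d → ℂˣ) (z : P.CΔ) : zeros (t • z) = zeros z := by
  ext j; simp [mem_zeros, smul_apply]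

theorem exists_isFace_zeros_subset (z : P.CΔ) : ∃ F, P.IsFace F ∧ zeros z ⊆ F := by
  obtain ⟨F, hF, h⟩ := z.2
  exact ⟨F, hF, fun j hj => h j (mem_zeros.1 hj)⟩

/-- The index set of the face to whose orbit the class of `z` belongs. -/
noncomputable def face (z : P.CΔ) : Finset (Fin d) := P.minFace (zeros z)

theorem isFace_face (z : P.CΔ) : P.IsFace (face z) := by
  obtain ⟨F, hF, h⟩ := exists_isFace_zeros_subset z
  exact isFace_minFace hF h

theorem zeros_subset_face (z : P.CΔ) : zeros z ⊆ face z := P.subset_minFace _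

theorem face_subset {z : P.CΔ} {F : Finset (Fin d)} (hF : P.IsFace F) (h : zeros z ⊆ F) :
    face z ⊆ F := minFace_subset hF h

theorem face_smul (t : Fin d → ℂˣ) (z : P.CΔ) : face (t • z) = face z := by
  rw [face, zeros_smul, face]

theorem ne_zero_of_notMem_face {z : P.CΔ} {j : Fin d} (hj : j ∉ face z) :
    (z : Fin d → ℂ) j ≠ 0 := fun h => hj (zeros_subset_face z (mem_zeros.2 h))

/-- The point with the coordinates in `face z` replaced by zeros. -/
noncomputable def retr (z : P.CΔ) : P.CΔ :=
  ⟨fun j => if j ∈ face z then 0 else (z : Fin d → ℂ) j, face z, isFace_face z, fun j hj => by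
    by_contra h
    simp only [if_neg h] at hj
    exact ne_zero_of_notMem_face h hj⟩

theorem retr_apply (z : P.CΔ) (j : Fin d) :
    (retr z : Fin d → ℂ) j = if j ∈ face z then 0 else (z : Fin d → ℂ) j := rfl

theorem retr_smul (t : Fin d → ℂˣ) (z : P.CΔ) : retr (t • z) = t • retr z := by
  refine Subtype.ext (funext fun j => ?_)
  rw [smul_apply, retr_apply, retr_apply, face_smul, smul_apply]
  split_ifs <;> simp

theorem zeros_eq_of_mem_coordStratum {F : Finset (Fin d)} {z : P.CΔ}
    (h : z ∈ P.coordStratum F) : zeros z = F := by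
  ext j; rw [mem_zeros]; exact h j

theorem face_eq_of_mem_coordStratum {F : Finset (Fin d)} (hF : P.IsFace F) {z : P.CΔ}
    (h : z ∈ P.coordStratum F) : face z = F := by
  rw [face, zeros_eq_of_mem_coordStratum h, minFace_eq_self hF]

theorem retr_mem_coordStratum (z : P.CΔ) : retr z ∈ P.coordStratum (face z) := fun j => by
  rw [retr_apply]
  by_cases h : j ∈ face z
  · simp [h]
  · simp [h, ne_zero_of_notMem_face h]

theorem face_retr (z : P.CΔ) : face (retr z) = face z :=
  face_eq_of_mem_coordStratum (isFace_face z) (retr_mem_coordStratum z)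

theorem retr_eq_self {F : Finset (Fin d)} (hF : P.IsFace F) {z : P.CΔ}
    (h : z ∈ P.coordStratum F) : retr z = z := by
  refine Subtype.ext (funext fun j => ?_)
  rw [retr_apply, face_eq_of_mem_coordStratum hF h]
  split_ifs with hj
  · exact ((h j).2 hj).symm
  · rfl

theorem retr_retr (z : P.CΔ) : retr (retr z) = retr z :=
  retr_eq_self (isFace_face z) (retr_mem_coordStratum z)

/-- The relation of `exists_relation_minFace` gives a one-parameter subgroup of `A` that contracts
the nonzero coordinates in `face z` to zero and fixes those outside. Where the sign of the relation
is unknown, `z` already vanishes. -/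
theorem retr_mem_closure (z : P.CΔ) : retr z ∈ closure (MulAction.orbit P.A z) := by
  obtain ⟨F, hF, hz⟩ := exists_isFace_zeros_subset z
  obtain ⟨y, hy, hpos, hzero⟩ := exists_relation_minFace hF hz
  let t : ℕ → P.CΔ := fun n => ⟨fun j => Real.exp (-(n * y j)) * (z : Fin d → ℂ) j, F, hF,
    fun j hj => hz (mem_zeros.2 (by simpa using hj))⟩
  refine mem_closure_of_tendsto (f := t) (b := Filter.atTop) ?_
    (Filter.Eventually.of_forall fun n => mem_orbit_A_iff.2
      ⟨fun j => -(n * y j), ?_, fun j => rfl⟩)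
  · rw [tendsto_subtype_rng, tendsto_pi_nhds]
    intro j
    change Filter.Tendsto (fun n : ℕ => ((Real.exp (-(n * y j)) : ℝ) : ℂ) * (z : Fin d → ℂ) j) _ _
    rw [retr_apply]
    split_ifs with hj
    · by_cases hzj : (z : Fin d → ℂ) j = 0
      · simp [hzj]
      · have h0 : 0 < y j := hpos j hj fun h => hzj (mem_zeros.1 h)
        rw [← zero_mul ((z : Fin d → ℂ) j)]
        refine Filter.Tendsto.mul_const _ ?_
        rw [← Complex.ofReal_zero]
        refine (Complex.continuous_ofReal.tendsto 0).comp (Real.tendsto_exp_neg_atTop_nhds_zero.comp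
          (tendsto_natCast_atTop_atTop.atTop_mul_const h0))
    · simp [hzero j hj]
  · simp only [neg_smul, mul_smul, Finset.sum_neg_distrib, ← Finset.smul_sum, hy, smul_zero,
      neg_zero]

theorem eq_zero_of_mem_closure {z w : P.CΔ} (h : w ∈ closure (MulAction.orbit P.A z)) {j : Fin d}
    (hj : (z : Fin d → ℂ) j = 0) : (w : Fin d → ℂ) j = 0 := by
  have hcl : IsClosed {u : P.CΔ | (u : Fin d → ℂ) j = 0} :=
    isClosed_eq ((continuous_apply j).comp continuous_subtype_val) continuous_const
  refine closure_minimal (fun u hu => ?_) hcl h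
  obtain ⟨y, -, hy⟩ := mem_orbit_A_iff.1 hu
  simp [hy j, hj]

theorem zeros_subset_of_mem_closure {z w : P.CΔ} (h : w ∈ closure (MulAction.orbit P.A z)) :
    zeros z ⊆ zeros w := fun _ hj => mem_zeros.2 (eq_zero_of_mem_closure h (mem_zeros.1 hj))

/-- Taking the closure of an `A`-orbit does not lead out of the sets `ℂ^F × (ℂ^*)^{F^c}`. -/
theorem zeros_subset_isFace_of_mem_closure {z w : P.CΔ}
    (h : w ∈ closure (MulAction.orbit P.A z)) {F : Finset (Fin d)} (hF : P.IsFace F)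
    (hz : zeros z ⊆ F) : zeros w ⊆ F := by
  obtain ⟨G, hG, hw⟩ := exists_isFace_zeros_subset w
  have hzw := zeros_subset_of_mem_closure h
  -- The difference of a point of the open face `F ∩ G` and one of `G` is zero on the normals in `F
  -- ∩ G` and positive on those in `G \ F`.
  obtain ⟨μ₁, h₁⟩ := hF.inter hG
  obtain ⟨μ₂, h₂⟩ := hG
  rw [mem_openFace_iff] at h₁ h₂
  set ν := μ₁ - μ₂ with hν
  have hν0 : ∀ j ∈ F ∩ G, ν (P.X j) = 0 := fun j hj => by
    rw [hν, LinearMap.sub_apply, h₁.1 j hj, h₂.1 j (Finset.mem_inter.1 hj).2, sub_self]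
  have hνpos : ∀ j ∈ G, j ∉ F → 0 < ν (P.X j) := fun j hj hjF => by
    rw [hν, LinearMap.sub_apply, h₂.1 j hj, sub_pos]
    exact h₁.2 j fun h => hjF (Finset.mem_inter.1 h).1
  -- This monomial is `A`-invariant because `ν` kills relations between normals, and continuous at
  -- `w`, whose coordinates outside `G` are nonzero. It is nonzero at `z`, but would be zero at `w`
  -- if `w` vanished at a coordinate in `G \ F`.
  let Φ : P.CΔ → ℝ := fun u => ∏ j, ‖(u : Fin d → ℂ) j‖ ^ ν (P.X j)
  have hΦc : ContinuousAt Φ w := by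
    refine tendsto_finsetProd _ fun j _ => ?_
    have hn : ContinuousAt (fun u : P.CΔ => ‖(u : Fin d → ℂ) j‖) w :=
      ((continuous_apply j).comp continuous_subtype_val).norm.continuousAt
    refine hn.rpow_const ?_
    by_cases hjG : j ∈ G
    · right
      by_cases hjF : j ∈ F
      · exact (hν0 j (Finset.mem_inter.2 ⟨hjF, hjG⟩)).ge
      · exact (hνpos j hjG hjF).le
    · exact Or.inl (norm_ne_zero_iff.2 fun h0 => hjG (hw (mem_zeros.2 h0)))
  have hΦ : ∀ u ∈ MulAction.orbit P.A z, Φ u = Φ z := by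
    intro u hu
    obtain ⟨y, hy, hu⟩ := mem_orbit_A_iff.1 hu
    have : ∀ j, ‖(u : Fin d → ℂ) j‖ ^ ν (P.X j) =
        Real.exp (y j * ν (P.X j)) * ‖(z : Fin d → ℂ) j‖ ^ ν (P.X j) := fun j => by
      rw [hu j, norm_mul, Complex.norm_real, Real.norm_eq_abs, Real.abs_exp,
        Real.mul_rpow (Real.exp_pos _).le (norm_nonneg _), Real.exp_mul]
    simp only [Φ, this, Finset.prod_mul_distrib]
    rw [← Real.exp_sum, show ∑ j, y j * ν (P.X j) = ν (∑ j, y j • P.X j) by simp, hy, map_zero,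
      Real.exp_zero, one_mul]
  have hΦw : Φ w = Φ z := by
    have := hΦc.continuousWithinAt.mem_closure_image h
    refine Set.mem_singleton_iff.1 (closure_minimal ?_ isClosed_singleton this)
    rintro _ ⟨u, hu, rfl⟩
    exact hΦ u hu
  have hΦz : Φ z ≠ 0 := Finset.prod_ne_zero_iff.2 fun j _ => by
    by_cases hj : j ∈ F ∩ G
    -- The exponent is 0, so the factor is 1 even where the coordinate vanishes.
    · simp [hν0 j hj]
    · refine (Real.rpow_pos_of_pos (norm_pos_iff.2 fun h0 => hj ?_) _).ne'
      have := mem_zeros.2 h0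
      exact Finset.mem_inter.2 ⟨hz this, hw (hzw this)⟩
  intro j hj
  by_contra hjF
  rw [← hΦw] at hΦz
  refine Finset.prod_ne_zero_iff.1 hΦz j (Finset.mem_univ j) ?_
  rw [mem_zeros.1 hj, norm_zero, Real.zero_rpow (hνpos j (hw hj) hjF).ne']

theorem face_eq_of_mem_closure {z w : P.CΔ} (h : w ∈ closure (MulAction.orbit P.A z)) :
    face w = face z :=
  (face_subset (isFace_face z) (zeros_subset_isFace_of_mem_closure h (isFace_face z)
    (zeros_subset_face z))).antisymm
  (face_subset (isFace_face w) ((zeros_subset_of_mem_closure h).trans (zeros_subset_face w)))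

/-- Outside `face z` the logarithms of the moduli along the orbit form a translate of the subspace
`K`, closed by finite dimensionality, and the arguments are constant. So limits give nothing new on
these coordinates. -/
theorem retr_mem_orbit {z w : P.CΔ} (h : w ∈ closure (MulAction.orbit P.A z)) :
    retr w ∈ MulAction.orbit P.A (retr z) := by
  classical
  have hface := face_eq_of_mem_closure h
  let ρ : (Fin d → ℝ) →ₗ[ℝ] (Fin d → ℝ) :=
    LinearMap.pi fun j => if j ∈ face z then 0 else LinearMap.proj j
  have hρ : ∀ y j, ρ y j = if j ∈ face z then 0 else y j := fun y j => by
    simp only [ρ, LinearMap.pi_apply]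
    split_ifs <;> simp
  let K : Submodule ℝ (Fin d → ℝ) := (LinearMap.ker (Fintype.linearCombination ℝ P.X)).map ρ
  let g : P.CΔ → Fin d → ℝ := fun u j =>
    if j ∈ face z then 0 else Real.log ‖(u : Fin d → ℂ) j‖ - Real.log ‖(z : Fin d → ℂ) j‖
  have hgc : ContinuousAt g w := by
    refine tendsto_pi_nhds.2 fun j => ?_
    change ContinuousAt (fun u => g u j) w
    simp only [g]
    split_ifs with hj
    · exact continuousAt_const
    · refine ContinuousAt.sub (ContinuousAt.log ?_ ?_) continuousAt_const
      · exact ((continuous_apply j).comp continuous_subtype_val).norm.continuousAt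
      · exact norm_ne_zero_iff.2 (ne_zero_of_notMem_face (hface ▸ hj))
  have hgK : g w ∈ K := by
    have := hgc.continuousWithinAt.mem_closure_image h
    refine closure_minimal ?_ K.closed_of_finiteDimensional this
    rintro _ ⟨u, hu, rfl⟩
    obtain ⟨y, hy, hu⟩ := mem_orbit_A_iff.1 hu
    refine ⟨y, by simpa [Fintype.linearCombination_apply] using hy, funext fun j => ?_⟩
    rw [hρ]
    simp only [g]
    split_ifs with hj
    · rfl
    · rw [hu j, norm_mul, Complex.norm_real, Real.norm_eq_abs, Real.abs_exp,
        Real.log_mul (Real.exp_ne_zero _) (norm_ne_zero_iff.2 (ne_zero_of_notMem_face hj)),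
        Real.log_exp, add_sub_cancel_right]
  obtain ⟨y, hy, hyg⟩ := hgK
  refine mem_orbit_A_iff.2 ⟨y, by simpa [Fintype.linearCombination_apply] using hy, fun j => ?_⟩
  rw [retr_apply, retr_apply, hface]
  split_ifs with hj
  · simp
  · have hz0 : ‖(z : Fin d → ℂ) j‖ ≠ 0 := norm_ne_zero_iff.2 (ne_zero_of_notMem_face hj)
    have hw0 : ‖(w : Fin d → ℂ) j‖ ≠ 0 :=
      norm_ne_zero_iff.2 (ne_zero_of_notMem_face (hface ▸ hj))
    -- Equality of arguments, written without division so that it is a closed condition.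
    have harg : (w : Fin d → ℂ) j * (‖(z : Fin d → ℂ) j‖ : ℂ) =
        (z : Fin d → ℂ) j * (‖(w : Fin d → ℂ) j‖ : ℂ) := by
      have hcj : Continuous fun u : P.CΔ => (u : Fin d → ℂ) j :=
        (continuous_apply j).comp continuous_subtype_val
      have hcl : IsClosed {u : P.CΔ | (u : Fin d → ℂ) j * (‖(z : Fin d → ℂ) j‖ : ℂ) =
          (z : Fin d → ℂ) j * (‖(u : Fin d → ℂ) j‖ : ℂ)} :=
        isClosed_eq (hcj.mul continuous_const)
          (continuous_const.mul (Complex.continuous_ofReal.comp hcj.norm))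
      refine closure_minimal (fun u hu => ?_) hcl h
      obtain ⟨y, -, hu⟩ := mem_orbit_A_iff.1 hu
      simp only [Set.mem_ofPred_eq, hu j, norm_mul, Complex.norm_real, Real.norm_eq_abs,
        Real.abs_exp, Complex.ofReal_mul]
      ring
    have hyj := congrFun hyg j
    rw [hρ, if_neg hj] at hyj
    simp only [g, if_neg hj] at hyj
    rw [hyj, Real.exp_sub, Real.exp_log (by positivity), Real.exp_log (by positivity),
      Complex.ofReal_div]
    have hz0' : (‖(z : Fin d → ℂ) j‖ : ℂ) ≠ 0 := by exact_mod_cast hz0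
    rw [div_mul_eq_mul_div, eq_div_iff hz0', harg, mul_comm]

/-! ### The equivalence relation -/

/-- Each orbit closure contains the retraction of its base point, and all its points retract into
the `A`-orbit of that retraction; `N` and `A` together make up `N_ℂ`. -/
theorem rel_iff {z w : P.CΔ} : P.rel z w ↔ ∃ g ∈ P.NC, g • retr z = retr w := by
  constructor
  · rintro ⟨t, ht, u, hu, htu⟩
    obtain ⟨⟨a, ha⟩, h1⟩ := retr_mem_orbit hu
    obtain ⟨⟨c, hc⟩, h2⟩ := retr_mem_orbit htu
    change a • retr z = retr u at h1
    change c • retr w = retr (t • u) at h2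
    refine ⟨c⁻¹ * (t * a), P.NC.mul_mem (P.NC.inv_mem (P.A_le_NC hc))
      (P.NC.mul_mem (P.N_le_NC ht) (P.A_le_NC ha)), ?_⟩
    rw [mul_smul, mul_smul, h1, ← retr_smul, ← h2, inv_smul_smul]
  · rintro ⟨g, hg, h⟩
    obtain ⟨t, ht, a, ha, rfl⟩ := P.exists_mul_of_mem_NC hg
    refine ⟨t, ht, retr z, retr_mem_closure z, ?_⟩
    have h1 : t • retr z = a⁻¹ • retr w := by
      rw [← h, mul_comm, mul_smul, inv_smul_smul]
    rw [h1, ← retr_smul]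
    have : retr (a⁻¹ • w) ∈ closure (MulAction.orbit P.A (a⁻¹ • w)) := retr_mem_closure _
    rwa [show MulAction.orbit P.A (a⁻¹ • w) = MulAction.orbit P.A w from
      MulAction.orbit_eq_iff.2 ⟨⟨a⁻¹, P.A.inv_mem ha⟩, rfl⟩] at this

theorem rel_equivalence : Equivalence P.rel where
  refl z := rel_iff.2 ⟨1, one_mem _, one_smul _ _⟩
  symm h := by
    obtain ⟨g, hg, h⟩ := rel_iff.1 h
    exact rel_iff.2 ⟨g⁻¹, inv_mem hg, by rw [← h, inv_smul_smul]⟩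
  trans h h' := by
    obtain ⟨g, hg, h⟩ := rel_iff.1 h
    obtain ⟨g', hg', h'⟩ := rel_iff.1 h'
    exact rel_iff.2 ⟨g' * g, mul_mem hg' hg, by rw [mul_smul, h, h']⟩

theorem toSpace_eq_iff {z w : P.CΔ} :
    P.toSpace z = P.toSpace w ↔ ∃ g ∈ P.NC, g • retr z = retr w := by
  rw [toSpace, toSpace, Quot.eq, rel_equivalence.eqvGen_iff, rel_iff]

theorem toSpace_retr (z : P.CΔ) : P.toSpace (retr z) = P.toSpace z :=
  toSpace_eq_iff.2 ⟨1, one_mem _, by rw [one_smul, retr_retr]⟩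

theorem toSpace_smul_of_mem {g : Fin d → ℂˣ} (hg : g ∈ P.NC) (z : P.CΔ) :
    P.toSpace (g • z) = P.toSpace z :=
  toSpace_eq_iff.2 ⟨g⁻¹, inv_mem hg, by rw [retr_smul, inv_smul_smul]⟩

theorem toSpace_smul_congr (g : Fin d → ℂˣ) {z w : P.CΔ} (h : P.toSpace z = P.toSpace w) :
    P.toSpace (g • z) = P.toSpace (g • w) := by
  obtain ⟨t, ht, h⟩ := toSpace_eq_iff.1 h
  refine toSpace_eq_iff.2 ⟨t, ht, ?_⟩
  rw [retr_smul, retr_smul, ← h, smul_comm]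

theorem face_eq_of_toSpace_eq {z w : P.CΔ} (h : P.toSpace z = P.toSpace w) : face z = face w := by
  obtain ⟨g, -, h⟩ := toSpace_eq_iff.1 h
  rw [← face_retr z, ← face_retr w, ← h, face_smul]

theorem toSpace_surjective : Function.Surjective P.toSpace := Quot.mk_surjective

theorem isQuotientMap_toSpace : Topology.IsQuotientMap P.toSpace := isQuotientMap_quot_mk

theorem continuous_toSpace : Continuous P.toSpace := continuous_quot_mk

theorem toSpace_eq_iff_of_mem_coordStratum {F G : Finset (Fin d)} (hF : P.IsFace F)
    (hG : P.IsFace G) {z w : P.CΔ} (hz : z ∈ P.coordStratum F) (hw : w ∈ P.coordStratum G) :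
    P.toSpace z = P.toSpace w ↔ ∃ g ∈ P.NC, g • z = w := by
  rw [toSpace_eq_iff, retr_eq_self hF hz, retr_eq_self hG hw]

/-! ### Orbits and pieces -/

theorem toSpace_mem_faceOrbit_iff {F : Finset (Fin d)} (hF : P.IsFace F) {z : P.CΔ} :
    P.toSpace z ∈ P.faceOrbit F ↔ face z = F := by
  constructor
  · rintro ⟨w, hw, h⟩
    rw [← face_eq_of_toSpace_eq h, face_eq_of_mem_coordStratum hF hw]
  · rintro rfl
    exact ⟨retr z, retr_mem_coordStratum z, toSpace_retr z⟩

/-- The face is constant on closures of `A`-orbits, so the closure can meet the stratum of `F` only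
if `face z = F`. -/
theorem piece_eq_faceOrbit {F : Finset (Fin d)} (hF : P.IsFace F) : P.piece F = P.faceOrbit F := by
  ext x
  constructor
  · rintro ⟨z, ⟨w, hw, hwF⟩, rfl⟩
    rw [toSpace_mem_faceOrbit_iff hF, ← face_eq_of_mem_closure hw,
      face_eq_of_mem_coordStratum hF hwF]
  · rintro ⟨z, hz, rfl⟩
    exact ⟨z, ⟨z, subset_closure (MulAction.mem_orbit_self z), hz⟩, rfl⟩

theorem toSpace_mem_maxPiece_iff [FiniteDimensional ℝ 𝔡] {z : P.CΔ} :
    P.toSpace z ∈ P.maxPiece ↔ P.IsRegular (face z) := by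
  constructor
  · rintro ⟨w, ⟨F, hF, hw⟩, h⟩
    rw [← face_eq_of_toSpace_eq h]
    exact hF.subset (face_subset hF.1 fun j hj => hw j (mem_zeros.1 hj))
  · intro h
    exact ⟨z, ⟨_, h, fun j hj => zeros_subset_face z (mem_zeros.2 hj)⟩, rfl⟩

theorem maxPiece_eq_iUnion [FiniteDimensional ℝ 𝔡] :
    P.maxPiece = ⋃ F ∈ {F | P.IsRegular F}, P.faceOrbit F := by
  ext x
  obtain ⟨z, rfl⟩ := toSpace_surjective x
  rw [toSpace_mem_maxPiece_iff]
  simp only [Set.mem_iUnion, Set.mem_ofPred_eq, exists_prop]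
  constructor
  · exact fun h => ⟨_, h, (toSpace_mem_faceOrbit_iff h.1).2 rfl⟩
  · rintro ⟨F, hF, h⟩
    rwa [(toSpace_mem_faceOrbit_iff hF.1).1 h]

end ToricDatum

instance {𝔡 : Type u} [AddCommGroup 𝔡] [Module ℝ 𝔡] :
    IsModuleTopology ℂ (Complexification 𝔡) := ⟨rfl⟩

instance {𝔡 : Type u} [AddCommGroup 𝔡] [Module ℝ 𝔡] : ContinuousAdd (Complexification 𝔡) :=
  IsModuleTopology.toContinuousAdd ℂ _

namespace ToricDatum

variable {𝔡 : Type u} [AddCommGroup 𝔡] [Module ℝ 𝔡] {d : ℕ} {P : ToricDatum 𝔡 d}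

/-! ### Open subsets of the quotient -/

theorem isOpen_image_toSpace {V : Set P.CΔ} (hV : IsOpen V)
    (hs : ∀ z ∈ V, ∀ w, P.toSpace z = P.toSpace w → w ∈ V) : IsOpen (P.toSpace '' V) := by
  rw [← isQuotientMap_toSpace.isOpen_preimage]
  convert hV using 1
  ext z
  constructor
  · rintro ⟨w, hw, h⟩
    exact hs w hw z h
  · exact fun hz => ⟨z, hz, rfl⟩

theorem isOpen_zeros_subset (F : Finset (Fin d)) : IsOpen {z : P.CΔ | zeros z ⊆ F} := by
  have : {z : P.CΔ | zeros z ⊆ F} = ⋂ j, {z : P.CΔ | j ∉ F → (z : Fin d → ℂ) j ≠ 0} := by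
    ext z
    simp only [Set.mem_ofPred_eq, Set.mem_iInter]
    exact ⟨fun h j hj h0 => hj (h (mem_zeros.2 h0)), fun h j hj => by
      by_contra hjF
      exact h j hjF (mem_zeros.1 hj)⟩
  rw [this]
  refine isOpen_iInter_of_finite fun j => ?_
  by_cases hj : j ∈ F
  · simp [hj]
  · simp only [hj, not_false_eq_true, true_imp_iff]
    exact isOpen_ne_fun ((continuous_apply j).comp continuous_subtype_val) continuous_const

theorem mapsTo_toSpace_piece {F : Finset (Fin d)} (hF : P.IsFace F) :
    Set.MapsTo P.toSpace (P.coordStratum F) (P.piece F) := fun z hz => by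
  rw [piece_eq_faceOrbit hF]
  exact ⟨z, hz, rfl⟩

/-- The piece has the subspace topology of `X_Δ`, so an open subset of the stratum has to be
extended to a saturated open subset of `ℂ^d_Δ`. -/
theorem isOpenQuotientMap_piece {F : Finset (Fin d)} (hF : P.IsFace F) :
    IsOpenQuotientMap (mapsTo_toSpace_piece hF).restrict := by
  refine ⟨?_, continuous_toSpace.restrict _, ?_⟩
  · rintro ⟨x, hx⟩
    rw [piece_eq_faceOrbit hF] at hx
    obtain ⟨z, hz, rfl⟩ := hx
    exact ⟨⟨z, hz⟩, rfl⟩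
  · rintro _ ⟨U', hU', rfl⟩
    obtain ⟨O, hO, rfl⟩ := hU'
    let tr : (Fin d → ℂˣ) → P.CΔ → Fin d → ℂ := fun g z j =>
      if j ∈ F then 0 else g j * (z : Fin d → ℂ) j
    have htr : ∀ g, Continuous (tr g) := fun g => continuous_pi fun j => by
      by_cases hj : j ∈ F
      · simp only [tr, if_pos hj]; exact continuous_const
      · simp only [tr, if_neg hj]
        exact continuous_const.mul ((continuous_apply j).comp continuous_subtype_val)
    -- The points that some element of `N_ℂ`, followed by killing the coordinates in `F`, moves into
    -- `O`. The set is saturated: equivalent points have the same face and, outside it, differ by an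
    -- element of `N_ℂ`.
    let V : Set P.CΔ := {z | zeros z ⊆ F} ∩ ⋃ g ∈ P.NC, tr g ⁻¹' O
    have hV : IsOpen V := (isOpen_zeros_subset F).inter
      (isOpen_biUnion fun g _ => hO.preimage (htr g))
    have hsat : ∀ z ∈ V, ∀ w, P.toSpace z = P.toSpace w → w ∈ V := by
      rintro z ⟨hz, hzO⟩ w hzw
      have hface := face_eq_of_toSpace_eq hzw
      have hsub : face z ⊆ F := face_subset hF hz
      obtain ⟨t, ht, h⟩ := toSpace_eq_iff.1 hzw
      simp only [Set.mem_iUnion, exists_prop] at hzO ⊢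
      obtain ⟨g, hg, hgO⟩ := hzO
      refine ⟨(zeros_subset_face w).trans (hface ▸ hsub), ?_⟩
      simp only [Set.mem_iUnion, exists_prop]
      refine ⟨g * t⁻¹, mul_mem hg (inv_mem ht), ?_⟩
      rw [Set.mem_preimage] at hgO ⊢
      suffices heq : tr (g * t⁻¹) w = tr g z by rwa [heq]
      funext j
      simp only [tr]
      split_ifs with hj
      · rfl
      · have hjz : j ∉ face z := fun h => hj (hsub h)
        have h' := congrFun (congrArg Subtype.val h) j
        rw [smul_apply, retr_apply, retr_apply, ← hface, if_neg hjz, if_neg hjz] at h'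
        rw [← h', Pi.mul_apply, Pi.inv_apply, Units.val_mul, mul_assoc,
          Units.inv_mul_cancel_left]
    have himg := isOpen_image_toSpace hV hsat
    convert himg.preimage continuous_subtype_val using 1
    ext ⟨x, hx⟩
    constructor
    · rintro ⟨⟨z, hz⟩, hzO, hzx⟩
      refine ⟨z, ⟨(zeros_eq_of_mem_coordStratum hz).subset, ?_⟩, congrArg Subtype.val hzx⟩
      simp only [Set.mem_iUnion, exists_prop]
      refine ⟨1, one_mem _, ?_⟩
      rw [Set.mem_preimage]
      suffices heq : tr 1 z = z by rw [heq]; exact hzO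
      funext j
      simp only [tr]
      split_ifs with hj
      · exact ((hz j).2 hj).symm
      · simp
    · rintro ⟨z, ⟨-, hzO⟩, rfl⟩
      rw [piece_eq_faceOrbit hF, toSpace_mem_faceOrbit_iff hF] at hx
      simp only [Set.mem_iUnion, exists_prop] at hzO
      obtain ⟨g, hg, hgO⟩ := hzO
      have hmem : g • retr z ∈ P.coordStratum F := fun j => by
        rw [smul_apply, ← hx, ← retr_mem_coordStratum z j]
        simp
      refine ⟨⟨g • retr z, hmem⟩, ?_, Subtype.ext ?_⟩
      · suffices heq : ((g • retr z : P.CΔ) : Fin d → ℂ) = tr g z by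
          rw [Set.mem_preimage, Set.mem_preimage, heq]
          exact hgO
        funext j
        simp only [tr]
        rw [smul_apply, retr_apply, hx]
        split_ifs <;> simp
      · exact (toSpace_smul_of_mem hg _).trans (toSpace_retr z)

/-! ### The action of the complex quasitorus -/

variable (P) in
/-- The action of `exp Z` on `X_Δ`. -/
noncomputable def torusAct (Z : Fin d → ℂ) : P.Space → P.Space :=
  Quot.lift (fun z => P.toSpace (expC Z • z)) fun _ _ h =>
    toSpace_smul_congr _ (Quot.sound h)

theorem torusAct_toSpace (Z : Fin d → ℂ) (z : P.CΔ) :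
    P.torusAct Z (P.toSpace z) = P.toSpace (expC Z • z) := rfl

theorem torusAct_eq {Z W : Fin d → ℂ}
    (h : (QuotientAddGroup.mk (P.πC Z) : P.DC) = QuotientAddGroup.mk (P.πC W)) (x : P.Space) :
    P.torusAct Z x = P.torusAct W x := by
  obtain ⟨z, rfl⟩ := toSpace_surjective x
  rw [QuotientAddGroup.eq, ← map_neg, ← map_add, πC_mem_QC_iff] at h
  rw [torusAct_toSpace, torusAct_toSpace, ← toSpace_smul_of_mem (P.mem_NC_iff.2 ⟨_, h, rfl⟩),
    ← mul_smul, ← expC_add]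
  congr 3
  abel

theorem mk_πC_surjective :
    Function.Surjective fun Z : Fin d → ℂ => (QuotientAddGroup.mk (P.πC Z) : P.DC) :=
  (QuotientAddGroup.mk_surjective).comp P.πC_surjective

theorem torusAct_zero (x : P.Space) : P.torusAct 0 x = x := by
  obtain ⟨z, rfl⟩ := toSpace_surjective x
  rw [torusAct_toSpace, expC_zero, one_smul]

theorem torusAct_add (Z W : Fin d → ℂ) (x : P.Space) :
    P.torusAct (Z + W) x = P.torusAct Z (P.torusAct W x) := by
  obtain ⟨z, rfl⟩ := toSpace_surjective x
  rw [torusAct_toSpace, torusAct_toSpace, torusAct_toSpace, expC_add, mul_smul]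

variable (P) in
/-- The action of the complex quasitorus on `X_Δ`. -/
noncomputable abbrev quasitorusAction : AddAction P.DC P.Space where
  -- Any preimage of `g` serves, by `torusAct_eq`.
  vadd g x := P.torusAct (Function.surjInv mk_πC_surjective g) x
  zero_vadd x := by
    refine (torusAct_eq ?_ x).trans (torusAct_zero x)
    rw [map_zero]
    exact Function.surjInv_eq mk_πC_surjective 0
  add_vadd g h x := by
    refine (torusAct_eq ?_ x).trans (torusAct_add _ _ x)
    rw [map_add, QuotientAddGroup.mk_add]
    exact (Function.surjInv_eq mk_πC_surjective (g + h)).trans (congrArg₂ (· + ·)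
      (Function.surjInv_eq mk_πC_surjective g).symm (Function.surjInv_eq mk_πC_surjective h).symm)

attribute [local instance] quasitorusAction

theorem mk_vadd_toSpace (Z : Fin d → ℂ) (z : P.CΔ) :
    (QuotientAddGroup.mk (P.πC Z) : P.DC) +ᵥ P.toSpace z = P.toSpace (expC Z • z) :=
  torusAct_eq (Function.surjInv_eq mk_πC_surjective _) _

theorem isOpenQuotientMap_mk_sum {ι : Type*} [Fintype ι] {v : ι → Complexification 𝔡}
    (hv : Function.Surjective fun Z : ι → ℂ => ∑ i, Z i • v i) :
    IsOpenQuotientMap fun Z : ι → ℂ => (QuotientAddGroup.mk (∑ i, Z i • v i) : P.DC) := by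
  have hv' : Function.Surjective (Fintype.linearCombination ℂ v) := hv
  exact QuotientAddGroup.isOpenQuotientMap_mk.comp
    (IsModuleTopology.isOpenQuotientMap_of_surjective hv')

theorem isOpenQuotientMap_mk_πC :
    IsOpenQuotientMap fun Z : Fin d → ℂ => (QuotientAddGroup.mk (P.πC Z) : P.DC) := by
  simp only [πC_apply]
  refine isOpenQuotientMap_mk_sum ?_
  convert P.πC_surjective using 1
  funext Z
  exact (P.πC_apply Z).symm

theorem continuous_expC_smul : Continuous fun p : (Fin d → ℂ) × P.CΔ => expC p.1 • p.2 := by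
  refine Continuous.subtype_mk (continuous_pi fun j => ?_) _
  refine Continuous.mul ?_ ((continuous_apply j).comp (continuous_subtype_val.comp continuous_snd))
  exact Complex.continuous_exp.comp
    (continuous_const.mul ((continuous_apply j).comp continuous_fst))

/-- Quotient maps need not survive products. The map onto `D_ℂ` does because it is open, and
`toSpace` does because the other factor `ℂ^d` is locally compact. -/
theorem continuous_vadd_space : Continuous fun p : P.DC × P.Space => p.1 +ᵥ p.2 := by
  have h1 : IsOpenQuotientMap (Prod.map
      (fun Z : Fin d → ℂ => (QuotientAddGroup.mk (P.πC Z) : P.DC)) (id : P.Space → P.Space)) :=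
    isOpenQuotientMap_mk_πC.prodMap IsOpenQuotientMap.id
  rw [h1.isQuotientMap.continuous_iff]
  refine isQuotientMap_toSpace.continuous_lift_prod_right ?_
  refine (continuous_toSpace.comp continuous_expC_smul).congr fun p => ?_
  exact (mk_vadd_toSpace p.1 p.2).symm

theorem exists_expC_eq {t : Fin d → ℂ} (ht : ∀ j, t j ≠ 0) :
    ∃ Z : Fin d → ℂ, ∀ j, (expC Z j : ℂ) = t j := by
  refine ⟨fun j => (2 * Real.pi * Complex.I)⁻¹ * Complex.log (t j), fun j => ?_⟩
  change Complex.exp (2 * Real.pi * Complex.I * ((2 * Real.pi * Complex.I)⁻¹ * _)) = _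
  rw [mul_inv_cancel_left₀ Complex.two_pi_I_ne_zero, Complex.exp_log (ht j)]

theorem exists_orbit_eq_faceOrbit {F : Finset (Fin d)} (hF : P.IsFace F) :
    ∃ x, AddAction.orbit P.DC x = P.faceOrbit F := by
  let z₀ : P.CΔ := ⟨fun j => if j ∈ F then 0 else 1, F, hF, fun j hj => by
    by_contra h
    simp [h] at hj⟩
  have hz₀ : z₀ ∈ P.coordStratum F := fun j => by simp [z₀]
  refine ⟨P.toSpace z₀, Set.Subset.antisymm ?_ ?_⟩
  · rintro _ ⟨g, rfl⟩
    obtain ⟨Z, rfl⟩ := mk_πC_surjective g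
    refine ⟨expC Z • z₀, fun j => ?_, (mk_vadd_toSpace Z z₀).symm⟩
    rw [smul_apply, ← hz₀ j]
    simp
  · rintro _ ⟨z, hz, rfl⟩
    obtain ⟨Z, hZ⟩ := exists_expC_eq (t := fun j => if j ∈ F then 1 else (z : Fin d → ℂ) j)
      fun j => by
        split_ifs with h
        · exact one_ne_zero
        · exact fun h0 => h ((hz j).1 h0)
    refine ⟨QuotientAddGroup.mk (P.πC Z), ?_⟩
    change QuotientAddGroup.mk (P.πC Z) +ᵥ P.toSpace z₀ = _
    rw [mk_vadd_toSpace]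
    congr 1
    refine Subtype.ext (funext fun j => ?_)
    rw [smul_apply, hZ]
    by_cases h : j ∈ F
    · simp [z₀, h, (hz j).2 h]
    · simp [z₀, h]

theorem face_vadd_invariant {F : Finset (Fin d)} (hF : P.IsFace F) (g : P.DC) {x : P.Space}
    (hx : x ∈ P.faceOrbit F) : g +ᵥ x ∈ P.faceOrbit F := by
  obtain ⟨y, hy⟩ := exists_orbit_eq_faceOrbit hF
  rw [← hy] at hx ⊢
  exact AddAction.mem_orbit_of_mem_orbit g hx

theorem preimage_faceOrbit_empty [FiniteDimensional ℝ 𝔡] :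
    P.toSpace ⁻¹' P.faceOrbit ∅ = {z | zeros z ⊆ ∅} := by
  ext z
  rw [Set.mem_preimage, toSpace_mem_faceOrbit_iff P.isFace_empty, ← Finset.subset_empty]
  exact ⟨fun h => (zeros_subset_face z).trans h, fun h => face_subset P.isFace_empty h⟩

theorem isOpen_faceOrbit_empty [FiniteDimensional ℝ 𝔡] : IsOpen (P.faceOrbit ∅) := by
  rw [← isQuotientMap_toSpace.isOpen_preimage, preimage_faceOrbit_empty]
  exact isOpen_zeros_subset ∅

theorem isOpen_CΔ : IsOpen P.CΔ := by
  have : P.CΔ = ⋃ F ∈ {F | P.IsFace F}, ⋂ j, {z | j ∉ F → z j ≠ 0} := by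
    ext z
    simp only [CΔ, Set.mem_ofPred_eq, Set.mem_iUnion, Set.mem_iInter, exists_prop]
    exact exists_congr fun F => and_congr_right fun _ => forall_congr' fun j => not_imp_not.symm
  rw [this]
  refine isOpen_biUnion fun F _ => isOpen_iInter_of_finite fun j => ?_
  by_cases hj : j ∈ F
  · simp [hj]
  · simp only [hj, not_false_eq_true, true_imp_iff]
    exact isOpen_ne_fun (continuous_apply j) continuous_const

theorem dense_forall_ne_zero {ι : Type*} : Dense {z : ι → ℂ | ∀ i, z i ≠ 0} := by
  have := dense_pi (Set.univ : Set ι) (s := fun _ : ι => ({0}ᶜ : Set ℂ))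
    fun _ _ => dense_compl_singleton 0
  convert this using 1
  ext z
  simp

theorem dense_faceOrbit_empty [FiniteDimensional ℝ 𝔡] : Dense (P.faceOrbit ∅) := by
  have h : Dense (P.toSpace ⁻¹' P.faceOrbit ∅) := by
    rw [preimage_faceOrbit_empty]
    convert dense_forall_ne_zero.preimage isOpen_CΔ.isOpenMap_subtype_val using 1
    ext z
    simp only [Set.mem_ofPred_eq, Set.mem_preimage, Finset.subset_empty,
      Finset.eq_empty_iff_forall_notMem, mem_zeros, ne_eq]
  rw [← Set.image_preimage_eq (P.faceOrbit ∅) toSpace_surjective]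
  exact toSpace_surjective.denseRange.dense_image continuous_toSpace h

end ToricDatum

/-! ### General facts on charts -/

namespace ComplexChart

/-- Restricting `f` to `c.dom` settles the inclusion of the source, and that of the target then
follows from the last clause of `H`. -/
theorem compatible_of_exists {X : Type u} {c c' : ComplexChart.{u, v} X} (hc : IsOpen c.dom)
    (H : ∀ (x : c.dom) (y : c'.dom), c.proj x = c'.proj y →
      ∃ f : OpenPartialHomeomorph c.E c'.E, (x : c.E) ∈ f.source ∧ f x = y ∧
        DifferentiableOn ℂ f f.source ∧ DifferentiableOn ℂ f.symm f.target ∧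
        ∀ u : c.dom, (u : c.E) ∈ f.source →
          ∃ hu : f u ∈ c'.dom, c'.proj ⟨f u, hu⟩ = c.proj u) :
    c.Compatible c' := by
  intro x y hxy
  obtain ⟨f, hx, hfx, hd, hd', hf⟩ := H x y hxy
  have hs : (f.restrOpen c.dom hc).source = f.source ∩ c.dom := f.restrOpen_source _ _
  have ht : (f.restrOpen c.dom hc).target ⊆ f.target := Set.inter_subset_left
  refine ⟨f.restrOpen c.dom hc, ?_, hfx, ?_, ?_, ?_, ?_, ?_⟩
  · rw [hs]; exact ⟨hx, x.2⟩
  · rw [hs]; exact Set.inter_subset_right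
  · intro y hy
    have h1 := (f.restrOpen c.dom hc).map_target hy
    have h2 := (f.restrOpen c.dom hc).right_inv hy
    rw [hs] at h1
    obtain ⟨h3, -⟩ := hf ⟨_, h1.2⟩ h1.1
    rw [← h2]
    exact h3
  · exact hd.mono (by rw [hs]; exact Set.inter_subset_left)
  · exact hd'.mono ht
  · intro u hu
    rw [hs] at hu
    exact hf u hu.1

end ComplexChart

/-! ### The dimension of unions of coordinate hyperplanes -/

theorem dimH_eval_eq_zero_add_two {ι : Type*} [Fintype ι] (i : ι) :
    dimH {x : ι → ℂ | x i = 0} + 2 = ((2 * Fintype.card ι : ℕ) : ENNReal) := by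
  let K : Submodule ℂ (ι → ℂ) := LinearMap.ker (LinearMap.proj i : (ι → ℂ) →ₗ[ℂ] ℂ)
  have hK : {x : ι → ℂ | x i = 0} = Subtype.val '' (Set.univ : Set K) := by
    rw [Set.image_univ, Subtype.range_coe]
    rfl
  have hsurj : Function.Surjective (LinearMap.proj i : (ι → ℂ) →ₗ[ℂ] ℂ) :=
    LinearMap.proj_surjective i
  have hr := LinearMap.finrank_range_add_finrank_ker (LinearMap.proj i : (ι → ℂ) →ₗ[ℂ] ℂ)
  rw [LinearMap.range_eq_top.2 hsurj, finrank_top, Module.finrank_self,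
    Module.finrank_fintype_fun_eq_card] at hr
  rw [hK, isometry_subtype_coe.dimH_image, Real.dimH_univ_eq_finrank, finrank_real_of_complex,
    ← hr]
  push_cast
  ring

theorem dimH_add_two_le {ι : Type*} [Fintype ι] {s : Set (ι → ℂ)}
    (h : ∀ x ∈ s, ∃ i, x i = 0) :
    s = ∅ ∨ dimH s + 2 ≤ ((2 * Fintype.card ι : ℕ) : ENNReal) := by
  rcases s.eq_empty_or_nonempty with hs | ⟨x, hx⟩
  · exact Or.inl hs
  · right
    obtain ⟨i₀, -⟩ := h x hx
    have hsub : s ⊆ ⋃ i, {x : ι → ℂ | x i = 0} := fun x hx => Set.mem_iUnion.2 (h x hx)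
    refine (add_le_add_left (dimH_mono hsub) 2).trans ?_
    rw [dimH_iUnion, ← dimH_eval_eq_zero_add_two i₀]
    refine add_le_add_left (iSup_le fun i => ?_) 2
    have := (dimH_eval_eq_zero_add_two i).trans (dimH_eval_eq_zero_add_two i₀).symm
    exact ((ENNReal.add_left_inj (by simp)).1 this).le

namespace ToricDatum

variable {𝔡 : Type u} [AddCommGroup 𝔡] [Module ℝ 𝔡] {d : ℕ} {P : ToricDatum 𝔡 d}

/-! ### The complex quasitorus -/

/-- The identification of `ℂ^n` with `𝔡_ℂ` given by a basis of `𝔡`. -/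
noncomputable def complexCoord {ι : Type*} [Fintype ι] (b : Module.Basis ι ℝ 𝔡) :
    (ι → ℂ) ≃ₗ[ℂ] Complexification 𝔡 :=
  LinearEquiv.ofBijective (Fintype.linearCombination ℂ fun k => Complexification.incl (b k)) (by
    constructor
    · rw [← LinearMap.ker_eq_bot, LinearMap.ker_eq_bot']
      intro Z hZ
      rw [Fintype.linearCombination_apply] at hZ
      have key : ∀ φ : ℂ →ₗ[ℝ] ℝ, ∀ k, φ (Z k) = 0 := fun φ => by
        have := congrArg (Complexification.part φ) hZ
        simp only [map_sum, Complexification.part_smul_incl, map_zero] at this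
        exact Fintype.linearIndependent_iff.1 b.linearIndependent _ this
      exact funext fun k => Complex.ext (key Complex.reLm k) (key Complex.imLm k)
    · intro v
      induction v using Complexification.induction_on with
      | zero => exact ⟨0, map_zero _⟩
      | smul c x =>
        refine ⟨fun k => c * b.repr x k, ?_⟩
        rw [Fintype.linearCombination_apply]
        conv_rhs => rw [← b.sum_repr x, Complexification.smul_incl_sum]
      | add v w hv hw =>
        obtain ⟨Z, rfl⟩ := hv
        obtain ⟨W, rfl⟩ := hw
        exact ⟨Z + W, map_add _ _ _⟩)

theorem complexCoord_apply {ι : Type*} [Fintype ι] (b : Module.Basis ι ℝ 𝔡) (Z : ι → ℂ) :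
    complexCoord b Z = ∑ k, Z k • Complexification.incl (b k) := rfl

theorem isOpenQuotientMap_mk_complexCoord {ι : Type*} [Fintype ι] (b : Module.Basis ι ℝ 𝔡) :
    IsOpenQuotientMap fun Z : ι → ℂ => (QuotientAddGroup.mk (complexCoord b Z) : P.DC) :=
  isOpenQuotientMap_mk_sum (complexCoord b).surjective

/-- The `b k` are independent over ℝ, so a difference lying in `Q` has real coordinates. -/
theorem mk_complexCoord_eq_iff {ι : Type*} [Fintype ι] (b : Module.Basis ι ℝ 𝔡) (x y : ι → ℂ) :
    (QuotientAddGroup.mk (complexCoord b x) : P.DC) = QuotientAddGroup.mk (complexCoord b y) ↔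
      ∃ q ∈ P.Q, ∀ k, x k + b.repr q k = y k := by
  rw [QuotientAddGroup.eq, neg_add_eq_sub, ← map_sub, complexCoord_apply,
    sum_smul_incl_mem_QC_iff, TorusSlice.mem_logGroup]
  constructor
  · rintro ⟨h1, h2⟩
    refine ⟨_, h1, fun k => ?_⟩
    have him : ((y - x) k).im = 0 := Fintype.linearIndependent_iff.1 b.linearIndependent _ h2 k
    rw [b.repr_sum_self]
    have : (((y - x) k).re : ℂ) = (y - x) k := Complex.ext (by simp) (by simpa using him.symm)
    rw [this, Pi.sub_apply, add_sub_cancel]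
  · rintro ⟨q, hq, h⟩
    have hyx : ∀ k, (y - x) k = (b.repr q k : ℂ) := fun k => by
      rw [Pi.sub_apply, ← h k, add_sub_cancel_left]
    simp only [hyx, Complex.ofReal_re, Complex.ofReal_im, zero_smul, Finset.sum_const_zero,
      b.sum_repr, and_true]
    exact hq

theorem quasitorusChart_nonFree (b : Module.Basis (Fin (Module.finrank ℝ 𝔡)) ℝ 𝔡) :
    (P.quasitorusChart b).nonFree = ∅ := by
  rw [Set.eq_empty_iff_forall_notMem]
  rintro x ⟨-, γ, hγ, h⟩
  apply hγ
  have h0 : b.repr (Multiplicative.toAdd γ : P.Q) = 0 := by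
    ext k
    have := congrFun h k
    change x k + (b.repr (Multiplicative.toAdd γ : P.Q) k : ℂ) = x k at this
    rw [add_eq_left, Complex.ofReal_eq_zero] at this
    rw [this]; rfl
  rw [map_eq_zero_iff _ b.repr.injective] at h0
  exact Multiplicative.toAdd.injective (Subtype.ext h0)

theorem quasitorusChart_isChart (b : Module.Basis (Fin (Module.finrank ℝ 𝔡)) ℝ 𝔡) :
    (P.quasitorusChart b).IsChart where
  isOpen_dom := isOpen_univ
  isConnected_dom := isConnected_univ (α := Fin (Module.finrank ℝ 𝔡) → ℂ)
  mapsTo _ _ _ := trivial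
  one_act x _ := by
    funext k
    change x k + (b.repr ((0 : P.Q) : 𝔡) k : ℂ) = x k
    simp
  mul_act γ γ' x _ := by
    have h : ∀ (a c : P.Q) (x : Fin (Module.finrank ℝ 𝔡) → ℂ) k,
        x k + (b.repr ((a + c : P.Q) : 𝔡) k : ℂ) = x k + (b.repr c k : ℂ) + (b.repr a k : ℂ) := by
      intro a c x k
      rw [AddSubgroup.coe_add, map_add, Finsupp.add_apply, Complex.ofReal_add]
      ring
    exact funext (h (Multiplicative.toAdd γ) (Multiplicative.toAdd γ') x)
  holomorphic γ := by
    change DifferentiableOn ℂ (fun y : Fin (Module.finrank ℝ 𝔡) → ℂ =>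
      fun k => y k + (b.repr (Multiplicative.toAdd γ : P.Q) k : ℂ)) Set.univ
    fun_prop
  closed_nonFree := by
    rw [quasitorusChart_nonFree]
    exact isClosed_empty
  codim_nonFree := Or.inl (quasitorusChart_nonFree b)
  continuous_proj := (isOpenQuotientMap_mk_complexCoord b).continuous.comp continuous_subtype_val
  isOpenMap_proj := (isOpenQuotientMap_mk_complexCoord b).isOpenMap.comp
    isOpen_univ.isOpenMap_subtype_val
  proj_eq_iff x y := by
    refine (mk_complexCoord_eq_iff b x.1 y.1).trans ⟨?_, ?_⟩
    · rintro ⟨q, hq, h⟩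
      exact ⟨Multiplicative.ofAdd ⟨q, hq⟩, funext h⟩
    · rintro ⟨γ, h⟩
      exact ⟨_, (Multiplicative.toAdd γ : P.Q).2, congrFun h⟩

theorem quasitorusChart_compatible (b b' : Module.Basis (Fin (Module.finrank ℝ 𝔡)) ℝ 𝔡) :
    (P.quasitorusChart b).Compatible (P.quasitorusChart b') := by
  refine ComplexChart.compatible_of_exists isOpen_univ fun x y hxy => ?_
  have hxy' : (QuotientAddGroup.mk (complexCoord b x.1) : P.DC) =
    QuotientAddGroup.mk (complexCoord b' y.1) := hxy
  let T : (Fin (Module.finrank ℝ 𝔡) → ℂ) ≃L[ℂ] (Fin (Module.finrank ℝ 𝔡) → ℂ) :=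
    ((complexCoord b).trans (complexCoord b').symm).toContinuousLinearEquiv
  have hT : ∀ u, complexCoord b' (T u) = complexCoord b u := fun u =>
    (complexCoord b').apply_symm_apply _
  let x₁ : Fin (Module.finrank ℝ 𝔡) → ℂ := x.1
  let y₁ : Fin (Module.finrank ℝ 𝔡) → ℂ := y.1
  -- The linear change of basis is corrected by a translation, which lies over `Q` because `x` and
  -- `y` have the same image.
  let h : (Fin (Module.finrank ℝ 𝔡) → ℂ) ≃ₜ (Fin (Module.finrank ℝ 𝔡) → ℂ) :=
    T.toHomeomorph.trans (Homeomorph.addRight (y₁ - T x₁))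
  refine ⟨h.toOpenPartialHomeomorph, trivial, ?_, ?_, ?_, fun u _ => ⟨trivial, ?_⟩⟩
  · change T x₁ + (y₁ - T x₁) = y₁
    rw [add_sub_cancel]
  · exact (T.differentiable.add_const _).differentiableOn
  · exact (T.symm.differentiable.comp (differentiable_id.add_const (-(y₁ - T x₁)))).differentiableOn
  · have key : ∀ u, (QuotientAddGroup.mk (complexCoord b' (T u + (y₁ - T x₁))) : P.DC) =
        QuotientAddGroup.mk (complexCoord b u) := fun u => by
      rw [map_add, map_sub, hT, hT, QuotientAddGroup.mk_add, QuotientAddGroup.mk_sub, sub_eq_zero.2,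
        add_zero]
      exact hxy'.symm
    exact key u.1

theorem quasitorus_isComplexQuasifold [FiniteDimensional ℝ 𝔡] :
    IsComplexQuasifold (Module.finrank ℝ 𝔡) P.quasitorusChart where
  isChart := quasitorusChart_isChart
  finrank_eq _ := Module.finrank_fin_fun ℂ
  cover x := by
    obtain ⟨y, hy⟩ := (isOpenQuotientMap_mk_complexCoord (P := P)
      (Module.finBasis ℝ 𝔡)).surjective x
    exact ⟨Module.finBasis ℝ 𝔡, ⟨y, trivial⟩, hy⟩
  compatible := quasitorusChart_compatible

end ToricDatum

namespace ToricDatum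

variable {𝔡 : Type u} [AddCommGroup 𝔡] [Module ℝ 𝔡] {d : ℕ} {P : ToricDatum 𝔡 d}

open TorusSlice

/-! ### Translations by `N_ℂ` and the groups of the charts -/

theorem expC_apply (Z : Fin d → ℂ) (j : Fin d) : (expC Z j : ℂ) = cexp Z j := rfl

theorem exists_NC_smul_eq_iff {z w : P.CΔ} : (∃ g ∈ P.NC, g • z = w) ↔
    ∃ Z ∈ logGroup P.X P.Q, (w : Fin d → ℂ) = cexp Z * (z : Fin d → ℂ) := by
  constructor
  · rintro ⟨g, hg, rfl⟩
    obtain ⟨Z, hZ, rfl⟩ := P.mem_NC_iff.1 hg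
    exact ⟨Z, hZ, rfl⟩
  · rintro ⟨Z, hZ, h⟩
    exact ⟨_, P.mem_NC_iff.2 ⟨Z, hZ, rfl⟩, Subtype.ext h.symm⟩

theorem cexp_eq_one_iff {κ : Type*} {Z : κ → ℂ} {j : κ} : cexp Z j = 1 ↔ ∃ n : ℤ, Z j = n := by
  rw [cexp, Complex.exp_eq_one_iff]
  refine exists_congr fun n => ?_
  rw [mul_comm, mul_left_inj' Complex.two_pi_I_ne_zero]

/-- The ambiguity of logarithms is harmless, since integral combinations of the normals are in `Q`.
-/
theorem mem_logGroup_of_int {Z : Fin d → ℂ} (h : ∀ j, ∃ n : ℤ, Z j = n) :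
    Z ∈ logGroup P.X P.Q := by
  choose n hn using h
  refine ⟨?_, by simp [hn]⟩
  simp only [hn, Complex.intCast_re, Int.cast_smul_eq_zsmul]
  exact P.Q.sum_mem fun j _ => P.Q.zsmul_mem (P.mem_Q j) _

/-- An element of `logGroup` that is supported on a basis set is real. -/
theorem im_eq_zero_of_mem_logGroup {I : Finset (Fin d)} (hI : P.IsBasisSet I) {Z : Fin d → ℂ}
    (hZ : Z ∈ logGroup P.X P.Q) (h0 : ∀ j, j ∉ I → Z j = 0) (j : Fin d) : (Z j).im = 0 := by
  by_cases hj : j ∈ I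
  · have h := hZ.2
    rw [← Finset.sum_subset (Finset.subset_univ I) fun j _ hj => by simp [h0 j hj],
      ← Finset.sum_coe_sort I] at h
    exact Fintype.linearIndependent_iff.1 hI.1 (fun i : I => (Z i).im) h ⟨j, hj⟩
  · simp [h0 j hj]

/-- An element of `N_ℂ` that is trivial outside `I ∪ F` agrees on `I \ F` with an element
of `Γ_I`. -/
theorem exists_mem_ΓI {I F : Finset (Fin d)} (hI : P.IsBasisSet I)
    (hF : P.normalSpan (I ∩ F) = P.normalSpan F) {Z : Fin d → ℂ} (hZ : Z ∈ logGroup P.X P.Q)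
    (h1 : ∀ j, j ∉ I → j ∉ F → cexp Z j = 1) :
    ∃ γ ∈ P.ΓI I, ∀ j ∈ I, j ∉ F → (γ j : ℂ) = cexp Z j := by
  classical
  -- Outside `I ∪ F` the coordinates of `Z` are integers and can be subtracted.
  let D : Fin d → ℂ := fun j => if j ∈ I ∨ j ∈ F then 0 else Z j
  have hD : D ∈ logGroup P.X P.Q := mem_logGroup_of_int fun j => by
    simp only [D]
    split_ifs with h
    · exact ⟨0, by simp⟩
    · push Not at h
      exact cexp_eq_one_iff.1 (h1 j h.1 h.2)
  have hZD := sub_mem hZ hD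
  -- The coordinates in `F \ I` are traded for coordinates in `I ∩ F`, as the normals in `F` and in
  -- `I ∩ F` have the same span; those in `I \ F` are untouched.
  have key : ∀ φ : ℂ →ₗ[ℝ] ℝ, ∃ a : Fin d → ℝ, (∀ j, j ∉ I ∩ F → a j = 0) ∧
      ∑ j, a j • P.X j = ∑ j, φ (if j ∈ F ∧ j ∉ I then Z j else 0) • P.X j := fun φ => by
    refine P.mem_normalSpan_iff.1 ?_
    rw [hF]
    refine Submodule.sum_mem _ fun j _ => ?_
    by_cases hj : j ∈ F
    · exact Submodule.smul_mem _ _ (P.X_mem_normalSpan hj)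
    · simp [hj]
  obtain ⟨a, ha, hasum⟩ := key Complex.reLm
  obtain ⟨c, hc, hcsum⟩ := key Complex.imLm
  let G : Fin d → ℂ := fun j => if j ∈ F ∧ j ∉ I then Z j else 0
  have hE : (fun j => (a j + c j * Complex.I : ℂ)) - G ∈ logGroup P.X P.Q := by
    constructor
    · simp only [Pi.sub_apply, Complex.sub_re, sub_smul, Finset.sum_sub_distrib, Complex.add_re,
        Complex.mul_re, Complex.I_re, Complex.I_im, Complex.ofReal_re, Complex.ofReal_im, mul_zero,
        zero_mul, sub_zero, add_zero]
      rw [hasum]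
      simp [G, P.Q.zero_mem]
    · simp only [Pi.sub_apply, Complex.sub_im, sub_smul, Finset.sum_sub_distrib, Complex.add_im,
        Complex.mul_im, Complex.I_re, Complex.I_im, Complex.ofReal_re, Complex.ofReal_im, mul_zero,
        mul_one, zero_add, add_zero]
      rw [hcsum]
      simp [G]
  have hZ₂ := add_mem hZD hE
  set Z₂ := Z - D + ((fun j => (a j + c j * Complex.I : ℂ)) - G) with hZ₂def
  have hval : ∀ j, Z₂ j = (if j ∈ I then Z j else 0) + (a j + c j * Complex.I) := fun j => by
    simp only [hZ₂def, Pi.add_apply, Pi.sub_apply, D, G]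
    by_cases h1 : j ∈ I <;> by_cases h2 : j ∈ F <;> simp [h1, h2]
  have hoff : ∀ j, j ∉ I → Z₂ j = 0 := fun j hj => by
    have : j ∉ I ∩ F := fun h => hj (Finset.mem_inter.1 h).1
    simp [hval, hj, ha j this, hc j this]
  -- Being supported on `I`, the result is real, so its exponential is in `N` and not merely in
  -- `N_ℂ`.
  have hreal : ∀ j, ((Z₂ j).re : ℂ) = Z₂ j := fun j =>
    Complex.ext (by simp) (by simpa using (im_eq_zero_of_mem_logGroup hI hZ₂ hoff j).symm)
  refine ⟨expC Z₂, ⟨P.mem_N_iff.2 ⟨fun j => (Z₂ j).re, hZ₂.1, ?_⟩, fun j hj => ?_⟩,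
    fun j hj hjF => ?_⟩
  · simp only [hreal]
  · refine Units.ext ?_
    rw [expC_apply, cexp, hoff j hj]
    simp
  · have : j ∉ I ∩ F := fun h => hjF (Finset.mem_inter.1 h).2
    rw [expC_apply, cexp, cexp, hval j]
    simp [hj, ha j this, hc j this]

theorem exists_logGroup_of_mem_ΓI {I : Finset (Fin d)} {γ : Fin d → ℂˣ} (h : γ ∈ P.ΓI I) :
    ∃ Z ∈ logGroup P.X P.Q, γ = expC Z := P.mem_NC_iff.1 (P.N_le_NC h.1)

/-! ### The maximal piece -/

theorem pI_eq_fill (I : Finset (Fin d)) (z : I → ℂ) : pI I z = fill Subtype.val z := by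
  funext j
  by_cases hj : j ∈ I
  · rw [pI, dif_pos hj]
    exact (fill_apply Subtype.val_injective z ⟨j, hj⟩).symm
  · rw [pI, dif_neg hj, fill_of_notMem]
    simpa using hj

theorem pI_coe {I : Finset (Fin d)} (z : I → ℂ) (j : I) : pI I z j = z j := by
  rw [pI, dif_pos j.2]

theorem pI_of_notMem {I : Finset (Fin d)} (z : I → ℂ) {j : Fin d} (hj : j ∉ I) : pI I z j = 1 := by
  rw [pI, dif_neg hj]

/-- Subsets of regular faces are regular, so the exact condition on the zero set becomes an open
one. -/
theorem mem_maxDom_iff [FiniteDimensional ℝ 𝔡] {I : Finset (Fin d)} {z : I → ℂ} :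
    (∃ F, P.IsRegular F ∧ ∀ j, pI I z j = 0 ↔ j ∈ F) ↔
      ∃ F, P.IsRegular F ∧ ∀ j : I, z j = 0 → (j : Fin d) ∈ F := by
  constructor
  · rintro ⟨F, hF, h⟩
    exact ⟨F, hF, fun j hj => (h j).1 (by rw [pI_coe, hj])⟩
  · rintro ⟨F, hF, h⟩
    refine ⟨Finset.univ.filter fun j => pI I z j = 0, hF.subset fun j hj => ?_, by simp⟩
    rw [Finset.mem_filter] at hj
    by_cases hjI : j ∈ I
    · exact h ⟨j, hjI⟩ ((pI_coe z ⟨j, hjI⟩).symm.trans hj.2)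
    · rw [pI_of_notMem z hjI] at hj
      exact absurd hj.2 one_ne_zero

theorem isOpen_maxDom [FiniteDimensional ℝ 𝔡] (I : Finset (Fin d)) :
    IsOpen {z : I → ℂ | ∃ F, P.IsRegular F ∧ ∀ j, pI I z j = 0 ↔ j ∈ F} := by
  simp only [mem_maxDom_iff]
  have : {z : I → ℂ | ∃ F, P.IsRegular F ∧ ∀ j : I, z j = 0 → (j : Fin d) ∈ F} =
      ⋃ F ∈ {F | P.IsRegular F}, ⋂ j : I, {z | (j : Fin d) ∉ F → z j ≠ 0} := by
    ext z
    simp only [Set.mem_ofPred_eq, Set.mem_iUnion, Set.mem_iInter, exists_prop]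
    exact exists_congr fun F => and_congr_right fun _ => forall_congr' fun j => not_imp_not.symm
  rw [this]
  refine isOpen_biUnion fun F _ => isOpen_iInter_of_finite fun j => ?_
  by_cases hj : (j : Fin d) ∈ F
  · simp [hj]
  · simp only [hj, not_false_eq_true, true_imp_iff]
    exact isOpen_ne_fun (continuous_apply j) continuous_const

theorem isConnected_forall_ne_zero (ι : Type*) : IsConnected {z : ι → ℂ | ∀ i, z i ≠ 0} := by
  have h : IsConnected (Set.univ.pi fun _ : ι => ({0}ᶜ : Set ℂ)) :=
    isConnected_univ_pi.2 fun _ => isConnected_compl_singleton_of_one_lt_rank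
      (by rw [Complex.rank_real_complex]; exact Cardinal.one_lt_two) 0
  convert h using 1
  ext z
  simp

/-- The domain lies between the connected torus `(ℂ^*)^I` and its closure. -/
theorem isConnected_maxDom [FiniteDimensional ℝ 𝔡] (I : Finset (Fin d)) :
    IsConnected {z : I → ℂ | ∃ F, P.IsRegular F ∧ ∀ j, pI I z j = 0 ↔ j ∈ F} :=
  (isConnected_forall_ne_zero I).subset_closure
    (fun _ hz => mem_maxDom_iff.2 ⟨∅, P.isRegular_empty, fun j hj => absurd hj (hz j)⟩)
    (by rw [dense_forall_ne_zero.closure_eq]; exact Set.subset_univ _)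

section MaxChart

variable {I : {I : Finset (Fin d) // P.IsBasisSet I}}

theorem isBasis_val (I : {I : Finset (Fin d) // P.IsBasisSet I}) (i : I.1) :
    P.X i = I.2.basis i := (I.2.basis_apply i).symm

/-- The coordinates of a point of the chart. -/
def maxCoord (z : (P.maxChart I).dom) : I.1 → ℂ := z.1

/-- The point of `ℂ^d_Δ` with the coordinates `z`. -/
def maxPoint (z : (P.maxChart I).dom) : P.CΔ := ⟨pI I.1 z.1, by
  obtain ⟨F, hF, h⟩ := z.2
  exact ⟨F, hF.1, fun j hj => (h j).1 hj⟩⟩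

theorem maxPoint_coe (z : (P.maxChart I).dom) :
    (maxPoint z : Fin d → ℂ) = fill Subtype.val (maxCoord z) := pI_eq_fill _ _

theorem maxPoint_mem (z : (P.maxChart I).dom) :
    ∃ F, P.IsRegular F ∧ maxPoint z ∈ P.coordStratum F := z.2

theorem maxChart_proj_coe (z : (P.maxChart I).dom) :
    ((P.maxChart I).proj z : P.Space) = P.toSpace (maxPoint z) := rfl

theorem maxChart_proj_eq_iff {J : {I : Finset (Fin d) // P.IsBasisSet I}}
    (x : (P.maxChart I).dom) (y : (P.maxChart J).dom) :
    (P.maxChart I).proj x = (P.maxChart J).proj y ↔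
      ∃ Z ∈ logGroup P.X P.Q, fill Subtype.val (maxCoord y) = cexp Z * fill Subtype.val (maxCoord x) := by
  obtain ⟨F, hF, hx⟩ := maxPoint_mem x
  obtain ⟨G, hG, hy⟩ := maxPoint_mem y
  rw [← Subtype.val_inj, maxChart_proj_coe, maxChart_proj_coe,
    toSpace_eq_iff_of_mem_coordStratum hF.1 hG.1 hx hy, exists_NC_smul_eq_iff,
    maxPoint_coe, maxPoint_coe]

theorem mem_maxDom_of_eq {J : {I : Finset (Fin d) // P.IsBasisSet I}} (x : (P.maxChart I).dom)
    {y : J.1 → ℂ} {Z : Fin d → ℂ} (h : fill Subtype.val y = cexp Z * fill Subtype.val (maxCoord x)) :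
    y ∈ (P.maxChart J).dom := by
  obtain ⟨F, hF, hx⟩ := maxPoint_mem x
  refine ⟨F, hF, fun j => ?_⟩
  rw [← hx j, pI_eq_fill, maxPoint_coe, h, Pi.mul_apply, mul_eq_zero, or_iff_right (cexp_ne_zero _ _)]

theorem maxChart_nonFree_zero {x : I.1 → ℂ} (hx : x ∈ (P.maxChart I).nonFree) :
    ∃ i, x i = 0 := by
  obtain ⟨-, γ, hγ, h⟩ := hx
  by_contra! hne
  refine hγ (Subtype.ext (funext fun j => ?_))
  by_cases hj : j ∈ I.1
  · have := congrFun h ⟨j, hj⟩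
    exact Units.ext (mul_eq_right₀ (hne ⟨j, hj⟩) |>.1 this)
  · exact γ.2.2 j hj

theorem continuous_maxCoord : Continuous (maxCoord : (P.maxChart I).dom → I.1 → ℂ) :=
  continuous_subtype_val

/-- `γ` fixes `x` exactly when `x` vanishes wherever `γ` differs from 1, and only finitely many sets
`S` of coordinates occur. -/
theorem maxChart_closed_nonFree :
    IsClosed {x : (P.maxChart I).dom | (x : (P.maxChart I).E) ∈ (P.maxChart I).nonFree} := by
  have : {x : (P.maxChart I).dom | (x : (P.maxChart I).E) ∈ (P.maxChart I).nonFree} =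
      ⋃ (S : Finset I.1) (_ : ∃ γ : P.ΓI I.1, γ ≠ 1 ∧ ∀ i, i ∉ S → (γ : Fin d → ℂˣ) i = 1),
        {x : (P.maxChart I).dom | ∀ i ∈ S, maxCoord x i = 0} := by
    ext x
    simp only [Set.mem_ofPred_eq, Set.mem_iUnion, exists_prop]
    constructor
    · rintro ⟨-, γ, hγ, h⟩
      refine ⟨Finset.univ.filter fun i => maxCoord x i = 0, ⟨γ, hγ, fun i hi => ?_⟩,
        fun i hi => (Finset.mem_filter.1 hi).2⟩
      have hi' : maxCoord x i ≠ 0 := by simpa using hi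
      exact Units.ext (mul_eq_right₀ hi' |>.1 (congrFun h i))
    · rintro ⟨S, ⟨γ, hγ, h⟩, hx⟩
      refine ⟨x.2, γ, hγ, funext fun (i : I.1) => ?_⟩
      change ((γ : Fin d → ℂˣ) i : ℂ) * maxCoord x i = maxCoord x i
      by_cases hi : i ∈ S
      · rw [hx i hi, mul_zero]
      · rw [h i hi, Units.val_one, one_mul]
  rw [this]
  refine isClosed_iUnion_of_finite fun S => isClosed_iUnion_of_finite fun _ => ?_
  have : {x : (P.maxChart I).dom | ∀ i ∈ S, maxCoord x i = 0} =
      ⋂ i ∈ S, {x : (P.maxChart I).dom | maxCoord x i = 0} := by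
    ext x; simp
  rw [this]
  exact isClosed_biInter fun i _ =>
    isClosed_eq ((continuous_apply i).comp continuous_maxCoord)
      continuous_const

theorem continuous_maxPoint : Continuous (maxPoint : (P.maxChart I).dom → P.CΔ) := by
  refine Continuous.subtype_mk ?_ _
  have h : Continuous (pI I.1) := by
    simp only [funext (pI_eq_fill I.1)]
    exact (differentiable_fill Subtype.val_injective).continuous
  exact h.comp continuous_subtype_val

theorem maxChart_isOpenMap_proj [FiniteDimensional ℝ 𝔡] : IsOpenMap (P.maxChart I).proj := by
  intro U hU
  have hU' : IsOpen (Subtype.val '' U : Set (I.1 → ℂ)) :=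
    (isOpen_maxDom I.1).isOpenMap_subtype_val U hU
  let V : Set P.CΔ := {z | ∃ Z ∈ logGroup P.X P.Q, ∃ u ∈ (Subtype.val '' U : Set (I.1 → ℂ)),
    (z : Fin d → ℂ) = cexp Z * fill Subtype.val u}
  have hV : IsOpen V := (isOpen_saturation Subtype.val_injective (isBasis_val I) P.Q hU').preimage
    continuous_subtype_val
  have hVmem : ∀ z : P.CΔ, z ∈ V ↔ ∃ u ∈ U, ∃ g ∈ P.NC, g • maxPoint u = z := by
    intro z
    constructor
    · rintro ⟨Z, hZ, _, ⟨u, hu, rfl⟩, h⟩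
      exact ⟨u, hu, exists_NC_smul_eq_iff.2 ⟨Z, hZ,
        h.trans (congrArg (cexp Z * ·) (maxPoint_coe u).symm)⟩⟩
    · rintro ⟨u, hu, hg⟩
      obtain ⟨Z, hZ, h⟩ := exists_NC_smul_eq_iff.1 hg
      exact ⟨Z, hZ, _, ⟨u, hu, rfl⟩, by rw [h, maxPoint_coe]; rfl⟩
  have himg := isOpen_image_toSpace hV fun z hz w hzw => by
    obtain ⟨u, hu, g, hg, rfl⟩ := (hVmem z).1 hz
    rw [toSpace_smul_of_mem hg] at hzw
    obtain ⟨F, hF, hu'⟩ := maxPoint_mem u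
    have hface : face w = F := by
      rw [← face_eq_of_toSpace_eq hzw, face_eq_of_mem_coordStratum hF.1 hu']
    -- The zero set of `w` is itself the index set of a face, so `retr` does nothing and equivalence
    -- is translation by `N_ℂ`.
    have hw : IsRegular P (zeros w) := hF.subset (hface ▸ zeros_subset_face w)
    obtain ⟨g', hg', h⟩ := (toSpace_eq_iff_of_mem_coordStratum hF.1 hw.1 hu'
      fun j => mem_zeros.symm).1 hzw
    exact (hVmem w).2 ⟨u, hu, g', hg', h⟩
  convert himg.preimage (continuous_subtype_val (p := (· ∈ P.maxPiece))) using 1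
  ext x
  constructor
  · rintro ⟨u, hu, rfl⟩
    exact ⟨maxPoint u, (hVmem _).2 ⟨u, hu, 1, one_mem _, one_smul _ _⟩, rfl⟩
  · rintro ⟨z, hz, hzx⟩
    obtain ⟨u, hu, g, hg, rfl⟩ := (hVmem z).1 hz
    exact ⟨u, hu, Subtype.ext ((toSpace_smul_of_mem hg _).symm.trans hzx)⟩

theorem maxChart_isChart [FiniteDimensional ℝ 𝔡] (I : {I : Finset (Fin d) // P.IsBasisSet I}) :
    (P.maxChart I).IsChart where
  isOpen_dom := isOpen_maxDom I.1
  isConnected_dom := isConnected_maxDom I.1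
  mapsTo γ x hx := by
    obtain ⟨F, hF, h⟩ := mem_maxDom_iff.1 hx
    refine mem_maxDom_iff.2 ⟨F, hF, fun j hj => h j ?_⟩
    exact (mul_eq_zero.1 hj).resolve_left (Units.ne_zero _)
  one_act x _ := funext fun j => one_mul _
  mul_act γ γ' x _ := funext fun j => mul_assoc _ _ _
  holomorphic γ := by
    change DifferentiableOn ℂ (fun z : I.1 → ℂ => fun j : I.1 =>
      ((γ : P.ΓI I.1).1 j : ℂ) * z j) _
    fun_prop
  closed_nonFree := maxChart_closed_nonFree
  codim_nonFree := by
    have := dimH_add_two_le (ι := I.1) (s := (P.maxChart I).nonFree)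
      fun x hx => maxChart_nonFree_zero hx
    rwa [← Module.finrank_fintype_fun_eq_card ℂ] at this
  continuous_proj := (continuous_toSpace.comp continuous_maxPoint).subtype_mk _
  isOpenMap_proj := maxChart_isOpenMap_proj
  proj_eq_iff x y := by
    rw [maxChart_proj_eq_iff]
    constructor
    · rintro ⟨Z, hZ, h⟩
      have hoff : ∀ j, j ∉ I.1 → cexp Z j = 1 := fun j hj => by
        have hj' : j ∉ Set.range (Subtype.val : I.1 → Fin d) := by simpa using hj
        have := congrFun h j
        rw [Pi.mul_apply, fill_of_notMem _ hj', fill_of_notMem _ hj', mul_one] at this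
        exact this.symm
      obtain ⟨γ, hγ, hγZ⟩ := exists_mem_ΓI (F := ∅) I.2 (by simp) hZ fun j hj _ => hoff j hj
      refine ⟨⟨γ, hγ⟩, funext fun (i : I.1) => ?_⟩
      change (γ i : ℂ) * maxCoord x i = maxCoord y i
      have := congrFun h i
      rw [Pi.mul_apply, fill_apply Subtype.val_injective, fill_apply Subtype.val_injective] at this
      rw [hγZ i i.2 (Finset.notMem_empty _)]
      exact this.symm
    · rintro ⟨⟨γ, hγ⟩, h⟩
      obtain ⟨Z, hZ, rfl⟩ := exists_logGroup_of_mem_ΓI hγ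
      refine ⟨Z, hZ, ?_⟩
      rw [show maxCoord y = fun i : I.1 => cexp Z i * maxCoord x i from h.symm, ← pI_eq_fill,
        ← pI_eq_fill]
      funext j
      by_cases hj : j ∈ I.1
      · rw [Pi.mul_apply, pI_coe _ ⟨j, hj⟩, pI_coe _ ⟨j, hj⟩]
      · rw [Pi.mul_apply, pI_of_notMem _ hj, pI_of_notMem _ hj, ← expC_apply, hγ.2 j hj]
        simp

theorem maxChart_cover [FiniteDimensional ℝ 𝔡] (x : P.maxPiece) :
    ∃ I, x ∈ Set.range (P.maxChart I).proj := by
  obtain ⟨x, hx⟩ := x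
  have hx' := hx
  rw [maxPiece_eq_iUnion] at hx'
  simp only [Set.mem_iUnion, Set.mem_ofPred_eq, exists_prop] at hx'
  obtain ⟨F, hF, z, hz, rfl⟩ := hx'
  obtain ⟨I, hI, hFI⟩ := exists_isBasisSet_superset hF
  obtain ⟨W, hW, h⟩ := exists_eq_cexp_mul_fill (X := P.X) (e := (Subtype.val : I → Fin d))
    (b := hI.basis) Subtype.val_injective (isBasis_val ⟨I, hI⟩) (z := z) fun j hj => by
      rw [ne_eq, hz j]
      exact fun h => hj ⟨⟨j, hFI h⟩, rfl⟩
  set u : I → ℂ := toSlice P.X (Subtype.val : I → Fin d) hI.basis z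
  have hu : u ∈ (P.maxChart ⟨I, hI⟩).dom := by
    refine ⟨F, hF, fun j => ?_⟩
    rw [← hz j, pI_eq_fill, h, Pi.mul_apply, mul_eq_zero, or_iff_right (cexp_ne_zero _ _)]
  let u' : (P.maxChart ⟨I, hI⟩).dom := ⟨u, hu⟩
  refine ⟨⟨I, hI⟩, u', Subtype.ext ?_⟩
  obtain ⟨g, hg, hgz⟩ := exists_NC_smul_eq_iff.2
    ⟨W, logGroup_mono P.X bot_le hW, show (z : Fin d → ℂ) = cexp W * (maxPoint u').1 by
      rw [h, maxPoint_coe]; rfl⟩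
  change P.toSpace (maxPoint u') = P.toSpace z
  rw [← hgz, toSpace_smul_of_mem hg]

theorem maxChart_compatible [FiniteDimensional ℝ 𝔡]
    (I J : {I : Finset (Fin d) // P.IsBasisSet I}) :
    (P.maxChart I).Compatible (P.maxChart J) := by
  refine ComplexChart.compatible_of_exists (isOpen_maxDom I.1) fun x y hxy => ?_
  obtain ⟨Z, hZ, h⟩ := (maxChart_proj_eq_iff x y).1 hxy
  obtain ⟨f, hx, hfx, hd, hd', hf⟩ := exists_transition Subtype.val_injective (isBasis_val I)
    Subtype.val_injective (isBasis_val J) hZ h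
  refine ⟨f, hx, hfx, hd, hd', fun u hu => ?_⟩
  obtain ⟨W, hW, hWu⟩ := hf (maxCoord u) hu
  have hmem := mem_maxDom_of_eq u hWu
  exact ⟨hmem, ((maxChart_proj_eq_iff u ⟨f (maxCoord u), hmem⟩).2 ⟨W, hW, hWu⟩).symm⟩

theorem maxPiece_isComplexQuasifold [FiniteDimensional ℝ 𝔡] :
    IsComplexQuasifold (Module.finrank ℝ 𝔡) P.maxChart where
  isChart := maxChart_isChart
  finrank_eq I := by
    change Module.finrank ℂ (I.1 → ℂ) = _
    rw [Module.finrank_fintype_fun_eq_card, Fintype.card_coe, I.2.card_eq]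
  cover := maxChart_cover
  compatible := maxChart_compatible

end MaxChart

end ToricDatum

namespace ToricDatum

variable {𝔡 : Type u} [AddCommGroup 𝔡] [Module ℝ 𝔡] {d : ℕ} {P : ToricDatum 𝔡 d}

open TorusSlice

/-! ### The normals modulo those of a face -/

variable (P) in
/-- The normals of the facets that do not contain the face `F`, modulo the normal span of `F`. -/
def quotX (F : Finset (Fin d)) (j : {j // j ∉ F}) : 𝔡 ⧸ P.normalSpan F :=
  (P.normalSpan F).mkQ (P.X j)

variable (P) in
/-- The image of the quasilattice modulo the normal span of `F`. -/
def quotQ (F : Finset (Fin d)) : AddSubgroup (𝔡 ⧸ P.normalSpan F) :=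
  P.Q.map (P.normalSpan F).mkQ.toAddMonoidHom

/-- The restriction of a vector to the coordinates outside `F`. -/
def compl (F : Finset (Fin d)) (z : Fin d → ℂ) : {j // j ∉ F} → ℂ := fun j => z j

theorem sum_eq_sum_compl {M : Type*} [AddCommMonoid M] {F : Finset (Fin d)} {f : Fin d → M}
    (hf : ∀ j ∈ F, f j = 0) : ∑ j, f j = ∑ j : {j // j ∉ F}, f j := by
  rw [← Fintype.sum_subtype_add_sum_subtype (· ∈ F) f,
    Finset.sum_eq_zero fun j _ => hf j.1 j.2, zero_add]

theorem sum_smul_quotX (F : Finset (Fin d)) (a : Fin d → ℝ) :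
    ∑ j : {j // j ∉ F}, a j • P.quotX F j = (P.normalSpan F).mkQ (∑ j, a j • P.X j) := by
  rw [map_sum, sum_eq_sum_compl (F := F) (f := fun j => (P.normalSpan F).mkQ (a j • P.X j))]
  · exact Finset.sum_congr rfl fun j _ => by rw [map_smul]; rfl
  · intro j hj
    rw [Submodule.mkQ_apply, Submodule.Quotient.mk_eq_zero]
    exact Submodule.smul_mem _ _ (P.X_mem_normalSpan hj)

theorem compl_mem_logGroup (F : Finset (Fin d)) {Z : Fin d → ℂ} (hZ : Z ∈ logGroup P.X P.Q) :
    compl F Z ∈ logGroup (P.quotX F) (P.quotQ F) := by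
  refine ⟨?_, ?_⟩
  · have h : (P.normalSpan F).mkQ (∑ j, (Z j).re • P.X j) ∈ P.quotQ F := ⟨_, hZ.1, rfl⟩
    rw [← sum_smul_quotX F fun j => (Z j).re] at h
    exact h
  · have h := sum_smul_quotX (P := P) F fun j => (Z j).im
    rw [hZ.2, map_zero] at h
    exact h

/-- Extend `W` by zero; the errors lie in the normal span of `F` and are absorbed by the coordinates
in `F`. -/
theorem exists_compl_eq {F : Finset (Fin d)} {W : {j // j ∉ F} → ℂ}
    (hW : W ∈ logGroup (P.quotX F) (P.quotQ F)) : ∃ Z ∈ logGroup P.X P.Q, compl F Z = W := by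
  let Y : Fin d → ℂ := fun j => if h : j ∉ F then W ⟨j, h⟩ else 0
  have hY : ∀ j : {j // j ∉ F}, Y j = W j := fun j => dif_pos j.2
  have h1 : ∑ j : {j // j ∉ F}, (W j).re • P.quotX F j =
      (P.normalSpan F).mkQ (∑ j, (Y j).re • P.X j) := by
    rw [← sum_smul_quotX F fun j => (Y j).re]
    exact Finset.sum_congr rfl fun j _ => by rw [hY]
  have h2 : ∑ j : {j // j ∉ F}, (W j).im • P.quotX F j =
      (P.normalSpan F).mkQ (∑ j, (Y j).im • P.X j) := by
    rw [← sum_smul_quotX F fun j => (Y j).im]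
    exact Finset.sum_congr rfl fun j _ => by rw [hY]
  obtain ⟨⟨q, hq, hqW⟩, him⟩ := hW
  rw [h1] at hqW
  rw [h2, Submodule.mkQ_apply, Submodule.Quotient.mk_eq_zero] at him
  have hre : q - ∑ j, (Y j).re • P.X j ∈ P.normalSpan F :=
    (Submodule.Quotient.eq _).1 hqW
  obtain ⟨a, ha, hasum⟩ := P.mem_normalSpan_iff.1 hre
  obtain ⟨c, hc, hcsum⟩ := P.mem_normalSpan_iff.1 him
  -- `a` moves the real part of the sum to `q`, and `-c` cancels its imaginary part.
  refine ⟨fun j => Y j + (a j - c j * Complex.I), ⟨?_, ?_⟩, funext fun j => ?_⟩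
  · have : ∀ j, (Y j + (a j - c j * Complex.I)).re = (Y j).re + a j := by simp
    simp only [this, add_smul, Finset.sum_add_distrib, hasum, add_sub_cancel]
    exact hq
  · have : ∀ j, (Y j + (a j - c j * Complex.I)).im = (Y j).im - c j := fun j => by
      simp [sub_eq_add_neg]
    simp only [this, sub_smul, Finset.sum_sub_distrib, hcsum, sub_self]
  · simp [compl, hY, ha j j.2, hc j j.2]

/-- On the stratum the coordinates in `F` are zero, so only the normals modulo those of `F` matter,
and the slice construction applies in the quotient space. -/
theorem exists_NC_smul_eq_iff_compl {F : Finset (Fin d)} {z w : P.CΔ}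
    (hz : z ∈ P.coordStratum F) (hw : w ∈ P.coordStratum F) : (∃ g ∈ P.NC, g • z = w) ↔
    ∃ W ∈ logGroup (P.quotX F) (P.quotQ F), compl F w = cexp W * compl F z := by
  rw [exists_NC_smul_eq_iff]
  constructor
  · rintro ⟨Z, hZ, h⟩
    exact ⟨_, compl_mem_logGroup F hZ, by rw [h]; rfl⟩
  · rintro ⟨W, hW, h⟩
    obtain ⟨Z, hZ, rfl⟩ := exists_compl_eq hW
    refine ⟨Z, hZ, funext fun j => ?_⟩
    by_cases hj : j ∈ F
    · rw [Pi.mul_apply, (hz j).2 hj, (hw j).2 hj, mul_zero]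
    · exact congrFun h ⟨j, hj⟩

/-! ### The pieces of the singular faces -/

/-- The inclusion of `I \ F` into the complement of `F`. -/
def sdiffEmb (I F : Finset (Fin d)) (i : ↥(I \ F)) : {j // j ∉ F} :=
  ⟨i, (Finset.mem_sdiff.1 i.2).2⟩

theorem sdiffEmb_injective (I F : Finset (Fin d)) : Function.Injective (sdiffEmb I F) :=
  fun _ _ h => Subtype.ext (congrArg (fun j : {j // j ∉ F} => (j : Fin d)) h)

theorem mem_range_sdiffEmb {I F : Finset (Fin d)} {j : {j // j ∉ F}} :
    j ∈ Set.range (sdiffEmb I F) ↔ (j : Fin d) ∈ I := by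
  constructor
  · rintro ⟨i, rfl⟩
    exact (Finset.mem_sdiff.1 i.2).1
  · exact fun h => ⟨⟨j, Finset.mem_sdiff.2 ⟨h, j.2⟩⟩, rfl⟩

theorem compl_pF (F I : Finset (Fin d)) (z : ↥(I \ F) → ℂ) :
    compl F (pF F I z) = fill (sdiffEmb I F) z := by
  funext j
  by_cases hj : (j : Fin d) ∈ I
  · have hj' : (j : Fin d) ∈ I \ F := Finset.mem_sdiff.2 ⟨hj, j.2⟩
    rw [compl, pF, dif_pos hj']
    exact (fill_apply (sdiffEmb_injective I F) z ⟨j, hj'⟩).symm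
  · have hj' : (j : Fin d) ∉ I \ F := fun h => hj (Finset.mem_sdiff.1 h).1
    rw [compl, pF, dif_neg hj', if_neg j.2, fill_of_notMem]
    rwa [mem_range_sdiffEmb]

section PieceChart

variable [FiniteDimensional ℝ 𝔡] {F : Finset (Fin d)} {hF : P.IsSingular F}

/-- The index type of the atlas of a piece. -/
abbrev PieceIndex (P : ToricDatum 𝔡 d) (F : Finset (Fin d)) : Type :=
  {I : Finset (Fin d) // P.IsBasisSet I ∧ (I ∩ F).card + P.faceDim F = Module.finrank ℝ 𝔡}

omit [FiniteDimensional ℝ 𝔡] in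
theorem PieceIndex.card_sdiff (I : PieceIndex P F) : (I.1 \ F).card = P.faceDim F := by
  have h1 := Finset.card_sdiff_add_card_inter I.1 F
  have h2 := I.2.1.card_eq
  have h3 := I.2.2
  omega

omit [FiniteDimensional ℝ 𝔡] in
theorem top_le_span_quotX (I : PieceIndex P F) :
    ⊤ ≤ Submodule.span ℝ (Set.range fun i => P.quotX F (sdiffEmb I.1 F i)) := by
  rw [← LinearMap.range_eq_top.2 (P.normalSpan F).mkQ_surjective, ← Submodule.map_top, ← I.2.1.2.1,
    Submodule.map_span, Submodule.span_le]
  rintro _ ⟨_, ⟨j, hj, rfl⟩, rfl⟩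
  by_cases hjF : j ∈ F
  · rw [Submodule.mkQ_apply, (Submodule.Quotient.mk_eq_zero _).2 (P.X_mem_normalSpan hjF)]
    exact zero_mem _
  · exact Submodule.subset_span ⟨⟨j, Finset.mem_sdiff.2 ⟨hj, hjF⟩⟩, rfl⟩

/-- The basis of the quotient by the normal span of `F` given by the normals in `I \ F`. -/
noncomputable def pieceBasis (hF : P.IsFace F) (I : PieceIndex P F) :
    Module.Basis ↥(I.1 \ F) ℝ (𝔡 ⧸ P.normalSpan F) :=
  basisOfTopLeSpanOfCardEqFinrank (fun i => P.quotX F (sdiffEmb I.1 F i)) (top_le_span_quotX I) (by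
    have h1 := finrank_normalSpan_add_faceDim hF
    have h2 := (P.normalSpan F).finrank_quotient_add_finrank
    rw [Fintype.card_coe, I.card_sdiff]
    omega)

theorem pieceBasis_apply (hF : P.IsFace F) (I : PieceIndex P F) (i : ↥(I.1 \ F)) :
    P.quotX F (sdiffEmb I.1 F i) = pieceBasis hF I i := by
  simp [pieceBasis]

variable {I : PieceIndex P F}

omit [FiniteDimensional ℝ 𝔡] in
theorem isOpen_pieceDom (I F : Finset (Fin d)) : IsOpen {z : ↥(I \ F) → ℂ | ∀ j, z j ≠ 0} := by
  simp only [Set.ofPred_forall]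
  exact isOpen_iInter_of_finite fun j => isOpen_ne_fun (continuous_apply j) continuous_const

omit [FiniteDimensional ℝ 𝔡]

/-- The coordinates of a point of the chart. -/
def pieceCoord (z : (P.pieceChart F hF I).dom) : ↥(I.1 \ F) → ℂ := z.1

theorem continuous_pieceCoord :
    Continuous (pieceCoord : (P.pieceChart F hF I).dom → ↥(I.1 \ F) → ℂ) :=
  continuous_subtype_val

/-- The point of `ℂ^d_Δ` with the coordinates `z`. -/
def piecePoint (z : (P.pieceChart F hF I).dom) : P.coordStratum F :=
  ⟨⟨pF F I.1 (pieceCoord z), F, hF.1, fun j hj => (pF_eq_zero_iff z.2 j).1 hj⟩,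
    fun j => pF_eq_zero_iff z.2 j⟩

theorem compl_piecePoint (z : (P.pieceChart F hF I).dom) :
    compl F (piecePoint z : P.CΔ) = fill (sdiffEmb I.1 F) (pieceCoord z) := compl_pF _ _ _

theorem pieceChart_proj (z : (P.pieceChart F hF I).dom) :
    (P.pieceChart F hF I).proj z = Set.MapsTo.restrict P.toSpace (P.coordStratum F) (P.piece F)
        (mapsTo_toSpace_piece hF.1) (piecePoint z) := rfl

theorem restrict_piece_eq_iff (hF : P.IsFace F) (z w : P.coordStratum F) :
    Set.MapsTo.restrict P.toSpace (P.coordStratum F) (P.piece F)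
        (mapsTo_toSpace_piece hF) z = Set.MapsTo.restrict P.toSpace (P.coordStratum F) (P.piece F)
        (mapsTo_toSpace_piece hF) w ↔
      ∃ W ∈ logGroup (P.quotX F) (P.quotQ F), compl F (w : P.CΔ) = cexp W * compl F (z : P.CΔ) := by
  rw [← exists_NC_smul_eq_iff_compl z.2 w.2, ← toSpace_eq_iff_of_mem_coordStratum hF hF z.2 w.2,
    ← Subtype.val_inj]
  rfl

theorem pieceChart_proj_eq_iff {J : PieceIndex P F} (x : (P.pieceChart F hF I).dom)
    (y : (P.pieceChart F hF J).dom) :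
    (P.pieceChart F hF I).proj x = (P.pieceChart F hF J).proj y ↔
      ∃ W ∈ logGroup (P.quotX F) (P.quotQ F),
        fill (sdiffEmb J.1 F) (pieceCoord y) = cexp W * fill (sdiffEmb I.1 F) (pieceCoord x) := by
  rw [pieceChart_proj, pieceChart_proj, restrict_piece_eq_iff hF.1, compl_piecePoint, compl_piecePoint]

theorem continuous_piecePoint :
    Continuous (piecePoint : (P.pieceChart F hF I).dom → P.coordStratum F) := by
  refine Continuous.subtype_mk (Continuous.subtype_mk (continuous_pi fun j => ?_) _) _
  by_cases hj : j ∈ I.1 \ F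
  · simp only [pF, dif_pos hj]
    exact (continuous_apply _).comp continuous_pieceCoord
  · simp only [pF, dif_neg hj]
    exact continuous_const

theorem ne_zero_of_fill_eq {J : Finset (Fin d)} (x : (P.pieceChart F hF I).dom)
    {y : ↥(J \ F) → ℂ} {W : {j // j ∉ F} → ℂ}
    (h : fill (sdiffEmb J F) y = cexp W * fill (sdiffEmb I.1 F) (pieceCoord x)) (i : ↥(J \ F)) :
    y i ≠ 0 := by
  rw [← fill_apply (sdiffEmb_injective J F) y i, h, Pi.mul_apply, ← compl_piecePoint]
  refine mul_ne_zero (cexp_ne_zero _ _) fun h0 => ?_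
  exact (sdiffEmb J F i).2 (((piecePoint x).2 _).1 h0)

/-- The group consists of restrictions to `I \ F`, so it acts faithfully, and no coordinate vanishes
on the domain. -/
theorem pieceChart_nonFree : (P.pieceChart F hF I).nonFree = ∅ := by
  rw [Set.eq_empty_iff_forall_notMem]
  rintro x ⟨hx, γ, hγ, h⟩
  exact hγ (Subtype.ext (funext fun i => Units.ext (mul_eq_right₀ (hx i) |>.1 (congrFun h i))))

variable [FiniteDimensional ℝ 𝔡]

/-- The saturation of an open part of the slice is open in the stratum, and the stratum maps openly
onto the piece. -/
theorem pieceChart_isOpenMap_proj : IsOpenMap (P.pieceChart F hF I).proj := by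
  intro U hU
  have hU' : IsOpen (Subtype.val '' U : Set (↥(I.1 \ F) → ℂ)) :=
    (isOpen_pieceDom I.1 F).isOpenMap_subtype_val U hU
  have hcont : Continuous fun z : P.coordStratum F => compl F (z : P.CΔ) :=
    continuous_pi fun j =>
      (continuous_apply (j : Fin d)).comp (continuous_subtype_val.comp continuous_subtype_val)
  have hV := (isOpen_saturation (sdiffEmb_injective I.1 F) (pieceBasis_apply hF.1 I)
    (P.quotQ F) hU').preimage hcont
  convert (isOpenQuotientMap_piece hF.1).isOpenMap _ hV using 1
  ext x
  constructor
  · rintro ⟨u, hu, rfl⟩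
    exact ⟨piecePoint u, ⟨0, zero_mem _, _, ⟨u, hu, rfl⟩, by
      rw [cexp_zero, one_mul]; exact compl_piecePoint u⟩, rfl⟩
  · rintro ⟨z, ⟨W, hW, _, ⟨u, hu, rfl⟩, h⟩, rfl⟩
    refine ⟨u, hu, (restrict_piece_eq_iff hF.1 (piecePoint u) z).2 ?_⟩
    exact ⟨W, hW, h.trans (congrArg (cexp W * ·) (compl_piecePoint u).symm)⟩

theorem pieceChart_isChart (hF : P.IsSingular F) (I : PieceIndex P F) :
    (P.pieceChart F hF I).IsChart where
  isOpen_dom := isOpen_pieceDom I.1 F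
  isConnected_dom := isConnected_forall_ne_zero ↥(I.1 \ F)
  mapsTo γ x hx := fun i => mul_ne_zero (Units.ne_zero _) (hx i)
  one_act x _ := funext fun j => one_mul _
  mul_act γ γ' x _ := funext fun j => mul_assoc _ _ _
  holomorphic γ := by
    change DifferentiableOn ℂ (fun z : ↥(I.1 \ F) → ℂ => fun j : ↥(I.1 \ F) =>
      ((γ : (P.ΓI I.1).map (restrict (I.1 \ F))).1 j : ℂ) * z j) _
    fun_prop
  closed_nonFree := by
    rw [pieceChart_nonFree]
    exact isClosed_empty
  codim_nonFree := Or.inl pieceChart_nonFree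
  continuous_proj := (isOpenQuotientMap_piece hF.1).continuous.comp continuous_piecePoint
  isOpenMap_proj := pieceChart_isOpenMap_proj
  proj_eq_iff x y := by
    rw [pieceChart_proj_eq_iff]
    constructor
    · rintro ⟨W, hW, h⟩
      obtain ⟨Z, hZ, rfl⟩ := exists_compl_eq hW
      have hoff : ∀ j, j ∉ I.1 → j ∉ F → cexp Z j = 1 := fun j hj hjF => by
        have hj' : (⟨j, hjF⟩ : {j // j ∉ F}) ∉ Set.range (sdiffEmb I.1 F) := by
          rwa [mem_range_sdiffEmb]
        have := congrFun h ⟨j, hjF⟩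
        rw [Pi.mul_apply, fill_of_notMem _ hj', fill_of_notMem _ hj', mul_one] at this
        exact this.symm
      obtain ⟨γ, hγ, hγZ⟩ := exists_mem_ΓI I.2.1 (I.2.1.normalSpan_inter hF.1 I.2.2) hZ hoff
      refine ⟨⟨restrict _ γ, ⟨γ, hγ, rfl⟩⟩, funext fun (i : ↥(I.1 \ F)) => ?_⟩
      change (γ i : ℂ) * pieceCoord x i = pieceCoord y i
      have := congrFun h (sdiffEmb I.1 F i)
      rw [Pi.mul_apply, fill_apply (sdiffEmb_injective I.1 F),
        fill_apply (sdiffEmb_injective I.1 F)] at this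
      have hi := Finset.mem_sdiff.1 i.2
      rw [hγZ i hi.1 hi.2]
      exact this.symm
    · rintro ⟨⟨_, γ, hγ, rfl⟩, h⟩
      obtain ⟨Z, hZ, rfl⟩ := exists_logGroup_of_mem_ΓI hγ
      refine ⟨compl F Z, compl_mem_logGroup F hZ, ?_⟩
      rw [show pieceCoord y = fun i : ↥(I.1 \ F) => cexp Z i * pieceCoord x i from h.symm]
      funext j
      by_cases hj : j ∈ Set.range (sdiffEmb I.1 F)
      · obtain ⟨i, rfl⟩ := hj
        rw [Pi.mul_apply, fill_apply (sdiffEmb_injective I.1 F),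
          fill_apply (sdiffEmb_injective I.1 F)]
        rfl
      · rw [Pi.mul_apply, fill_of_notMem _ hj, fill_of_notMem _ hj, mul_one]
        rw [mem_range_sdiffEmb] at hj
        change 1 = (expC Z (j : Fin d) : ℂ)
        rw [hγ.2 j hj, Units.val_one]

theorem pieceChart_cover (hF : P.IsSingular F) (x : P.piece F) :
    ∃ I, x ∈ Set.range (P.pieceChart F hF I).proj := by
  obtain ⟨z, rfl⟩ := (isOpenQuotientMap_piece hF.1).surjective x
  obtain ⟨I, hI⟩ := P.exists_isBasisSet hF.1
  let I' : PieceIndex P F := ⟨I, hI⟩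
  have hne : ∀ j, compl F (z : P.CΔ) j ≠ 0 := fun j h => j.2 ((z.2 _).1 h)
  obtain ⟨W, hW, h⟩ := exists_eq_cexp_mul_fill (sdiffEmb_injective I F)
    (pieceBasis_apply hF.1 I') fun j _ => hne j
  set u : ↥(I \ F) → ℂ := toSlice (P.quotX F) (sdiffEmb I F) (pieceBasis hF.1 I') (compl F z.1)
  have hu : ∀ i, u i ≠ 0 := fun i h0 => hne (sdiffEmb I F i) (by
    rw [h, Pi.mul_apply, fill_apply (sdiffEmb_injective I F), h0, mul_zero])
  let u' : (P.pieceChart F hF I').dom := ⟨u, hu⟩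
  refine ⟨I', u', (restrict_piece_eq_iff hF.1 (piecePoint u') z).2 ?_⟩
  exact ⟨W, logGroup_mono _ bot_le hW,
    h.trans (congrArg (cexp W * ·) (compl_piecePoint u').symm)⟩

theorem pieceChart_compatible (hF : P.IsSingular F) (I J : PieceIndex P F) :
    (P.pieceChart F hF I).Compatible (P.pieceChart F hF J) := by
  refine ComplexChart.compatible_of_exists (isOpen_pieceDom I.1 F) fun x y hxy => ?_
  obtain ⟨Z, hZ, h⟩ := (pieceChart_proj_eq_iff x y).1 hxy
  obtain ⟨f, hx, hfx, hd, hd', hf⟩ := exists_transition (sdiffEmb_injective I.1 F)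
    (pieceBasis_apply hF.1 I) (sdiffEmb_injective J.1 F) (pieceBasis_apply hF.1 J) hZ h
  refine ⟨f, hx, hfx, hd, hd', fun u hu => ?_⟩
  obtain ⟨W, hW, hWu⟩ := hf (pieceCoord u) hu
  have hmem := ne_zero_of_fill_eq u hWu
  exact ⟨hmem, ((pieceChart_proj_eq_iff u ⟨f (pieceCoord u), hmem⟩).2 ⟨W, hW, hWu⟩).symm⟩

theorem piece_isComplexQuasifold (hF : P.IsSingular F) :
    IsComplexQuasifold (P.faceDim F) (P.pieceChart F hF) where
  isChart := pieceChart_isChart hF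
  finrank_eq I := by
    change Module.finrank ℂ (↥(I.1 \ F) → ℂ) = _
    rw [Module.finrank_fintype_fun_eq_card, Fintype.card_coe, PieceIndex.card_sdiff I]
  cover := pieceChart_cover hF
  compatible := pieceChart_compatible hF

end PieceChart

/-! ### Holomorphy of the action -/

attribute [local instance] quasitorusAction

/-- The coordinates with respect to the basis of a basis set of a point of the complexification
given by its coordinates with respect to another basis. -/
noncomputable def basisCoord {I : Finset (Fin d)} (hI : P.IsBasisSet I) {ι : Type*} [Fintype ι]
    (b : Module.Basis ι ℝ 𝔡) : (ι → ℂ) →ₗ[ℂ] (I → ℂ) :=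
  (complexCoord b).trans (complexCoord hI.basis).symm

/-- The extension by zero of `basisCoord`. -/
noncomputable def basisLift {I : Finset (Fin d)} (hI : P.IsBasisSet I) {ι : Type*} [Fintype ι]
    (b : Module.Basis ι ℝ 𝔡) (y : ι → ℂ) : Fin d → ℂ :=
  fun j => if h : j ∈ I then basisCoord hI b y ⟨j, h⟩ else 0

theorem πC_basisLift {I : Finset (Fin d)} (hI : P.IsBasisSet I) {ι : Type*} [Fintype ι]
    (b : Module.Basis ι ℝ 𝔡) (y : ι → ℂ) : P.πC (basisLift hI b y) = complexCoord b y := by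
  have h : complexCoord hI.basis (basisCoord hI b y) = complexCoord b y :=
    (complexCoord hI.basis).apply_symm_apply _
  rw [← h, πC_apply, complexCoord_apply, ← Finset.sum_subset (Finset.subset_univ I)
    fun j _ hj => by simp only [basisLift, dif_neg hj, zero_smul], ← Finset.sum_coe_sort I]
  exact Finset.sum_congr rfl fun j _ => by
    have := j.2
    simp only [basisLift, dif_pos this, hI.basis_apply]

theorem expC_basisLift_of_notMem {I : Finset (Fin d)} (hI : P.IsBasisSet I) {ι : Type*} [Fintype ι]
    (b : Module.Basis ι ℝ 𝔡) (y : ι → ℂ) {j : Fin d} (hj : j ∉ I) :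
    (expC (basisLift hI b y) j : ℂ) = 1 := by
  rw [expC_apply, cexp, basisLift, dif_neg hj, mul_zero, Complex.exp_zero]

theorem differentiable_expC_basisLift {I : Finset (Fin d)} (hI : P.IsBasisSet I) {ι : Type*}
    [Fintype ι] (b : Module.Basis ι ℝ 𝔡) (j : Fin d) :
    Differentiable ℂ fun y => (expC (basisLift hI b y) j : ℂ) := by
  by_cases hj : j ∈ I
  · have h : Differentiable ℂ (basisCoord hI b) :=
      (LinearMap.toContinuousLinearMap (basisCoord hI b)).differentiable
    have hv : ∀ y, (expC (basisLift hI b y) j : ℂ) =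
        Complex.exp (2 * Real.pi * Complex.I * basisCoord hI b y ⟨j, hj⟩) := fun y => by
      rw [expC_apply, cexp, basisLift, dif_pos hj]
    simp only [hv]
    exact ((differentiable_pi.1 h ⟨j, hj⟩).const_mul _).cexp
  · simp only [expC_basisLift_of_notMem hI b _ hj]
    exact differentiable_const _

theorem mk_complexCoord_vadd {I : Finset (Fin d)} (hI : P.IsBasisSet I) {ι : Type*} [Fintype ι]
    (b : Module.Basis ι ℝ 𝔡) (y : ι → ℂ) (z : P.CΔ) :
    (QuotientAddGroup.mk (complexCoord b y) : P.DC) +ᵥ P.toSpace z =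
      P.toSpace (expC (basisLift hI b y) • z) := by
  rw [← πC_basisLift hI, mk_vadd_toSpace]

theorem continuous_restricted_vadd {T : Set P.Space} (h : ∀ (g : P.DC), ∀ x ∈ T, g +ᵥ x ∈ T) :
    Continuous fun p : P.DC × T => (⟨p.1 +ᵥ (p.2 : P.Space), h p.1 p.2 p.2.2⟩ : T) :=
  (continuous_vadd_space.comp
    (continuous_fst.prodMk (continuous_subtype_val.comp continuous_snd))).subtype_mk _

/-- A point of `𝔡_ℂ` has a lift to `ℂ^d` supported on `I`, whose exponential is 1 outside `I` and so
preserves the slice. Hence the action lifts on the whole product chart to multiplication by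
exponentials of linear forms. -/
theorem actsHolomorphicallyOn_maxPiece [FiniteDimensional ℝ 𝔡] :
    P.ActsHolomorphicallyOn P.maxPiece P.maxChart := by
  have hinv : ∀ (g : P.DC), ∀ x ∈ P.maxPiece, g +ᵥ x ∈ P.maxPiece := by
    intro g x hx
    rw [maxPiece_eq_iUnion] at hx ⊢
    simp only [Set.mem_iUnion, Set.mem_ofPred_eq, exists_prop] at hx ⊢
    obtain ⟨F, hF, hx⟩ := hx
    exact ⟨F, hF, face_vadd_invariant hF.1 g hx⟩
  refine ⟨hinv, continuous_restricted_vadd hinv, ?_⟩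
  rintro ⟨b, I⟩ x
  let G : (Fin (Module.finrank ℝ 𝔡) → ℂ) × (I.1 → ℂ) → I.1 → ℂ :=
    fun p i => (expC (basisLift I.2 b p.1) i : ℂ) * p.2 i
  have hG : Differentiable ℂ G := differentiable_pi.2 fun i =>
    ((differentiable_expC_basisLift I.2 b i).comp differentiable_fst).mul
      (differentiable_pi.1 differentiable_snd i)
  refine ⟨I, (P.prodAtlas P.maxChart (b, I)).dom, G, isOpen_univ.prod (isOpen_maxDom I.1), x.2,
    subset_rfl, hG.differentiableOn, fun u _ => ?_⟩
  have hmem : G u.1 ∈ (P.maxChart I).dom := by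
    obtain ⟨F, hF, h⟩ := mem_maxDom_iff.1 u.2.2
    exact mem_maxDom_iff.2 ⟨F, hF, fun j hj =>
      h j ((mul_eq_zero.1 hj).resolve_left (Units.ne_zero _))⟩
  refine ⟨hmem, Subtype.ext ?_⟩
  let u₁ : Fin (Module.finrank ℝ 𝔡) → ℂ := u.1.1
  let u₂ : (P.maxChart I).dom := ⟨u.1.2, u.2.2⟩
  change P.toSpace (maxPoint ⟨G u.1, hmem⟩) =
    (QuotientAddGroup.mk (complexCoord b u₁) : P.DC) +ᵥ P.toSpace (maxPoint u₂)
  rw [mk_complexCoord_vadd I.2]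
  congr 1
  refine Subtype.ext (funext fun j => ?_)
  rw [smul_apply]
  change pI I.1 (G (u₁, maxCoord u₂)) j = _ * pI I.1 (maxCoord u₂) j
  by_cases hj : j ∈ I.1
  · rw [pI_coe _ ⟨j, hj⟩, pI_coe _ ⟨j, hj⟩]
  · rw [pI_of_notMem _ hj, pI_of_notMem _ hj, expC_basisLift_of_notMem I.2 b _ hj, mul_one]

/-- The same lift as on the maximal piece works; its factors on `I ∩ F` multiply zeros. -/
theorem actsHolomorphicallyOn_piece [FiniteDimensional ℝ 𝔡] {F : Finset (Fin d)}
    (hF : P.IsSingular F) : P.ActsHolomorphicallyOn (P.piece F) (P.pieceChart F hF) := by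
  have hinv : ∀ (g : P.DC), ∀ x ∈ P.piece F, g +ᵥ x ∈ P.piece F := by
    rw [piece_eq_faceOrbit hF.1]
    exact fun g x hx => face_vadd_invariant hF.1 g hx
  refine ⟨hinv, continuous_restricted_vadd hinv, ?_⟩
  rintro ⟨b, I⟩ x
  let G : (Fin (Module.finrank ℝ 𝔡) → ℂ) × (↥(I.1 \ F) → ℂ) → ↥(I.1 \ F) → ℂ :=
    fun p i => (expC (basisLift I.2.1 b p.1) i : ℂ) * p.2 i
  have hG : Differentiable ℂ G := differentiable_pi.2 fun i =>
    ((differentiable_expC_basisLift I.2.1 b i).comp differentiable_fst).mul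
      (differentiable_pi.1 differentiable_snd i)
  refine ⟨I, (P.prodAtlas (P.pieceChart F hF) (b, I)).dom, G,
    isOpen_univ.prod (isOpen_pieceDom I.1 F), x.2, subset_rfl, hG.differentiableOn, fun u _ => ?_⟩
  have hmem : G u.1 ∈ (P.pieceChart F hF I).dom :=
    fun i => mul_ne_zero (Units.ne_zero _) (u.2.2 i)
  refine ⟨hmem, Subtype.ext ?_⟩
  let u₁ : Fin (Module.finrank ℝ 𝔡) → ℂ := u.1.1
  let u₂ : (P.pieceChart F hF I).dom := ⟨u.1.2, u.2.2⟩
  change P.toSpace (piecePoint ⟨G u.1, hmem⟩).1 =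
    (QuotientAddGroup.mk (complexCoord b u₁) : P.DC) +ᵥ P.toSpace (piecePoint u₂).1
  rw [mk_complexCoord_vadd I.2.1]
  congr 1
  refine Subtype.ext (funext fun j => ?_)
  rw [smul_apply]
  change pF F I.1 (G (u₁, pieceCoord u₂)) j = _ * pF F I.1 (pieceCoord u₂) j
  by_cases hj : j ∈ I.1 \ F
  · rw [pF, pF, dif_pos hj, dif_pos hj]
  · rw [pF, pF, dif_neg hj, dif_neg hj]
    split_ifs with hjF
    · rw [mul_zero]
    · rw [expC_basisLift_of_notMem I.2.1 b _ fun h => hj (Finset.mem_sdiff.2 ⟨h, hjF⟩), mul_one]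

end ToricDatum

/-- The homeomorphism of `(ℂ^*)^{F^c} / N_ℂ` with `𝒯_F` is expressed by a quotient map from the
stratum whose fibres are the `N_ℂ`-orbits. -/
theorem mainTheorem7 {𝔡 : Type*} [AddCommGroup 𝔡] [Module ℝ 𝔡] [FiniteDimensional ℝ 𝔡] {d : ℕ}
    (P : ToricDatum 𝔡 d) :
    IsComplexQuasifold (Module.finrank ℝ 𝔡) P.quasitorusChart ∧
    IsComplexQuasifold (Module.finrank ℝ 𝔡) P.maxChart ∧
    (∀ (F : Finset (Fin d)) (hF : P.IsSingular F),
      IsComplexQuasifold (P.faceDim F) (P.pieceChart F hF)) ∧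
    ∃ _ : AddAction P.DC P.Space,
      (∀ (Z : Fin d → ℂ) (z : P.CΔ),
        (QuotientAddGroup.mk (P.πC Z) : P.DC) +ᵥ P.toSpace z = P.toSpace (ToricDatum.expC Z • z)) ∧
      Continuous (fun p : P.DC × P.Space => p.1 +ᵥ p.2) ∧
      (∀ F, P.IsFace F → ∃ x, AddAction.orbit P.DC x = P.faceOrbit F) ∧
      (∃ x, AddAction.orbit P.DC x = P.faceOrbit ∅) ∧
      IsOpen (P.faceOrbit ∅) ∧ Dense (P.faceOrbit ∅) ∧
      P.ActsHolomorphicallyOn P.maxPiece P.maxChart ∧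
      (∀ (F : Finset (Fin d)) (hF : P.IsSingular F),
        P.ActsHolomorphicallyOn (P.piece F) (P.pieceChart F hF)) ∧
      (∀ F, P.IsSingular F → P.piece F = P.faceOrbit F ∧
        (∀ z ∈ P.coordStratum F, ∀ w ∈ P.coordStratum F,
          P.toSpace z = P.toSpace w ↔ ∃ g ∈ P.NC, g • z = w) ∧
        ∃ h : Set.MapsTo P.toSpace (P.coordStratum F) (P.piece F), Topology.IsQuotientMap h.restrict) ∧
      P.maxPiece = ⋃ F ∈ {F | P.IsRegular F}, P.faceOrbit F := by
  refine ⟨ToricDatum.quasitorus_isComplexQuasifold, ToricDatum.maxPiece_isComplexQuasifold,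
    fun F hF => ToricDatum.piece_isComplexQuasifold hF, P.quasitorusAction,
    ToricDatum.mk_vadd_toSpace, ToricDatum.continuous_vadd_space,
    fun F hF => ToricDatum.exists_orbit_eq_faceOrbit hF,
    ToricDatum.exists_orbit_eq_faceOrbit P.isFace_empty, ToricDatum.isOpen_faceOrbit_empty,
    ToricDatum.dense_faceOrbit_empty, ToricDatum.actsHolomorphicallyOn_maxPiece,
    fun F hF => ToricDatum.actsHolomorphicallyOn_piece hF, fun F hF =>
    ⟨ToricDatum.piece_eq_faceOrbit hF.1, fun z hz w hw =>
      ToricDatum.toSpace_eq_iff_of_mem_coordStratum hF.1 hF.1 hz hw,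
      ToricDatum.mapsTo_toSpace_piece hF.1,
      (ToricDatum.isOpenQuotientMap_piece hF.1).isQuotientMap⟩,
    ToricDatum.maxPiece_eq_iUnion⟩
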